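/- Let $\Omega$ be the category of non-empty finite rooted trees, a morphism $S\to T$ being a morphism $\Omega(S)\to\Omega(T)$ between the coloured symmetric operads freely generated by the vertices. A dendroidal set is a presheaf of sets $X$ on $\Omega$; it is normal if for every tree $T$ the group $\mathrm{Aut}(T)$ acts freely on $X_T$. Write $|T|$ for the number of vertices of $T$, and $P_T$ for the set of planar structures on $T$ (a linear order on the inputs of each vertex); $P$ is a presheaf on $\Omega$. A planar structure $p$ labels the vertices of $T$ by $0,\dots,|T|-1$ in depth-first order, starting from the root vertex and taking the branches from left to right, and $\mathrm{sgn}(p',p)$ is the sign of the permutation of labels taking the labelling induced by $p'$ to the one induced by $p$. The elementary faces $\partial_a\colon\partial_aT\to T$ are: the inner faces (contract an inner edge), with sign $\mathrm{sgn}_p(\partial_a)=(-1)^k$, where $k$ is the label of the vertex above the edge; the top faces (chop off a vertex all of whose inputs are leaves, together with its inputs), with sign $(-1)^{k+1}$, where $k$ is the label of that vertex; and the bottom faces (chop off the root vertex, keeping the part of $T$ above one of its inputs $e$, provided that all its other inputs are leaves), with sign $+1$. For a dendroidal set $X$ let $\mathrm{Ch}^{un}(X)_n$ be the free abelian group on the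 triples $(T,p,x)$ with $|T|=n$, $p\in P_T$, $x\in X_T$, modulo the relations $(T,p,x)=\mathrm{sgn}(p',\tau^*p)\,(T',p',\tau^*x)$ for all isomorphisms $\tau\colon T'\to T$ and all $p'\in P_{T'}$; write $[T,p,x]$ for the class of $(T,p,x)$, and put $$d[T,p,x]=\sum_{\partial_a}\mathrm{sgn}_p(\partial_a)\,[\partial_aT,\partial_a^*p,\partial_a^*x],$$ the sum running over the elementary faces of $T$. Let $D(X)_n\subseteq\mathrm{Ch}^{un}(X)_n$ be the subgroup generated by the classes of degenerate dendrices, i.e. of those in the image of $\sigma_e^*$ for some elementary degeneracy $\sigma_e\colon\sigma_eS\to S$ (where $\sigma_eS$ is $S$ with an additional unary vertex inserted on the edge $e$). Then, for every normal dendroidal set $X$: the map $d$ is well defined, $d^2=0$, $D(X)$ is a subcomplex of $\mathrm{Ch}^{un}(X)$, and the quotient map $$\mathrm{Ch}^{un}(X)\longrightarrow \mathrm{Ch}(X):=\mathrm{Ch}^{un}(X)/D(X)$$ is a quasi-isomorphism. -/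

import Mathlib

open CategoryTheory

universe u

/-- A finite, non-empty, rooted tree with edge set `E`. A vertex has exactly one output edge, and
distinct vertices have distinct output edges, so a vertex is identified with its output edge:
`vert` is the set of those edges which are the output of a vertex (the other edges are the leaves).
If `e ≠ root`, then `e` is an input of the vertex `next e`; at the root, which is not an input of any
vertex, `next` takes the dummy value `root`. -/
structure OTree : Type 1 where
  E : Type
  finite : Finite E
  root : E
  next : E → E
  next_root : next root = root
  reach : ∀ e, ∃ n : ℕ, next^[n] e = root
  vert : Set E
  next_mem : ∀ e, e ≠ root → next e ∈ vert

namespace OTree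

instance (T : OTree) : Finite T.E := T.finite

noncomputable instance (T : OTree) : Fintype T.E := Fintype.ofFinite _

/-- The number `|T|` of vertices. -/
noncomputable def size (T : OTree) : ℕ := Nat.card T.vert

open Classical in
/-- The set of inputs of the vertex `v`. -/
noncomputable def inputs (T : OTree) (v : T.E) : Finset T.E :=
  Finset.univ.filter fun e => e ≠ T.root ∧ T.next e = v

theorem mem_inputs {T : OTree} {v e : T.E} : e ∈ T.inputs v ↔ e ≠ T.root ∧ T.next e = v := by
  simp [inputs]

theorem reach_of_height {E : Type} (root : E) (next : E → E) (h : E → ℕ)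
    (hh : ∀ e, e ≠ root → h (next e) < h e) (e : E) : ∃ n : ℕ, next^[n] e = root := by
  induction hk : h e using Nat.strong_induction_on generalizing e with
  | _ k ih =>
    by_cases he : e = root
    · exact ⟨0, he⟩
    · obtain ⟨n, hn⟩ := ih _ (hk ▸ hh e he) (next e) rfl
      exact ⟨n + 1, hn⟩

theorem iterate_root (T : OTree) (n : ℕ) : T.next^[n] T.root = T.root := by
  induction n with
  | zero => rfl
  | succ n ih => rw [Function.iterate_succ_apply, T.next_root, ih]

open Classical in
/-- The distance of an edge from the root. -/
noncomputable def height (T : OTree) (e : T.E) : ℕ := Nat.find (T.reach e)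

theorem height_next (T : OTree) (e : T.E) (he : e ≠ T.root) :
    T.height e = T.height (T.next e) + 1 := by
  classical
  apply le_antisymm
  · exact Nat.find_min' (T.reach e) (Nat.find_spec (T.reach (T.next e)))
  · have h1 := Nat.find_spec (T.reach e)
    have h0 : T.height e ≠ 0 := fun h => he (by
      have : T.next^[T.height e] e = T.root := h1
      rwa [h] at this)
    obtain ⟨k, hk⟩ := Nat.exists_eq_succ_of_ne_zero h0
    have h2 : T.next^[k] (T.next e) = T.root := by
      have : T.next^[T.height e] e = T.root := h1
      rwa [hk] at this
    have : T.height (T.next e) ≤ k := Nat.find_min' _ h2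
    omega

theorem height_next_le (T : OTree) (e : T.E) : T.height (T.next e) ≤ T.height e := by
  by_cases he : e = T.root
  · rw [he, T.next_root]
  · have := T.height_next e he; omega

theorem height_iterate_le (T : OTree) (n : ℕ) (e : T.E) : T.height (T.next^[n] e) ≤ T.height e := by
  induction n generalizing e with
  | zero => exact le_rfl
  | succ n ih => exact (ih _).trans (T.height_next_le e)

/-- The order on edges: `a ≤ x` if `a` lies on the path from `x` down to the root. -/
instance (T : OTree) : PartialOrder T.E where
  le a x := ∃ n : ℕ, T.next^[n] x = a
  le_refl a := ⟨0, rfl⟩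
  le_trans := by
    rintro a b c ⟨n, rfl⟩ ⟨m, rfl⟩
    exact ⟨n + m, Function.iterate_add_apply _ _ _ _⟩
  le_antisymm := by
    rintro a b ⟨n, rfl⟩ ⟨m, hm⟩
    cases n with
    | zero => rfl
    | succ n =>
      by_cases hb : b = T.root
      · rw [hb, iterate_root]
      · exfalso
        have h1 := T.height_next b hb
        have h2 := T.height_iterate_le n (T.next b)
        have h3 := T.height_iterate_le m (T.next^[n + 1] b)
        rw [hm] at h3
        rw [Function.iterate_succ_apply] at h3
        omega

theorem le_def {T : OTree} {a x : T.E} : a ≤ x ↔ ∃ n : ℕ, T.next^[n] x = a := Iff.rfl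

theorem next_le {T : OTree} (x : T.E) : T.next x ≤ x := ⟨1, rfl⟩

theorem root_le {T : OTree} (x : T.E) : T.root ≤ x := T.reach x

theorem next_ne {T : OTree} {x : T.E} (hx : x ≠ T.root) : T.next x ≠ x := fun h => by
  have := T.height_next x hx
  rw [h] at this
  omega

theorem next_lt {T : OTree} {x : T.E} (hx : x ≠ T.root) : T.next x < x :=
  lt_of_le_of_ne (next_le x) (next_ne hx)

theorem le_next_of_lt {T : OTree} {a x : T.E} (h : a < x) : a ≤ T.next x := by
  obtain ⟨n, hn⟩ := h.le
  cases n with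
  | zero => exact absurd hn h.ne'
  | succ n => exact ⟨n, hn⟩

theorem ne_root_of_lt {T : OTree} {a x : T.E} (h : a < x) : x ≠ T.root := by
  rintro rfl
  exact absurd (root_le a) (not_le_of_gt h)

theorem comparable {T : OTree} {a b x : T.E} (ha : a ≤ x) (hb : b ≤ x) : a ≤ b ∨ b ≤ a := by
  obtain ⟨n, rfl⟩ := ha
  obtain ⟨m, rfl⟩ := hb
  rcases le_total n m with h | h
  · right
    refine ⟨m - n, ?_⟩
    rw [← Function.iterate_add_apply, Nat.sub_add_cancel h]
  · left
    refine ⟨n - m, ?_⟩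
    rw [← Function.iterate_add_apply, Nat.sub_add_cancel h]

theorem exists_child {T : OTree} {a x : T.E} (h : a < x) :
    ∃ b, b ≤ x ∧ b ≠ T.root ∧ T.next b = a := by
  obtain ⟨n, hn⟩ := h.le
  induction n generalizing x with
  | zero => exact absurd hn h.ne'
  | succ n ih =>
    have hx := ne_root_of_lt h
    rcases eq_or_lt_of_le (le_next_of_lt h) with h1 | h1
    · exact ⟨x, le_rfl, hx, h1.symm⟩
    · obtain ⟨b, hb, hb'⟩ := ih h1 hn
      exact ⟨b, hb.trans (next_le x), hb'⟩

/-- Two edges are siblings if they are inputs of the same vertex. -/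
def Sib (T : OTree) (a b : T.E) : Prop := a ≠ T.root ∧ b ≠ T.root ∧ T.next a = T.next b

theorem Sib.lt_of_lt {T : OTree} {a b u : T.E} (h : T.Sib a b) (hu : u < a) : u < b :=
  lt_of_le_of_lt ((le_next_of_lt hu).trans_eq h.2.2) (next_lt h.2.1)

theorem Sib.symm {T : OTree} {a b : T.E} (h : T.Sib a b) : T.Sib b a := ⟨h.2.1, h.1, h.2.2.symm⟩

theorem Sib.not_lt {T : OTree} {a b : T.E} (h : T.Sib a b) : ¬ a < b :=
  fun h' => lt_irrefl _ (h.symm.lt_of_lt h')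

theorem Sib.eq_of_le {T : OTree} {a b : T.E} (h : T.Sib a b) (h' : a ≤ b) : a = b :=
  h'.eq_or_lt.resolve_right h.not_lt

theorem exists_sib {T : OTree} {u v : T.E} (h1 : ¬ u ≤ v) (h2 : ¬ v ≤ u) :
    ∃ a b, T.Sib a b ∧ a ≠ b ∧ a ≤ u ∧ b ≤ v := by
  induction hk : T.height u using Nat.strong_induction_on generalizing u with
  | _ k ih =>
    have hu : u ≠ T.root := by rintro rfl; exact h1 (root_le v)
    by_cases h3 : T.next u ≤ v
    · have h4 : T.next u < v := lt_of_le_of_ne h3 (by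
        rintro rfl; exact h2 (next_le u))
      obtain ⟨b, hb, hb', hb''⟩ := exists_child h4
      refine ⟨u, b, ⟨hu, hb', hb''.symm⟩, ?_, le_rfl, hb⟩
      rintro rfl; exact h1 hb
    · obtain ⟨a, b, hs, hn, ha, hb⟩ := ih (T.height (T.next u))
        (by rw [← hk, T.height_next u hu]; omega) h3 (fun h => h2 (h.trans (next_le u))) rfl
      exact ⟨a, b, hs, hn, ha.trans (next_le u), hb⟩

/-! ### The category `Ω` -/

/-- The coloured symmetric operad `Ω(T)` freely generated by the vertices of `T` has the edges as
colours, and for colours `c₁, …, cₖ, c` the set of operations `Ω(T)(c₁, …, cₖ; c)` is either empty or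
a singleton; whether it is inhabited does not depend on the order of the inputs.
`T.Op {c₁, …, cₖ} c` says that it is inhabited: operations are generated from identities by composing
with vertices at the inputs. -/
inductive Op (T : OTree) : Multiset T.E → T.E → Prop
  | id (e : T.E) : Op T {e} e
  | comp (m : Multiset T.E) (x e : T.E) (hx : x ∈ T.vert) :
      Op T (x ::ₘ m) e → Op T ((T.inputs x).val + m) e

/-- Morphisms of `Ω`: morphisms of operads `Ω(S) → Ω(T)`. As `Ω(S)` is free on the vertices of `S` and
`Ω(T)` has at most one operation with given inputs and output, such a morphism is a map of colours
for which the image of every generator exists. -/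
@[ext]
structure Hom (S T : OTree) where
  toFun : S.E → T.E
  map_vert : ∀ v ∈ S.vert, T.Op ((S.inputs v).val.map toFun) (toFun v)

theorem Op.vertex {T : OTree} {v : T.E} (hv : v ∈ T.vert) : T.Op (T.inputs v).val v := by
  simpa using Op.comp 0 v v hv (Op.id v)

theorem Op.subst {T : OTree} {m m' : Multiset T.E} {x e : T.E} (h : T.Op (x ::ₘ m) e)
    (h' : T.Op m' x) : T.Op (m' + m) e := by
  induction h' with
  | id x => simpa using h
  | comp m' y x hy _ ih =>
    have := ih h
    rw [Multiset.cons_add] at this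
    have := Op.comp _ _ _ hy this
    rwa [← add_assoc] at this

theorem Op.map {S T : OTree} (f : Hom S T) {m : Multiset S.E} {e : S.E} (h : S.Op m e) :
    T.Op (m.map f.toFun) (f.toFun e) := by
  induction h with
  | id e => simpa using Op.id (f.toFun e)
  | comp m x e hx _ ih =>
    rw [Multiset.map_cons] at ih
    rw [Multiset.map_add]
    exact ih.subst (f.map_vert x hx)

/-- The category `Ω` of trees. -/
instance : Category.{0} OTree where
  Hom := Hom
  id T := ⟨fun e => e, fun v hv => by simpa using Op.vertex hv⟩
  comp f g := ⟨fun e => g.toFun (f.toFun e), fun v hv => by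
    simpa using Op.map g (f.map_vert v hv)⟩

/-- The map on edges of a morphism of trees. -/
def onEdges {S T : OTree} (f : S ⟶ T) : S.E → T.E := Hom.toFun f

theorem Op.antichain {T : OTree} {m : Multiset T.E} {e : T.E} (h : T.Op m e) :
    m.Nodup ∧ ∀ x ∈ m, ∀ y ∈ m, x ≤ y → x = y := by
  induction h with
  | id e => simp
  | comp m x e hx _ ih =>
    obtain ⟨hn, hi⟩ := ih
    rw [Multiset.nodup_cons] at hn
    have key : ∀ y ∈ (T.inputs x).val, ∀ z ∈ m, ¬ y ≤ z ∧ ¬ z ≤ y := by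
      intro y hy z hz
      have hy' := mem_inputs.1 (Finset.mem_def.2 hy)
      have hxy : x < y := hy'.2 ▸ next_lt hy'.1
      have hxz : x ≠ z := by rintro rfl; exact hn.1 hz
      have h1 : ¬ x ≤ z := fun h => hxz (hi x (by simp) z (by simp [hz]) h)
      have h2 : ¬ z ≤ x := fun h => hxz (hi z (by simp [hz]) x (by simp) h).symm
      refine ⟨fun h => h1 (hxy.le.trans h), fun h => ?_⟩
      rcases h.eq_or_lt with rfl | h
      · exact h1 hxy.le
      · exact h2 (hy'.2 ▸ le_next_of_lt h)
    refine ⟨?_, ?_⟩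
    · rw [Multiset.nodup_add]
      refine ⟨(T.inputs x).nodup, hn.2, ?_⟩
      rw [Multiset.disjoint_left]
      intro a ha ha'
      exact (key a ha a ha').1 le_rfl
    · intro a ha b hb hab
      rw [Multiset.mem_add] at ha hb
      rcases ha with ha | ha <;> rcases hb with hb | hb
      · have ha' := mem_inputs.1 (Finset.mem_def.2 ha)
        have hb' := mem_inputs.1 (Finset.mem_def.2 hb)
        exact Sib.eq_of_le ⟨ha'.1, hb'.1, ha'.2.trans hb'.2.symm⟩ hab
      · exact absurd hab (key a ha b hb).1
      · exact absurd hab (key b hb a ha).2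
      · exact hi a (by simp [ha]) b (by simp [hb]) hab

theorem Hom.sib_eq {S T : OTree} (f : S ⟶ T) {a b : S.E} (h : S.Sib a b)
    (hab : onEdges f a ≤ onEdges f b) : a = b := by
  obtain ⟨hn, hi⟩ := (f.map_vert (S.next a) (S.next_mem a h.1)).antichain
  have ha : a ∈ (S.inputs (S.next a)).val := mem_inputs.2 ⟨h.1, rfl⟩
  have hb : b ∈ (S.inputs (S.next a)).val := mem_inputs.2 ⟨h.2.1, h.2.2.symm⟩
  have := hi _ (Multiset.mem_map_of_mem _ ha) _ (Multiset.mem_map_of_mem _ hb) hab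
  exact Multiset.inj_on_of_nodup_map hn a ha b hb this

/-! ### Planar structures -/

/-- A planar structure: a linear order (here its strict part) on the inputs of each vertex. -/
@[ext]
structure Planar (T : OTree) where
  lt : T.E → T.E → Prop
  sib : ∀ a b, lt a b → T.Sib a b
  irrefl : ∀ a, ¬ lt a a
  trans : ∀ a b c, lt a b → lt b c → lt a c
  total : ∀ a b, T.Sib a b → a ≠ b → lt a b ∨ lt b a

namespace Planar

variable {T : OTree} (p : Planar T)

/-- `x` is drawn to the left of `y`: their paths to the root enter some vertex through different
inputs, the one of `x` being the smaller. -/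
def LeftOf (x y : T.E) : Prop := ∃ a b, p.lt a b ∧ a ≤ x ∧ b ≤ y

variable {p}

theorem LeftOf.trans {x y z : T.E} (h1 : p.LeftOf x y) (h2 : p.LeftOf y z) : p.LeftOf x z := by
  obtain ⟨a, b, hab, ha, hb⟩ := h1
  obtain ⟨c, d, hcd, hc, hd⟩ := h2
  rcases comparable hb hc with h | h
  · rcases h.eq_or_lt with rfl | h
    · exact ⟨a, d, p.trans _ _ _ hab hcd, ha, hd⟩
    · exact ⟨a, b, hab, ha, ((p.sib _ _ hcd).lt_of_lt h).le.trans hd⟩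
  · rcases h.eq_or_lt with rfl | h
    · exact ⟨a, d, p.trans _ _ _ hab hcd, ha, hd⟩
    · exact ⟨c, d, hcd, ((p.sib _ _ hab).symm.lt_of_lt h).le.trans ha, hd⟩

theorem LeftOf.irrefl {x : T.E} : ¬ p.LeftOf x x := by
  rintro ⟨a, b, hab, ha, hb⟩
  have hs := p.sib _ _ hab
  rcases comparable ha hb with h | h
  · exact p.irrefl b (hs.eq_of_le h ▸ hab)
  · exact p.irrefl a (hs.symm.eq_of_le h ▸ hab)

theorem LeftOf.total {x y : T.E} (h1 : ¬ x ≤ y) (h2 : ¬ y ≤ x) : p.LeftOf x y ∨ p.LeftOf y x := by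
  obtain ⟨a, b, hs, hn, ha, hb⟩ := exists_sib h1 h2
  rcases p.total a b hs hn with h | h
  · exact Or.inl ⟨a, b, h, ha, hb⟩
  · exact Or.inr ⟨b, a, h, hb, ha⟩

variable (p)

/-- The presheaf of planar structures on morphisms: the inputs of a vertex `v` of `S` are sent by
`f : S ⟶ T` to the leaves of a subtree of `T`, and are ordered from left to right as these. -/
def pullback {S : OTree} (f : S ⟶ T) : Planar S where
  lt a b := S.Sib a b ∧ p.LeftOf (onEdges f a) (onEdges f b)
  sib _ _ h := h.1
  irrefl _ h := h.2.irrefl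
  trans _ _ _ h1 h2 := ⟨⟨h1.1.1, h2.1.2.1, h1.1.2.2.trans h2.1.2.2⟩, h1.2.trans h2.2⟩
  total _ _ hs hn := by
    rcases LeftOf.total (p := p) (fun h => hn (Hom.sib_eq f hs h))
      (fun h => hn (Hom.sib_eq f hs.symm h).symm) with h | h
    · exact Or.inl ⟨hs, h⟩
    · exact Or.inr ⟨hs.symm, h⟩

/-- The order in which vertices are labelled: a vertex comes before everything above it, and the
vertices on a branch come before those on the branches to its right. -/
def Before (u v : T.E) : Prop := u < v ∨ p.LeftOf u v

variable {p}

theorem Before.trans {u v w : T.E} (h1 : p.Before u v) (h2 : p.Before v w) : p.Before u w := by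
  rcases h1 with h1 | h1 <;> rcases h2 with h2 | h2
  · exact Or.inl (h1.trans h2)
  · obtain ⟨a, b, hab, ha, hb⟩ := h2
    rcases comparable h1.le ha with h | h
    · rcases h.eq_or_lt with rfl | h
      · exact Or.inr ⟨_, _, hab, le_rfl, hb⟩
      · exact Or.inl (((p.sib _ _ hab).lt_of_lt h).trans_le hb)
    · exact Or.inr ⟨_, _, hab, h, hb⟩
  · obtain ⟨a, b, hab, ha, hb⟩ := h1
    exact Or.inr ⟨a, b, hab, ha, hb.trans h2.le⟩
  · exact Or.inr (h1.trans h2)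

theorem Before.irrefl {u : T.E} : ¬ p.Before u u := by
  rintro (h | h)
  · exact lt_irrefl _ h
  · exact LeftOf.irrefl h

theorem Before.total {u v : T.E} (h : u ≠ v) : p.Before u v ∨ p.Before v u := by
  by_cases h1 : u ≤ v
  · exact Or.inl (Or.inl (lt_of_le_of_ne h1 h))
  by_cases h2 : v ≤ u
  · exact Or.inr (Or.inl (lt_of_le_of_ne h2 h.symm))
  rcases LeftOf.total (p := p) h1 h2 with h | h
  · exact Or.inl (Or.inr h)
  · exact Or.inr (Or.inr h)

variable (p)

/-- The label of a vertex: the number of vertices labelled before it. -/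
noncomputable def label (v : T.E) : ℕ := {u : T.vert | p.Before u v}.ncard

variable {p}

theorem label_lt_label {u v : T.E} (hu : u ∈ T.vert) (h : p.Before u v) :
    p.label u < p.label v := by
  apply Set.ncard_lt_ncard _ (Set.toFinite _)
  refine ⟨fun w hw => hw.trans h, fun hs => ?_⟩
  exact Before.irrefl (hs (show (⟨u, hu⟩ : T.vert) ∈ {w : T.vert | p.Before w v} from h))

theorem label_lt_size {v : T.E} (hv : v ∈ T.vert) : p.label v < T.size := by
  have : p.label v < (Set.univ : Set T.vert).ncard := by
    apply Set.ncard_lt_ncard _ (Set.toFinite _)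
    refine ⟨Set.subset_univ _, fun hs => ?_⟩
    exact Before.irrefl (hs (Set.mem_univ (⟨v, hv⟩ : T.vert)))
  rwa [Set.ncard_univ] at this

variable (p)

/-- The labelling of the vertices by `0, …, |T| - 1`. -/
noncomputable def labelling : T.vert ≃ Fin T.size :=
  Equiv.ofBijective (fun v => ⟨p.label v, label_lt_size v.2⟩) <| by
    rw [Nat.bijective_iff_injective_and_card]
    refine ⟨fun u v huv => ?_, by simp [size]⟩
    by_contra hne
    have huv' : p.label u = p.label v := congrArg Fin.val huv
    rcases Before.total (p := p) (fun h => hne (Subtype.ext h) : (u : T.E) ≠ v) with h | h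
    · exact absurd (label_lt_label u.2 h) (by omega)
    · exact absurd (label_lt_label v.2 h) (by omega)

/-- `sgn(p', p)`, the sign of the permutation of the labels which sends the labelling induced by `p'`
to the one induced by `p`. (The label `0` is fixed, and so does not contribute to the sign.) -/
noncomputable def sgn (p' p : Planar T) : ℤ :=
  Equiv.Perm.sign (p'.labelling.symm.trans p.labelling)

end Planar

/-! ### Elementary faces -/

/-- Elementary faces of `T`: inner faces, given by an inner edge `e`; top faces, given by a vertex `w`
all of whose inputs are leaves; bottom faces, given by an input `e` of the root vertex such that all
other inputs of the root vertex are leaves. -/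
inductive Face (T : OTree) : Type
  | inner (e : T.E) (he : e ≠ T.root) (hv : e ∈ T.vert)
  | top (w : T.E) (hw : w ∈ T.vert) (hl : ∀ e ∈ T.inputs w, e ∉ T.vert)
  | bottom (e : T.E) (he : e ∈ T.inputs T.root) (hl : ∀ e' ∈ T.inputs T.root, e' ≠ e → e' ∉ T.vert)

instance (T : OTree) : Finite T.Face := by
  refine Finite.of_injective (β := Fin 3 × T.E) (fun a => match a with
    | .inner e _ _ => (0, e)
    | .top w _ _ => (1, w)
    | .bottom e _ _ => (2, e)) ?_
  rintro (_ | _ | _) (_ | _ | _) h <;> simp_all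

noncomputable instance (T : OTree) : Fintype T.Face := Fintype.ofFinite _

open Classical in
/-- The tree obtained by contracting the inner edge `e`. -/
noncomputable def innerFace (T : OTree) (e : T.E) (he : e ≠ T.root) : OTree where
  E := {x : T.E // x ≠ e}
  finite := inferInstance
  root := ⟨T.root, he.symm⟩
  next x := if h : T.next x = e then ⟨T.next e, next_ne he⟩ else ⟨T.next x, h⟩
  next_root := by
    have h : ¬ T.next T.root = e := by rw [T.next_root]; exact he.symm
    rw [dif_neg h]
    exact Subtype.ext T.next_root
  reach := reach_of_height _ _ (fun x => T.height x) <| by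
    rintro ⟨x, hx⟩ hx'
    have hx' : x ≠ T.root := fun h => hx' (Subtype.ext h)
    have h1 := T.height_next x hx'
    dsimp only
    split_ifs with h
    · have h2 := T.height_next e he
      rw [h] at h1
      dsimp only
      omega
    · dsimp only
      omega
  vert := {x | (x : T.E) ∈ T.vert}
  next_mem := by
    rintro ⟨x, hx⟩ hx'
    have hx' : x ≠ T.root := fun h => hx' (Subtype.ext h)
    dsimp only
    split_ifs with h
    · exact T.next_mem e he
    · exact T.next_mem x hx'

/-- The tree obtained by chopping off the top vertex `w` and all its inputs. -/
noncomputable def topFace (T : OTree) (w : T.E) (hl : ∀ e ∈ T.inputs w, e ∉ T.vert) : OTree where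
  E := {x : T.E // x ∉ T.inputs w}
  finite := inferInstance
  root := ⟨T.root, fun h => (mem_inputs.1 h).1 rfl⟩
  next x := ⟨T.next x, fun h => by
    have hx : (x : T.E) ≠ T.root := by
      intro hx
      rw [hx, T.next_root] at h
      exact (mem_inputs.1 h).1 rfl
    exact hl _ h (T.next_mem x hx)⟩
  next_root := Subtype.ext T.next_root
  reach := reach_of_height _ _ (fun x => T.height x) <| by
    rintro ⟨x, hx⟩ hx'
    have hx' : x ≠ T.root := fun h => hx' (Subtype.ext h)
    have h1 := T.height_next x hx'
    dsimp only
    omega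
  vert := {x | (x : T.E) ∈ T.vert ∧ (x : T.E) ≠ w}
  next_mem := by
    rintro ⟨x, hx⟩ hx'
    have hx' : x ≠ T.root := fun h => hx' (Subtype.ext h)
    exact ⟨T.next_mem x hx', fun h => hx (mem_inputs.2 ⟨hx', h⟩)⟩

open Classical in
/-- The part of the tree above the edge `e`; this is the tree obtained by chopping off the root vertex
with the root and all inputs other than `e`, if these other inputs are leaves. -/
noncomputable def bottomFace (T : OTree) (e : T.E) : OTree where
  E := {x : T.E // e ≤ x}
  finite := inferInstance
  root := ⟨e, le_rfl⟩
  next x := if h : (x : T.E) = e then ⟨e, le_rfl⟩ else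
    ⟨T.next x, le_next_of_lt (lt_of_le_of_ne x.2 (Ne.symm h))⟩
  next_root := by simp
  reach := reach_of_height _ _ (fun x => T.height x) <| by
    rintro ⟨x, hx⟩ hx'
    have hx' : x ≠ e := fun h => hx' (Subtype.ext h)
    have h1 := T.height_next x (ne_root_of_lt (lt_of_le_of_ne hx hx'.symm))
    simp only [hx', dite_false]
    omega
  vert := {x | (x : T.E) ∈ T.vert}
  next_mem := by
    rintro ⟨x, hx⟩ hx'
    have hx' : x ≠ e := fun h => hx' (Subtype.ext h)
    simp only [hx', dite_false]
    exact T.next_mem x (ne_root_of_lt (lt_of_le_of_ne hx hx'.symm))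

theorem innerFace_mem_inputs {T : OTree} {e : T.E} (he : e ≠ T.root) {v x : (T.innerFace e he).E} :
    x ∈ (T.innerFace e he).inputs v ↔
      x.1 ∈ T.inputs v.1 ∨ (T.next e = v.1 ∧ x.1 ∈ T.inputs e) := by
  classical
  refine mem_inputs.trans ?_
  obtain ⟨v, hv⟩ := v
  obtain ⟨x, hx⟩ := x
  change ((⟨x, hx⟩ : {x : T.E // x ≠ e}) ≠ ⟨T.root, he.symm⟩ ∧
    (if h : T.next x = e then (⟨T.next e, next_ne he⟩ : {x : T.E // x ≠ e}) else ⟨T.next x, h⟩)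
      = ⟨v, hv⟩) ↔ x ∈ T.inputs v ∨ (T.next e = v ∧ x ∈ T.inputs e)
  rw [mem_inputs, mem_inputs]
  split_ifs with h
  · simp only [ne_eq, Subtype.mk.injEq, h]
    constructor
    · rintro ⟨h1, h2⟩
      exact Or.inr ⟨h2, h1, trivial⟩
    · rintro (⟨-, h2⟩ | ⟨h1, h2, -⟩)
      · exact absurd h2.symm hv
      · exact ⟨h2, h1⟩
  · simp [h]

theorem topFace_mem_inputs {T : OTree} {w : T.E} (hl : ∀ e ∈ T.inputs w, e ∉ T.vert)
    {v x : (T.topFace w hl).E} :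
    x ∈ (T.topFace w hl).inputs v ↔ x.1 ∈ T.inputs v.1 := by
  refine mem_inputs.trans (Iff.trans ?_ mem_inputs.symm)
  exact and_congr (not_congr Subtype.ext_iff) Subtype.ext_iff

theorem bottomFace_mem_inputs {T : OTree} {e : T.E} {v x : (T.bottomFace e).E} :
    x ∈ (T.bottomFace e).inputs v ↔ x.1 ∈ T.inputs v.1 := by
  classical
  refine mem_inputs.trans (Iff.trans ?_ mem_inputs.symm)
  obtain ⟨v, hv⟩ := v
  obtain ⟨x, hx⟩ := x
  change ((⟨x, hx⟩ : {x : T.E // e ≤ x}) ≠ ⟨e, le_rfl⟩ ∧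
    (if h : x = e then (⟨e, le_rfl⟩ : {x : T.E // e ≤ x}) else
      ⟨T.next x, le_next_of_lt (lt_of_le_of_ne hx (Ne.symm h))⟩) = ⟨v, hv⟩) ↔
    x ≠ T.root ∧ T.next x = v
  by_cases h : x = e
  · subst h
    simp only [ne_eq, not_true_eq_false, false_and, false_iff, not_and]
    rintro h rfl
    exact absurd (next_lt h) (not_lt_of_ge hv)
  · have h' := ne_root_of_lt (lt_of_le_of_ne hx (Ne.symm h))
    simp [h, h']

theorem Op.map_inputs {S T : OTree} {f : S.E → T.E} {v : S.E} {m : Multiset T.E} {e : T.E}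
    (h : T.Op m e) (hf : ∀ x ∈ S.inputs v, ∀ y ∈ S.inputs v, f x = f y → x = y)
    (hm : ∀ x, (∃ y ∈ S.inputs v, f y = x) ↔ x ∈ m) : T.Op ((S.inputs v).val.map f) e := by
  have h1 : ((S.inputs v).val.map f).Nodup :=
    Multiset.Nodup.map_on hf (S.inputs v).nodup
  rwa [(h1.ext h.antichain.1).2 fun x => by simpa using hm x]

namespace Face

variable {T : OTree}

/-- The elementary face `∂_a T`. -/
noncomputable def tree : T.Face → OTree
  | inner e he _ => T.innerFace e he
  | top w _ hl => T.topFace w hl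
  | bottom e _ _ => T.bottomFace e

/-- The elementary face map `∂_a : ∂_a T ⟶ T`; on edges it is the inclusion. -/
noncomputable def map : (a : T.Face) → (a.tree ⟶ T)
  | inner e he hv => Hom.mk (S := T.innerFace e he) Subtype.val <| by
      intro v hv'
      by_cases h : T.next e = v.1
      · have h1 : e ∈ (T.inputs v.1).val := mem_inputs.2 ⟨he, h⟩
        obtain ⟨m, hm⟩ := Multiset.exists_cons_of_mem h1
        have h2 := Op.vertex (T := T) (v := v.1) hv'
        have hem : e ∉ m := (Multiset.nodup_cons.1 (hm ▸ h2.antichain.1)).1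
        rw [hm] at h2
        refine (Op.comp _ _ _ hv h2).map_inputs
          (fun x _ y _ hxy => Subtype.val_injective hxy) fun x => ?_
        have h3 : x ∈ T.inputs v.1 ↔ x = e ∨ x ∈ m := by
          rw [← Finset.mem_val, hm, Multiset.mem_cons]
        rw [Multiset.mem_add, Finset.mem_val]
        constructor
        · rintro ⟨y, hy, rfl⟩
          rcases (innerFace_mem_inputs he).1 hy with hy | hy
          · exact Or.inr ((h3.1 hy).resolve_left y.2)
          · exact Or.inl hy.2
        · intro hx
          have hxe : x ≠ e := by
            rintro rfl
            rcases hx with hx | hx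
            · exact next_ne he (mem_inputs.1 hx).2
            · exact hem hx
          refine ⟨⟨x, hxe⟩, (innerFace_mem_inputs he).2 ?_, rfl⟩
          rcases hx with hx | hx
          · exact Or.inr ⟨h, hx⟩
          · exact Or.inl (h3.2 (Or.inr hx))
      · refine (Op.vertex (T := T) (v := v.1) hv').map_inputs
          (fun x _ y _ hxy => Subtype.val_injective hxy) fun x => ?_
        rw [Finset.mem_val]
        constructor
        · rintro ⟨y, hy, rfl⟩
          exact ((innerFace_mem_inputs he).1 hy).resolve_right fun h' => h h'.1
        · intro hx
          have hxe : x ≠ e := by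
            rintro rfl
            exact h (mem_inputs.1 hx).2
          exact ⟨⟨x, hxe⟩, (innerFace_mem_inputs he).2 (Or.inl hx), rfl⟩
  | top w hw hl => Hom.mk (S := T.topFace w hl) Subtype.val <| by
      intro v hv'
      refine (Op.vertex (T := T) (v := v.1) hv'.1).map_inputs
        (fun x _ y _ hxy => Subtype.val_injective hxy) fun x => ?_
      rw [Finset.mem_val]
      constructor
      · rintro ⟨y, hy, rfl⟩
        exact (topFace_mem_inputs hl).1 hy
      · intro hx
        exact ⟨⟨x, fun h => hv'.2 ((mem_inputs.1 hx).2.symm.trans (mem_inputs.1 h).2)⟩,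
          (topFace_mem_inputs hl).2 hx, rfl⟩
  | bottom e he hl => Hom.mk (S := T.bottomFace e) Subtype.val <| by
      intro v hv'
      refine (Op.vertex (T := T) (v := v.1) hv').map_inputs
        (fun x _ y _ hxy => Subtype.val_injective hxy) fun x => ?_
      rw [Finset.mem_val]
      constructor
      · rintro ⟨y, hy, rfl⟩
        exact bottomFace_mem_inputs.1 hy
      · intro hx
        exact ⟨⟨x, v.2.trans ((mem_inputs.1 hx).2 ▸ next_le x)⟩, bottomFace_mem_inputs.2 hx, rfl⟩

theorem size_add_one (a : T.Face) : a.tree.size + 1 = T.size := by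
  have key : ∀ (S : OTree) (f : S.E → T.E), Function.Injective f → ∀ w ∈ T.vert,
      (∀ x, x ∈ T.vert ∧ x ≠ w ↔ ∃ y ∈ S.vert, f y = x) → S.size + 1 = T.size := by
    intro S f hf w hw h
    have h1 : T.vert \ {w} = f '' S.vert := by
      ext x
      simpa using h x
    have h2 := Set.ncard_sdiff_singleton_add_one hw (Set.toFinite _)
    rw [h1, Set.ncard_image_of_injective _ hf] at h2
    exact h2
  cases a with
  | inner e he hv =>
    refine key (T.innerFace e he) Subtype.val Subtype.val_injective e hv fun x => ?_
    exact ⟨fun h => ⟨⟨x, h.2⟩, h.1, rfl⟩, by rintro ⟨y, hy, rfl⟩; exact ⟨hy, y.2⟩⟩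
  | top w hw hl =>
    refine key (T.topFace w hl) Subtype.val Subtype.val_injective w hw fun x => ?_
    exact ⟨fun h => ⟨⟨x, fun h' => hl x h' h.1⟩, h, rfl⟩, by rintro ⟨y, hy, rfl⟩; exact hy⟩
  | bottom e he hl =>
    have he' := mem_inputs.1 he
    have hr : T.root ∈ T.vert := he'.2 ▸ T.next_mem e he'.1
    refine key (T.bottomFace e) Subtype.val Subtype.val_injective T.root hr fun x => ?_
    constructor
    · rintro ⟨hx, hx'⟩
      refine ⟨⟨x, ?_⟩, hx, rfl⟩
      obtain ⟨b, hb, hb', hb''⟩ := exists_child (lt_of_le_of_ne (root_le x) (Ne.symm hx'))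
      by_cases hbe : b = e
      · exact hbe ▸ hb
      · have hbl := hl b (mem_inputs.2 ⟨hb', hb''⟩) hbe
        exfalso
        rcases hb.eq_or_lt with rfl | h
        · exact hbl hx
        · obtain ⟨c, -, hc, hc'⟩ := exists_child h
          exact hbl (hc' ▸ T.next_mem c hc)
    · rintro ⟨y, hy, rfl⟩
      refine ⟨hy, fun h => ?_⟩
      have h1 : e ≤ T.root := h ▸ y.2
      exact he'.1 (le_antisymm h1 (root_le e))

/-- The sign `sgn_p(∂_a)`, for a planar structure `p`. -/
noncomputable def sgn (p : Planar T) : T.Face → ℤ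
  | inner e _ _ => (-1) ^ p.label e
  | top w _ _ => (-1) ^ (p.label w + 1)
  | bottom _ _ _ => 1

end Face

/-! ### Elementary degeneracies -/

open Classical in
/-- The tree `σ_e T` obtained from `T` by adding a copy `none` of the edge `e = some e` and a unary
vertex with input `none` and output `some e`. -/
noncomputable def degen (T : OTree) (e : T.E) : OTree where
  E := Option T.E
  finite := inferInstance
  root := some T.root
  next
    | none => some e
    | some x => if x = T.root then some T.root else if T.next x = e then none else some (T.next x)
  next_root := by simp
  reach := reach_of_height _ _
    (fun x => match x with | none => 2 * T.height e + 1 | some x => 2 * T.height x) <| by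
      rintro (_ | x) hx
      · simp
      · have hx : x ≠ T.root := fun h => hx (congrArg some h)
        have h1 := T.height_next x hx
        simp only [hx, if_false]
        split_ifs with h
        · rw [h] at h1
          dsimp only
          omega
        · dsimp only
          omega
  vert := {x | match x with | none => e ∈ T.vert | some x => x ∈ T.vert ∨ x = e}
  next_mem := by
    rintro (_ | x) hx
    · simp
    · have hx : x ≠ T.root := fun h => hx (congrArg some h)
      simp only [hx, if_false]
      split_ifs with h
      · exact h ▸ T.next_mem x hx
      · exact Or.inl (T.next_mem x hx)

theorem size_degen (T : OTree) (e : T.E) : (T.degen e).size = T.size + 1 := by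
  classical
  have h2 := Set.ncard_sdiff_singleton_add_one (s := (T.degen e).vert) (a := some e) (Or.inr rfl)
    (Set.toFinite (α := Option T.E) _)
  have h3 : ((T.degen e).vert \ {some e}).ncard = T.vert.ncard := by
    symm
    apply Set.ncard_congr (fun x _ => if x = e then none else some x)
    · intro x hx
      by_cases h : x = e
      · subst h
        rw [if_pos rfl]
        exact ⟨hx, fun h => Option.some_ne_none _ (Set.mem_singleton_iff.1 h).symm⟩
      · rw [if_neg h]
        exact ⟨Or.inl hx, fun h' => h (Option.some_injective _ (Set.mem_singleton_iff.1 h'))⟩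
    · intro x y _ _ h
      split_ifs at h with h1 h2 h2
      · exact h1.trans h2.symm
      · exact Option.some_injective _ h
    · rintro (_ | x) ⟨hx, hx'⟩
      · exact ⟨e, hx, if_pos rfl⟩
      · have hx' : x ≠ e := fun h => hx' (congrArg some h)
        exact ⟨x, hx.resolve_right hx', if_neg hx'⟩
  have h4 : (T.degen e).size = (T.degen e).vert.ncard := rfl
  have h5 : T.size = T.vert.ncard := rfl
  omega

theorem degen_mem_inputs_none {T : OTree} {e : T.E} {x : Option T.E} :
    x ∈ (T.degen e).inputs (none : Option T.E) ↔ ∃ y ∈ T.inputs e, some y = x := by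
  classical
  refine mem_inputs.trans ?_
  rcases x with _ | x
  · constructor
    · rintro ⟨-, h⟩
      exact absurd h (Option.some_ne_none _)
    · rintro ⟨y, -, h⟩
      exact absurd h (Option.some_ne_none _)
  · change ((some x : Option T.E) ≠ some T.root ∧ (if x = T.root then some T.root else
      if T.next x = e then none else some (T.next x)) = none) ↔ _
    by_cases h1 : x = T.root <;> by_cases h2 : T.next x = e <;> simp [h1, h2, mem_inputs]

theorem degen_mem_inputs_some {T : OTree} {e v : T.E} {x : Option T.E} :
    x ∈ (T.degen e).inputs (some v : Option T.E) ↔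
      (v = e ∧ x = none) ∨ (v ≠ e ∧ ∃ y ∈ T.inputs v, some y = x) := by
  classical
  refine mem_inputs.trans ?_
  rcases x with _ | x
  · change ((none : Option T.E) ≠ some T.root ∧ some e = some v) ↔ _
    simp [eq_comm]
  · change ((some x : Option T.E) ≠ some T.root ∧ (if x = T.root then some T.root else
      if T.next x = e then none else some (T.next x)) = some v) ↔ _
    by_cases h1 : x = T.root
    · simp [h1, mem_inputs]
    · by_cases h2 : T.next x = e
      · simp [h1, h2, mem_inputs, eq_comm]
      · simp only [ne_eq, Option.some.injEq, h1, not_false_eq_true, if_false, h2, true_and,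
          mem_inputs, reduceCtorEq, and_false, false_or, exists_eq_right]
        constructor
        · rintro rfl
          exact ⟨h2, rfl⟩
        · exact fun h => h.2

/-- The elementary degeneracy map `σ_e : σ_e T ⟶ T`. -/
noncomputable def degenMap (T : OTree) (e : T.E) : T.degen e ⟶ T :=
  Hom.mk (S := T.degen e) (fun x => Option.getD x e) <| by
    rintro (_ | v) hv
    · refine (Op.vertex (T := T) (v := e) hv).map_inputs ?_ ?_
      · intro x hx y hy hxy
        obtain ⟨x, -, rfl⟩ := degen_mem_inputs_none.1 hx
        obtain ⟨y, -, rfl⟩ := degen_mem_inputs_none.1 hy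
        exact congrArg some hxy
      · intro x
        constructor
        · rintro ⟨y, hy, rfl⟩
          obtain ⟨y, hy', rfl⟩ := degen_mem_inputs_none.1 hy
          exact hy'
        · intro hx
          exact ⟨some x, degen_mem_inputs_none.2 ⟨x, hx, rfl⟩, rfl⟩
    · by_cases hve : v = e
      · subst hve
        refine (Op.id (T := T) v).map_inputs ?_ ?_
        · intro x hx y hy _
          have hx := (degen_mem_inputs_some.1 hx).resolve_right fun h => h.1 rfl
          have hy := (degen_mem_inputs_some.1 hy).resolve_right fun h => h.1 rfl
          exact hx.2.trans hy.2.symm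
        · intro x
          rw [Multiset.mem_singleton]
          constructor
          · rintro ⟨y, hy, rfl⟩
            have hy := (degen_mem_inputs_some.1 hy).resolve_right fun h => h.1 rfl
            exact congrArg (fun z => Option.getD z v) hy.2
          · rintro rfl
            exact ⟨(none : Option T.E), degen_mem_inputs_some.2 (Or.inl ⟨rfl, rfl⟩), rfl⟩
      · refine (Op.vertex (T := T) (v := v) (hv.resolve_right hve)).map_inputs ?_ ?_
        · intro x hx y hy hxy
          obtain ⟨-, x, -, rfl⟩ := (degen_mem_inputs_some.1 hx).resolve_left fun h => hve h.1
          obtain ⟨-, y, -, rfl⟩ := (degen_mem_inputs_some.1 hy).resolve_left fun h => hve h.1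
          exact congrArg some hxy
        · intro x
          constructor
          · rintro ⟨y, hy, rfl⟩
            obtain ⟨-, y, hy', rfl⟩ := (degen_mem_inputs_some.1 hy).resolve_left fun h => hve h.1
            exact hy'
          · intro hx
            exact ⟨some x, degen_mem_inputs_some.2 (Or.inr ⟨hve, x, hx, rfl⟩), rfl⟩

end OTree

/-! ### Dendroidal sets and their chain complexes -/

/-- Dendroidal sets: presheaves of sets on the category `Ω` of trees. -/
abbrev DSet := OTreeᵒᵖ ⥤ Type u

namespace DSet

variable (X : DSet.{u})

/-- The set `X_T` of `T`-dendrices of `X`. -/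
abbrev Dendrex (T : OTree) : Type u := X.obj (Opposite.op T)

variable {X} in
/-- The map `f^* : X_T → X_S` induced by `f : S ⟶ T`. -/
def res {S T : OTree} (f : S ⟶ T) (x : X.Dendrex T) : X.Dendrex S := X.map f.op x

/-- `X` is normal: for every tree `T` the group `Aut(T)` acts freely on `X_T`. -/
def IsNormal : Prop := ∀ (T : OTree) (τ : T ≅ T) (x : X.Dendrex T), res τ.hom x = x → τ = Iso.refl T

variable {X} in
/-- A dendrex is degenerate if it is in the image of `σ_e^*` for an elementary degeneracy map `σ_e`
(where the source of `σ_e` may be replaced by an isomorphic tree). -/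
def IsDegenerate {T : OTree} (x : X.Dendrex T) : Prop :=
  ∃ (S : OTree) (e : S.E) (φ : T ≅ S.degen e) (y : X.Dendrex S), x = res φ.hom (res (S.degenMap e) y)

/-- The triples `(T, p, x)` with `T` a tree with `n` vertices, `p` a planar structure on `T` and
`x ∈ X_T`. -/
structure Gen (n : ℕ) where
  tree : OTree
  size_eq : tree.size = n
  planar : tree.Planar
  dendrex : X.Dendrex tree

/-- The free abelian group `C(X)_n` on the triples `(T, p, x)`. -/
abbrev C (n : ℕ) : Type (max 1 u) := X.Gen n →₀ ℤ

/-- The subgroup `A(X)_n` of `C(X)_n` generated by the elements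
`(T, p, x) - sgn(p', τ^* p) (T', p', τ^* x)`, for `τ : T' ≅ T` and `p'` a planar structure on `T'`. -/
noncomputable def A (n : ℕ) : Submodule ℤ (X.C n) :=
  Submodule.span ℤ {c | ∃ (g g' : X.Gen n) (τ : g'.tree ≅ g.tree), g'.dendrex = res τ.hom g.dendrex ∧
    c = Finsupp.single g 1 -
      Finsupp.single g' (OTree.Planar.sgn g'.planar (g.planar.pullback τ.hom))}

variable {X} in
/-- The triple `(∂_a T, p_a, ∂_a^* x)`. -/
noncomputable def Gen.face {n : ℕ} (g : X.Gen (n + 1)) (a : g.tree.Face) : X.Gen n where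
  tree := a.tree
  size_eq := Nat.succ_injective (a.size_add_one.trans g.size_eq)
  planar := g.planar.pullback a.map
  dendrex := res a.map g.dendrex

/-- The differential on representatives: `(T, p, x) ↦ ∑_a sgn_p(∂_a) (∂_a T, p_a, ∂_a^* x)`. -/
noncomputable def boundary (n : ℕ) : X.C (n + 1) →ₗ[ℤ] X.C n :=
  Finsupp.linearCombination ℤ fun g => ∑ a : g.tree.Face, Finsupp.single (g.face a) (a.sgn g.planar)

/-- The group `Ch^{un}(X)_n = C(X)_n / A(X)_n`. -/
abbrev UnGroup (n : ℕ) : Type (max 1 u) := X.C n ⧸ X.A n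

/-- The subgroup `D(X)_n` of `Ch^{un}(X)_n` generated by the classes of degenerate dendrices. -/
noncomputable def D (n : ℕ) : Submodule ℤ (X.UnGroup n) :=
  Submodule.span ℤ {c | ∃ g : X.Gen n, IsDegenerate g.dendrex ∧
    c = (X.A n).mkQ (Finsupp.single g 1)}

/-- The differential is well defined on classes. -/
def BoundaryDescends : Prop := ∀ n, X.A (n + 1) ≤ (X.A n).comap (X.boundary n)

variable {X}

/-- The differential `d : Ch^{un}(X)_{n+1} → Ch^{un}(X)_n`. -/
noncomputable def d (h : X.BoundaryDescends) (n : ℕ) : X.UnGroup (n + 1) →ₗ[ℤ] X.UnGroup n :=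
  (X.A (n + 1)).mapQ (X.A n) (X.boundary n) (h n)

/-- The unnormalized chain complex `Ch^{un}(X)`. -/
noncomputable def chUn (h : X.BoundaryDescends) (hd : ∀ n, d h n ∘ₗ d h (n + 1) = 0) :
    ChainComplex (ModuleCat.{max 1 u} ℤ) ℕ :=
  ChainComplex.of (fun n => ModuleCat.of ℤ (X.UnGroup n)) (fun n => ModuleCat.ofHom (d h n))
    fun n => by rw [← ModuleCat.ofHom_comp, hd n]; rfl

/-- The normalized chain complex `Ch(X) = Ch^{un}(X) / D(X)`. -/
noncomputable def ch (h : X.BoundaryDescends) (hd : ∀ n, d h n ∘ₗ d h (n + 1) = 0)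
    (hD : ∀ n, X.D (n + 1) ≤ (X.D n).comap (d h n)) : ChainComplex (ModuleCat.{max 1 u} ℤ) ℕ :=
  ChainComplex.of (fun n => ModuleCat.of ℤ (X.UnGroup n ⧸ X.D n))
    (fun n => ModuleCat.ofHom ((X.D (n + 1)).mapQ (X.D n) (d h n) (hD n)))
    fun n => by
      refine ModuleCat.hom_ext (LinearMap.ext fun x => ?_)
      obtain ⟨x, rfl⟩ := (X.D (n + 1 + 1)).mkQ_surjective x
      exact congrArg (X.D n).mkQ (LinearMap.congr_fun (hd n) x)

/-- The quotient map `Ch^{un}(X) → Ch(X)`. -/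
noncomputable def chUnToCh (h : X.BoundaryDescends) (hd : ∀ n, d h n ∘ₗ d h (n + 1) = 0)
    (hD : ∀ n, X.D (n + 1) ≤ (X.D n).comap (d h n)) : chUn h hd ⟶ ch h hd hD :=
  ChainComplex.ofHom (fun n => ModuleCat.ofHom (X.D n).mkQ) fun n => by
    have h1 : (chUn h hd).d (n + 1) n = ModuleCat.ofHom (d h n) :=
      ChainComplex.of_d (fun n => ModuleCat.of ℤ (X.UnGroup n)) (fun n => ModuleCat.ofHom (d h n)) n
    have h2 : (ch h hd hD).d (n + 1) n =
        ModuleCat.ofHom ((X.D (n + 1)).mapQ (X.D n) (d h n) (hD n)) :=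
      ChainComplex.of_d (fun n => ModuleCat.of ℤ (X.UnGroup n ⧸ X.D n))
        (fun n => ModuleCat.ofHom ((X.D (n + 1)).mapQ (X.D n) (d h n) (hD n))) n
    refine (congrArg (fun f => ModuleCat.ofHom (X.D (n + 1)).mkQ ≫ f) h2).trans ?_
    exact (congrArg (fun f => f ≫ ModuleCat.ofHom (X.D n).mkQ) h1).symm

end DSet

/-!
`d² = 0` because the pairs (face of `T`, face of that face) are matched by a fixed-point-free
involution: two removals of vertices are either interchanged, which changes the sign by the shift of
the labels, or carried out in the same order by faces of opposite relative sign.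

For the quasi-isomorphism it suffices that `D(X)` is acyclic. Since `X` is normal, every dendrex is
`π^* y` for a nondegenerate `y` and a composite of degeneracies `π`, uniquely up to a unique
isomorphism. Hence the edges of `T` have canonical colours, the edges of the core `y`, and the edges
of one colour form a linear branch all of whose inner vertices are degenerate. Filter `D(X)` by the
number of nondegenerate vertices. On the graded pieces only the faces which shorten such a branch
survive, and those of one branch cancel in pairs, except for one face if the number of edges is odd.
So a graded piece is a sum of tensor products, over the edges of the core, of copies of
`ℤ ←0 ℤ ←1 ℤ ←0 ⋯`. Lengthening a branch with at least one degenerate vertex contracts this complex;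
the branch to be lengthened has to be chosen depending only on the set of colours of the degenerate
vertices, so that the choice is compatible with the differential.
-/

namespace OTree

variable {R S T : OTree}

@[ext]
theorem hom_ext {f g : S ⟶ T} (h : ∀ x, onEdges f x = onEdges g x) : f = g :=
  Hom.ext (funext h)

@[simp]
theorem onEdges_comp (f : R ⟶ S) (g : S ⟶ T) (x : R.E) :
    onEdges (f ≫ g) x = onEdges g (onEdges f x) := rfl

@[simp]
theorem onEdges_id (x : T.E) : onEdges (𝟙 T) x = x := rfl

theorem Op.le {m : Multiset T.E} {e : T.E} (h : T.Op m e) : ∀ x ∈ m, e ≤ x := by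
  induction h with
  | id e => simp
  | comp m x e _ _ ih =>
    intro y hy
    rcases Multiset.mem_add.1 hy with hy | hy
    · have := mem_inputs.1 (Finset.mem_def.2 hy)
      exact (ih x (by simp)).trans (this.2 ▸ next_le y)
    · exact ih y (by simp [hy])

theorem Op.eq_singleton_of_mem {m : Multiset T.E} {e : T.E} (h : T.Op m e) (he : e ∈ m) :
    m = {e} := by
  refine (h.antichain.1.ext (Multiset.nodup_singleton e)).2 fun x => ?_
  rw [Multiset.mem_singleton]
  exact ⟨fun hx => (h.antichain.2 e he x hx (h.le x hx)).symm, fun hx => hx ▸ he⟩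

theorem Op.eq_singleton_of_leaf {m : Multiset T.E} {e : T.E} (h : T.Op m e) (he : e ∉ T.vert) :
    m = {e} := by
  induction h with
  | id e => rfl
  | comp m x e hx _ ih =>
    have h1 : x ∈ ({e} : Multiset T.E) := ih he ▸ Multiset.mem_cons_self x m
    exact absurd (Multiset.mem_singleton.1 h1 ▸ hx) he

theorem mem_inputs_iff_covBy {v x : T.E} : x ∈ T.inputs v ↔ v ⋖ x := by
  rw [mem_inputs]
  constructor
  · rintro ⟨h, rfl⟩
    exact ⟨next_lt h, fun c hc hc' => absurd (le_next_of_lt hc') (not_le_of_gt hc)⟩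
  · intro h
    have hx := ne_root_of_lt h.lt
    exact ⟨hx, ((le_next_of_lt h.lt).eq_or_lt.resolve_right fun h' => h.2 h' (next_lt hx)).symm⟩

theorem onEdges_next_le (f : S ⟶ T) (b : S.E) : onEdges f (S.next b) ≤ onEdges f b := by
  by_cases hb : b = S.root
  · rw [hb, S.next_root]
  · exact (f.map_vert (S.next b) (S.next_mem b hb)).le _
      (Multiset.mem_map_of_mem _ (mem_inputs.2 ⟨hb, rfl⟩))

theorem onEdges_mono (f : S ⟶ T) : Monotone (onEdges f) := by
  rintro a b ⟨n, rfl⟩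
  induction n generalizing b with
  | zero => exact le_rfl
  | succ n ih => exact (ih (b := S.next b)).trans (onEdges_next_le f b)

theorem le_or_le_of_onEdges_le (f : S ⟶ T) {a b : S.E} (h : onEdges f a ≤ onEdges f b) :
    a ≤ b ∨ b ≤ a := by
  by_contra! hc
  obtain ⟨c, d, hs, hne, hca, hdb⟩ := exists_sib hc.1 hc.2
  rcases comparable ((onEdges_mono f hca).trans h) (onEdges_mono f hdb) with h' | h'
  · exact hne (f.sib_eq hs h')
  · exact hne (f.sib_eq hs.symm h').symm

theorem lt_of_onEdges_lt (f : S ⟶ T) {a b : S.E} (h : onEdges f a < onEdges f b) : a < b := by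
  have h1 : ¬ b ≤ a := fun h' => absurd (onEdges_mono f h') (not_le_of_gt h)
  exact lt_of_le_not_ge ((le_or_le_of_onEdges_le f h.le).resolve_right h1) h1

theorem onEdges_le_iff (f : S ⟶ T) (hf : Function.Injective (onEdges f)) {a b : S.E} :
    onEdges f a ≤ onEdges f b ↔ a ≤ b := by
  refine ⟨fun h => ?_, fun h => onEdges_mono f h⟩
  rcases h.eq_or_lt with h | h
  · exact (hf h).le
  · exact (lt_of_onEdges_lt f h).le

theorem onEdges_lt_iff (f : S ⟶ T) (hf : Function.Injective (onEdges f)) {a b : S.E} :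
    onEdges f a < onEdges f b ↔ a < b := by
  rw [lt_iff_le_not_ge, lt_iff_le_not_ge, onEdges_le_iff f hf, onEdges_le_iff f hf]

/-- `v` is a vertex whose only input is `i`. -/
structure IsUnary (T : OTree) (v i : T.E) : Prop where
  mem : v ∈ T.vert
  inputs_eq : T.inputs v = {i}

namespace IsUnary

variable {v i : T.E}

theorem mem_inputs (h : T.IsUnary v i) : i ∈ T.inputs v := by
  rw [h.inputs_eq]; exact Finset.mem_singleton_self i

theorem ne_root (h : T.IsUnary v i) : i ≠ T.root := (OTree.mem_inputs.1 h.mem_inputs).1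

theorem next_eq (h : T.IsUnary v i) : T.next i = v := (OTree.mem_inputs.1 h.mem_inputs).2

theorem lt (h : T.IsUnary v i) : v < i := h.next_eq ▸ next_lt h.ne_root

theorem vertex_lt_iff_le (h : T.IsUnary v i) {e : T.E} : v < e ↔ i ≤ e := by
  refine ⟨fun h' => ?_, fun h' => h.lt.trans_le h'⟩
  obtain ⟨b, hb, hb', hb''⟩ := exists_child h'
  have : b ∈ T.inputs v := OTree.mem_inputs.2 ⟨hb', hb''⟩
  rw [h.inputs_eq, Finset.mem_singleton] at this
  exact this ▸ hb

theorem lt_input_iff_le (h : T.IsUnary v i) {e : T.E} : e < i ↔ e ≤ v :=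
  ⟨fun h' => h.next_eq ▸ le_next_of_lt h', fun h' => h'.trans_lt h.lt⟩

theorem eq_input_of_next_eq (h : T.IsUnary v i) {b : T.E} (hb : b ≠ T.root)
    (hv : T.next b = v) : b = i := by
  have : b ∈ T.inputs v := OTree.mem_inputs.2 ⟨hb, hv⟩
  rwa [h.inputs_eq, Finset.mem_singleton] at this

theorem input_unique {j : T.E} (h : T.IsUnary v i) (h' : T.IsUnary v j) : i = j :=
  h'.eq_input_of_next_eq h.ne_root h.next_eq

end IsUnary

theorem isUnary_of_onEdges_next_eq (f : S ⟶ T) {b : S.E} (hb : b ≠ S.root)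
    (h : onEdges f (S.next b) = onEdges f b) : S.IsUnary (S.next b) b := by
  refine ⟨S.next_mem b hb, ?_⟩
  have hm : b ∈ S.inputs (S.next b) := mem_inputs.2 ⟨hb, rfl⟩
  have h1 := (f.map_vert (S.next b) (S.next_mem b hb)).eq_singleton_of_mem
    (Multiset.mem_map.2 ⟨b, hm, h.symm⟩)
  have h2 := congrArg Multiset.card h1
  rw [Multiset.card_map, Multiset.card_singleton] at h2
  obtain ⟨c, hc⟩ := Finset.card_eq_one.1 h2
  rw [hc, Finset.mem_singleton] at hm
  rw [hc, hm]

theorem exists_onEdges_next_eq (f : S ⟶ T) (hf : ¬ Function.Injective (onEdges f)) :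
    ∃ b, b ≠ S.root ∧ onEdges f (S.next b) = onEdges f b := by
  have of_lt : ∀ a b, a < b → onEdges f a = onEdges f b →
      ∃ b, b ≠ S.root ∧ onEdges f (S.next b) = onEdges f b := fun a b hab h =>
    ⟨b, ne_root_of_lt hab, le_antisymm (onEdges_next_le f b)
      (h ▸ onEdges_mono f (le_next_of_lt hab))⟩
  obtain ⟨a, b, h, hne⟩ := Function.not_injective_iff.1 hf
  rcases le_or_le_of_onEdges_le f h.le with h' | h'
  · exact of_lt a b (lt_of_le_of_ne h' hne) h
  · exact of_lt b a (lt_of_le_of_ne h' hne.symm) h.symm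

/-- The morphism of trees given by an isomorphism of the edge posets which preserves vertices. -/
def homOfOrderIso (φ : S.E ≃o T.E) (hv : ∀ x ∈ S.vert, φ x ∈ T.vert) : S ⟶ T :=
  Hom.mk φ fun v hv' => (Op.vertex (hv v hv')).map_inputs (fun _ _ _ _ h => φ.injective h)
    fun x => by
      rw [Finset.mem_val, mem_inputs_iff_covBy]
      constructor
      · rintro ⟨y, hy, rfl⟩
        exact (apply_covBy_apply_iff φ).2 (mem_inputs_iff_covBy.1 hy)
      · intro hx
        refine ⟨φ.symm x, mem_inputs_iff_covBy.2 ?_, φ.apply_symm_apply x⟩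
        rwa [← apply_covBy_apply_iff φ, φ.apply_symm_apply]

/-- The isomorphism of trees given by an isomorphism of the edge posets which matches vertices. -/
def isoOfOrderIso (φ : S.E ≃o T.E) (hv : ∀ x, x ∈ S.vert ↔ φ x ∈ T.vert) : S ≅ T where
  hom := homOfOrderIso φ fun x hx => (hv x).1 hx
  inv := homOfOrderIso φ.symm fun x hx => (hv _).2 (by rwa [φ.apply_symm_apply])
  hom_inv_id := hom_ext fun x => φ.symm_apply_apply x
  inv_hom_id := hom_ext fun x => φ.apply_symm_apply x

@[simp]
theorem onEdges_inv_hom (τ : S ≅ T) (x : S.E) : onEdges τ.inv (onEdges τ.hom x) = x := by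
  rw [← onEdges_comp, τ.hom_inv_id, onEdges_id]

@[simp]
theorem onEdges_hom_inv (τ : S ≅ T) (x : T.E) : onEdges τ.hom (onEdges τ.inv x) = x := by
  rw [← onEdges_comp, τ.inv_hom_id, onEdges_id]

theorem onEdges_hom_injective (τ : S ≅ T) : Function.Injective (onEdges τ.hom) :=
  Function.LeftInverse.injective (onEdges_inv_hom τ)

theorem onEdges_hom_bijective (τ : S ≅ T) : Function.Bijective (onEdges τ.hom) :=
  ⟨onEdges_hom_injective τ, Function.RightInverse.surjective (onEdges_hom_inv τ)⟩

/-- The order isomorphism on edges underlying an isomorphism of trees. -/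
def edgeOrderIso (τ : S ≅ T) : S.E ≃o T.E where
  toFun := onEdges τ.hom
  invFun := onEdges τ.inv
  left_inv := onEdges_inv_hom τ
  right_inv := onEdges_hom_inv τ
  map_rel_iff' := onEdges_le_iff τ.hom (onEdges_hom_injective τ)

theorem onEdges_mem_vert (f : S ⟶ T) (hf : Function.Injective (onEdges f)) {v : S.E}
    (hv : v ∈ S.vert) : onEdges f v ∈ T.vert := by
  by_contra h
  have h1 := (f.map_vert v hv).eq_singleton_of_leaf h
  have h2 : onEdges f v ∈ (S.inputs v).val.map f.toFun := by
    rw [h1]; exact Multiset.mem_singleton_self _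
  obtain ⟨b, hb, hb'⟩ := Multiset.mem_map.1 h2
  have h3 : b = v := hf hb'
  have h4 := mem_inputs.1 (Finset.mem_def.2 hb)
  rw [h3] at h4
  exact next_ne h4.1 h4.2

theorem onEdges_hom_mem_vert (τ : S ≅ T) {v : S.E} : onEdges τ.hom v ∈ T.vert ↔ v ∈ S.vert := by
  refine ⟨fun h => ?_, onEdges_mem_vert τ.hom (onEdges_hom_injective τ)⟩
  have := onEdges_mem_vert τ.inv (onEdges_hom_injective τ.symm) h
  rwa [onEdges_inv_hom] at this

theorem onEdges_hom_mem_inputs (τ : S ≅ T) {v x : S.E} :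
    onEdges τ.hom x ∈ T.inputs (onEdges τ.hom v) ↔ x ∈ S.inputs v := by
  rw [mem_inputs_iff_covBy, mem_inputs_iff_covBy]
  exact apply_covBy_apply_iff (edgeOrderIso τ)

theorem root_eq_of_forall_le {r : T.E} (h : ∀ x, r ≤ x) : r = T.root :=
  le_antisymm (h _) (root_le _)

theorem onEdges_hom_root (τ : S ≅ T) : onEdges τ.hom S.root = T.root :=
  root_eq_of_forall_le fun x => by
    rw [← onEdges_hom_inv τ x]; exact onEdges_mono _ (root_le _)

theorem onEdges_hom_ne_root (τ : S ≅ T) {x : S.E} : onEdges τ.hom x ≠ T.root ↔ x ≠ S.root := by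
  rw [← onEdges_hom_root τ, (onEdges_hom_injective τ).ne_iff]

theorem isIso_of_bijective (f : S ⟶ T) (hf : Function.Bijective (onEdges f))
    (hs : T.size ≤ S.size) : IsIso f := by
  have h1 : onEdges f '' S.vert = T.vert := by
    apply Set.eq_of_subset_of_ncard_le
    · rintro _ ⟨v, hv, rfl⟩
      exact onEdges_mem_vert f hf.1 hv
    · rw [Set.ncard_image_of_injective _ hf.1]
      exact hs
    · exact Set.toFinite _
  let φ : S.E ≃o T.E :=
    { Equiv.ofBijective _ hf with map_rel_iff' := onEdges_le_iff f hf.1 }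
  have hφ : ∀ x, x ∈ S.vert ↔ φ x ∈ T.vert := fun x =>
    ⟨onEdges_mem_vert f hf.1, fun hx => (hf.1.mem_set_image (s := S.vert)).1 (h1.symm ▸ hx)⟩
  exact (isoOfOrderIso φ hφ).isIso_hom

theorem exists_iso_of_range_eq (f : R ⟶ T) (g : S ⟶ T) (hf : Function.Injective (onEdges f))
    (hg : Function.Injective (onEdges g)) (h : Set.range (onEdges f) = Set.range (onEdges g))
    (hv : ∀ x y, onEdges f x = onEdges g y → (x ∈ R.vert ↔ y ∈ S.vert)) :
    ∃ φ : R ≅ S, φ.hom ≫ g = f := by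
  let k : R.E ≃ S.E :=
    (Equiv.ofInjective _ hf).trans ((Equiv.setCongr h).trans (Equiv.ofInjective _ hg).symm)
  have hk : ∀ x, onEdges g (k x) = onEdges f x := fun x => Equiv.apply_ofInjective_symm hg _
  let φ : R.E ≃o S.E :=
    { k with
      map_rel_iff' := by
        intro a b
        rw [← onEdges_le_iff g hg, hk, hk, onEdges_le_iff f hf] }
  exact ⟨isoOfOrderIso φ fun x => hv x (k x) (hk x).symm, hom_ext hk⟩

/-! ### Labels and signs of planar structures -/

namespace Planar

variable {p p' : Planar T}

theorem LeftOf.not_le {x y : T.E} (h : p.LeftOf x y) : ¬ x ≤ y := by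
  rintro hxy
  obtain ⟨a, b, hab, ha, hb⟩ := h
  have hs := p.sib _ _ hab
  rcases comparable (ha.trans hxy) hb with h | h
  · exact p.irrefl b (hs.eq_of_le h ▸ hab)
  · exact p.irrefl a (hs.symm.eq_of_le h ▸ hab)

theorem LeftOf.not_ge {x y : T.E} (h : p.LeftOf x y) : ¬ y ≤ x := by
  rintro hxy
  obtain ⟨a, b, hab, ha, hb⟩ := h
  exact LeftOf.not_le (p := p) ⟨a, b, hab, le_rfl, hb.trans hxy⟩ ha

theorem LeftOf.asymm {x y : T.E} (h : p.LeftOf x y) : ¬ p.LeftOf y x :=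
  fun h' => (h.trans h').irrefl

theorem LeftOf.mono {x y x' y' : T.E} (h : p.LeftOf x y) (hx : x ≤ x') (hy : y ≤ y') :
    p.LeftOf x' y' := by
  obtain ⟨a, b, hab, ha, hb⟩ := h
  exact ⟨a, b, hab, ha.trans hx, hb.trans hy⟩

theorem lt_iff_sib_and_leftOf {a b : T.E} : p.lt a b ↔ T.Sib a b ∧ p.LeftOf a b := by
  refine ⟨fun h => ⟨p.sib _ _ h, a, b, h, le_rfl, le_rfl⟩, fun ⟨h, h'⟩ => ?_⟩
  refine (p.total a b h ?_).resolve_right fun h'' => h'.asymm ⟨b, a, h'', le_rfl, le_rfl⟩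
  rintro rfl
  exact h'.irrefl

theorem leftOf_pullback (p : Planar T) (f : S ⟶ T) {x y : S.E} :
    (p.pullback f).LeftOf x y ↔ p.LeftOf (onEdges f x) (onEdges f y) := by
  have key : ∀ {x y}, (p.pullback f).LeftOf x y → p.LeftOf (onEdges f x) (onEdges f y) := by
    rintro x y ⟨a, b, hab, ha, hb⟩
    exact hab.2.mono (onEdges_mono f ha) (onEdges_mono f hb)
  refine ⟨key, fun h => ?_⟩
  refine (LeftOf.total (p := p.pullback f) (fun h' => h.not_le (onEdges_mono f h'))
    fun h' => h.not_ge (onEdges_mono f h')).resolve_right fun h' => h.asymm (key h')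

theorem before_pullback_of_injective (p : Planar T) (f : S ⟶ T)
    (hf : Function.Injective (onEdges f)) {x y : S.E} :
    (p.pullback f).Before x y ↔ p.Before (onEdges f x) (onEdges f y) :=
  or_congr (onEdges_lt_iff f hf).symm (leftOf_pullback p f)

theorem pullback_comp (p : Planar T) (f : R ⟶ S) (g : S ⟶ T) :
    p.pullback (f ≫ g) = (p.pullback g).pullback f := by
  ext a b
  exact and_congr Iff.rfl (leftOf_pullback p g).symm

@[simp]
theorem pullback_id (p : Planar T) : p.pullback (𝟙 T) = p := by
  ext a b
  exact lt_iff_sib_and_leftOf.symm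

theorem Before.asymm {x y : T.E} (h : p.Before x y) : ¬ p.Before y x :=
  fun h' => (h.trans h').irrefl

theorem not_before_iff {x y : T.E} (h : x ≠ y) : ¬ p.Before x y ↔ p.Before y x :=
  ⟨fun h' => (Before.total h).resolve_left h', fun h' => h'.asymm⟩

open Classical in
theorem before_add_before {x y : T.E} (h : x ≠ y) :
    (if p.Before x y then 1 else 0) + (if p.Before y x then 1 else 0) = 1 := by
  by_cases h' : p.Before x y
  · simp [h', h'.asymm]
  · simp [h', (not_before_iff h).1 h']

end Planar

open Classical in
/-- The set of vertices, as a finset. -/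
noncomputable def verts (T : OTree) : Finset T.E := Finset.univ.filter (· ∈ T.vert)

@[simp]
theorem mem_verts {x : T.E} : x ∈ T.verts ↔ x ∈ T.vert := by simp [verts]

theorem card_verts (T : OTree) : T.verts.card = T.size := by
  change _ = T.vert.ncard
  rw [← Set.ncard_coe_finset]
  congr 1
  ext x
  simp

/-- `f` identifies `S` with a subtree of `T` whose vertices are those of `T` except `r`. -/
structure RemovesVertex (f : S ⟶ T) (r : T.E) : Prop where
  inj : Function.Injective (onEdges f)
  mem : r ∈ T.vert
  mem_iff : ∀ y, y ∈ S.vert ↔ onEdges f y ∈ T.vert ∧ onEdges f y ≠ r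
  exists_eq : ∀ x ∈ T.vert, x ≠ r → ∃ y, onEdges f y = x

open Classical in
theorem RemovesVertex.verts_eq {f : S ⟶ T} {r : T.E} (h : RemovesVertex f r) :
    T.verts = insert r (S.verts.image (onEdges f)) := by
  ext x
  simp only [mem_verts, Finset.mem_insert, Finset.mem_image]
  constructor
  · intro hx
    refine or_iff_not_imp_left.2 fun hr => ?_
    obtain ⟨y, rfl⟩ := h.exists_eq x hx hr
    exact ⟨y, (h.mem_iff y).2 ⟨hx, hr⟩, rfl⟩
  · rintro (rfl | ⟨y, hy, rfl⟩)
    · exact h.mem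
    · exact ((h.mem_iff y).1 hy).1

open Classical in
theorem RemovesVertex.notMem_image {f : S ⟶ T} {r : T.E} (h : RemovesVertex f r) :
    r ∉ S.verts.image (onEdges f) := by
  rw [Finset.mem_image]
  rintro ⟨y, hy, hr⟩
  exact ((h.mem_iff y).1 (mem_verts.1 hy)).2 hr

theorem RemovesVertex.size_eq {f : S ⟶ T} {r : T.E} (h : RemovesVertex f r) :
    S.size + 1 = T.size := by
  classical
  rw [← card_verts, ← card_verts, h.verts_eq, Finset.card_insert_of_notMem h.notMem_image,
    Finset.card_image_of_injective _ h.inj]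

@[to_additive]
theorem RemovesVertex.prod_eq {M : Type*} [CommMonoid M] {f : S ⟶ T} {r : T.E}
    (h : RemovesVertex f r) (w : T.E → M) :
    ∏ x ∈ T.verts, w x = w r * ∏ y ∈ S.verts, w (onEdges f y) := by
  classical
  rw [h.verts_eq, Finset.prod_insert h.notMem_image, Finset.prod_image h.inj.injOn]

theorem RemovesVertex.iso_comp {f : S ⟶ T} {r : T.E} (h : RemovesVertex f r) (τ : T ≅ R) :
    RemovesVertex (f ≫ τ.hom) (onEdges τ.hom r) where
  inj := (onEdges_hom_injective τ).comp h.inj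
  mem := (onEdges_hom_mem_vert τ).2 h.mem
  mem_iff y := by
    rw [onEdges_comp, onEdges_hom_mem_vert, (onEdges_hom_injective τ).ne_iff, h.mem_iff]
  exists_eq x hx hr := by
    obtain ⟨y, hy⟩ := h.exists_eq (onEdges τ.inv x)
      (by rw [← onEdges_hom_mem_vert τ, onEdges_hom_inv]; exact hx)
      (fun h' => hr (by rw [← h', onEdges_hom_inv]))
    exact ⟨y, by rw [onEdges_comp, hy, onEdges_hom_inv]⟩

namespace Planar

variable {p p' : Planar T}

open Classical in
theorem label_eq_card (p : Planar T) (v : T.E) :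
    p.label v = (T.verts.filter fun u => p.Before u v).card := by
  rw [label, ← Set.ncard_image_of_injective _ Subtype.val_injective, ← Set.ncard_coe_finset]
  congr 1
  ext x
  simp only [Set.mem_image, Set.mem_ofPred_eq, Finset.coe_filter, mem_verts, Subtype.exists,
    exists_and_left, exists_prop, exists_eq_right_right]
  exact and_comm

open Classical in
theorem label_eq_sum (p : Planar T) (v : T.E) :
    p.label v = ∑ u ∈ T.verts, if p.Before u v then 1 else 0 := by
  rw [label_eq_card, Finset.card_filter]

open Classical in
theorem label_onEdges_of_removesVertex {f : S ⟶ T} {r : T.E} (h : RemovesVertex f r)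
    (p : Planar T) (e : S.E) :
    p.label (onEdges f e) =
      (p.pullback f).label e + if p.Before r (onEdges f e) then 1 else 0 := by
  simp only [label_eq_sum, h.sum_eq, before_pullback_of_injective p f h.inj, add_comm]

open Classical in
theorem neg_one_pow_label (p : Planar T) (v : T.E) :
    (-1 : ℤ) ^ p.label v = ∏ u ∈ T.verts, if p.Before u v then -1 else 1 := by
  rw [label_eq_card, Finset.prod_ite, Finset.prod_const, Finset.prod_const_one, mul_one]

theorem labelling_lt_labelling_iff (p : Planar T) (u v : T.vert) :
    p.labelling u < p.labelling v ↔ p.Before u v := by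
  change p.label u < p.label v ↔ _
  refine ⟨fun h => ?_, fun h => label_lt_label u.2 h⟩
  have hne : (u : T.E) ≠ v := fun h' => by rw [h'] at h; exact lt_irrefl _ h
  exact (Before.total hne).resolve_right fun h' => absurd (label_lt_label v.2 h') (by omega)

open Classical in
/-- The contribution of the vertices `u` and `v` to the sign of `p` relative to `p'`: it is `-1` if
`u` comes before `v` for `p'` and after `v` for `p`. -/
noncomputable def inversion (p' p : Planar T) (u v : T.E) : ℤ :=
  if p'.Before u v ∧ p.Before v u then -1 else 1

@[simp]
theorem inversion_self (p' p : Planar T) (v : T.E) : inversion p' p v v = 1 :=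
  if_neg fun h => h.1.irrefl

open Classical in
theorem inversion_mul_inversion_swap (p' p : Planar T) {u v : T.E} (h : u ≠ v) :
    inversion p' p u v * inversion p' p v u =
      (if p'.Before u v then -1 else 1) * (if p.Before u v then -1 else 1) := by
  by_cases h1 : p.Before u v <;> by_cases h2 : p'.Before u v
  · simp [inversion, h1, h2, h1.asymm, h2.asymm]
  · simp [inversion, h1, h2, h1.asymm, (not_before_iff h).1 h2]
  · simp [inversion, h1, h2, h2.asymm, (not_before_iff h).1 h1]
  · simp [inversion, h1, h2, (not_before_iff h).1 h1, (not_before_iff h).1 h2]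

open Classical in
theorem sgn_eq_prod (p' p : Planar T) :
    sgn p' p = ∏ v ∈ T.verts, ∏ u ∈ T.verts, inversion p' p u v := by
  have prod_verts : ∀ w : T.E → ℤ, ∏ v ∈ T.verts, w v = ∏ v : T.vert, w v :=
    fun w => Finset.prod_subtype T.verts (fun x => mem_verts) w
  simp only [sgn, Equiv.Perm.sign_eq_prod_prod_Iio, Units.coe_prod, prod_verts]
  rw [← Equiv.prod_comp p'.labelling]
  refine Finset.prod_congr rfl fun v _ => ?_
  rw [← Equiv.prod_comp p'.labelling.symm fun u : T.vert => inversion p' p u v,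
    ← Finset.prod_subset (Finset.subset_univ (Finset.Iio (p'.labelling v)))]
  · refine Finset.prod_congr rfl fun i hi => ?_
    obtain ⟨u, rfl⟩ := p'.labelling.surjective i
    have hi := (labelling_lt_labelling_iff p' u v).1 (Finset.mem_Iio.1 hi)
    have hne : (u : T.E) ≠ v := fun h' => by rw [h'] at hi; exact hi.irrefl
    simp only [inversion, Equiv.trans_apply, Equiv.symm_apply_apply, labelling_lt_labelling_iff,
      hi, true_and]
    by_cases h : p.Before u v
    · simp [h, h.asymm]
    · simp [h, (not_before_iff hne).1 h]
  · intro i _ hi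
    obtain ⟨u, rfl⟩ := p'.labelling.surjective i
    rw [Finset.mem_Iio, labelling_lt_labelling_iff] at hi
    simp [inversion, hi]

@[simp]
theorem sgn_self (p : Planar T) : sgn p p = 1 := by
  rw [sgn, Equiv.symm_trans_self]
  simp

open Classical in
theorem sgn_eq_mul_of_removesVertex {f : S ⟶ T} {r : T.E} (h : RemovesVertex f r)
    (p' p : Planar T) :
    sgn p' p = sgn (p'.pullback f) (p.pullback f) * ((-1) ^ p'.label r * (-1) ^ p.label r) := by
  have inversion_pullback : ∀ x y, inversion (p'.pullback f) (p.pullback f) x y =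
      inversion p' p (onEdges f x) (onEdges f y) := fun x y =>
    if_congr (and_congr (before_pullback_of_injective p' f h.inj)
      (before_pullback_of_injective p f h.inj)) rfl rfl
  have pairs_with_r : (∏ x ∈ S.verts, inversion p' p (onEdges f x) r) *
      ∏ y ∈ S.verts, inversion p' p r (onEdges f y) =
      (-1) ^ p'.label r * (-1) ^ p.label r := by
    simp only [neg_one_pow_label, h.prod_eq, Before.irrefl, if_false, one_mul]
    rw [← Finset.prod_mul_distrib, ← Finset.prod_mul_distrib]
    exact Finset.prod_congr rfl fun x hx =>
      inversion_mul_inversion_swap p' p ((h.mem_iff x).1 (mem_verts.1 hx)).2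
  simp only [sgn_eq_prod, h.prod_eq, inversion_self, one_mul, Finset.prod_mul_distrib,
    inversion_pullback]
  rw [← mul_assoc, pairs_with_r, mul_comm]

theorem label_pullback_hom (p : Planar T) (τ : S ≅ T) (e : S.E) :
    (p.pullback τ.hom).label e = p.label (onEdges τ.hom e) := by
  classical
  simp only [label_eq_sum, before_pullback_of_injective p τ.hom (onEdges_hom_injective τ)]
  exact Finset.sum_nbij' (onEdges τ.hom) (onEdges τ.inv)
    (fun x hx => by rwa [mem_verts, onEdges_hom_mem_vert, ← mem_verts])
    (fun x hx => by rwa [mem_verts, ← onEdges_hom_mem_vert τ, onEdges_hom_inv, ← mem_verts])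
    (by simp) (by simp) (by simp)

theorem label_root (p : Planar T) : p.label T.root = 0 := by
  classical
  rw [label_eq_card, Finset.card_eq_zero, Finset.filter_eq_empty_iff]
  rintro u - (h | h)
  · exact absurd (root_le u) (not_le_of_gt h)
  · exact h.not_ge (root_le u)

theorem before_input_iff_of_isUnary {v i : T.E} (h : T.IsUnary v i) {u : T.E} :
    p.Before u i ↔ u = v ∨ p.Before u v := by
  constructor
  · rintro (h' | ⟨a, b, hab, ha, hb⟩)
    · rcases (h.lt_input_iff_le.1 h').eq_or_lt with h' | h'
      · exact Or.inl h'
      · exact Or.inr (Or.inl h')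
    · rcases hb.eq_or_lt with rfl | hb
      · have hs := p.sib _ _ hab
        have := h.eq_input_of_next_eq hs.1 (hs.2.2.trans h.next_eq)
        exact absurd (this ▸ hab) (p.irrefl _)
      · exact Or.inr (Or.inr ⟨a, b, hab, ha, h.lt_input_iff_le.1 hb⟩)
  · rintro (rfl | h')
    · exact Or.inl h.lt
    · exact h'.trans (Or.inl h.lt)

theorem label_input_of_isUnary {v i : T.E} (h : T.IsUnary v i) (p : Planar T) :
    p.label i = p.label v + 1 := by
  classical
  rw [label_eq_card, label_eq_card]
  rw [← Finset.card_insert_of_notMem (a := v) (s := T.verts.filter fun u => p.Before u v)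
    fun h' => Before.irrefl (Finset.mem_filter.1 h').2]
  congr 1
  ext u
  simp only [Finset.mem_filter, mem_verts, Finset.mem_insert, before_input_iff_of_isUnary h]
  constructor
  · rintro ⟨h1, h2 | h2⟩
    · exact Or.inl h2
    · exact Or.inr ⟨h1, h2⟩
  · rintro (rfl | ⟨h1, h2⟩)
    · exact ⟨h.mem, Or.inl rfl⟩
    · exact ⟨h1, Or.inr h2⟩

end Planar

end OTree

/-! ### The differential -/

namespace OTree

variable {R S T : OTree}

namespace Face

/-- The vertex of `T` which is not a vertex of the face: contracting the inner edge `e` merges the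
vertex above `e` into the one below it, so the former is removed. -/
def removed : T.Face → T.E
  | inner e _ _ => e
  | top w _ _ => w
  | bottom _ _ _ => T.root

/-- The three kinds of elementary faces. -/
inductive Kind
  | inner
  | top
  | bottom

/-- The kind of an elementary face. -/
def kind : T.Face → Kind
  | inner _ _ _ => .inner
  | top _ _ _ => .top
  | bottom _ _ _ => .bottom

/-- The sign of a face of the given kind relative to `(-1) ^ k`, where `k` is the label of the
removed vertex. -/
def Kind.eps : Kind → ℤ
  | .inner => 1
  | .top => -1
  | .bottom => 1

theorem sgn_eq (p : Planar T) (a : T.Face) :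
    a.sgn p = a.kind.eps * (-1) ^ p.label a.removed := by
  cases a with
  | inner e he hv => exact (one_mul _).symm
  | top w hw hl =>
    simp only [sgn, kind, Kind.eps, removed]
    rw [pow_succ, mul_comm]
  | bottom e he hl => simp [sgn, kind, Kind.eps, removed, Planar.label_root]

/-- The edge `x` of `T` is an edge of the face. -/
def Mem : T.Face → T.E → Prop
  | inner e _ _, x => x ≠ e
  | top w _ _, x => x ∉ T.inputs w
  | bottom e _ _, x => e ≤ x

theorem exists_onEdges_map_eq_iff {a : T.Face} {x : T.E} :
    (∃ y, onEdges a.map y = x) ↔ a.Mem x := by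
  cases a with
  | inner e he hv => exact ⟨by rintro ⟨y, rfl⟩; exact y.2, fun h => ⟨⟨x, h⟩, rfl⟩⟩
  | top w hw hl => exact ⟨by rintro ⟨y, rfl⟩; exact y.2, fun h => ⟨⟨x, h⟩, rfl⟩⟩
  | bottom e he hl => exact ⟨by rintro ⟨y, rfl⟩; exact y.2, fun h => ⟨⟨x, h⟩, rfl⟩⟩

theorem mem_onEdges_map {a : T.Face} (y : a.tree.E) : a.Mem (onEdges a.map y) :=
  exists_onEdges_map_eq_iff.1 ⟨y, rfl⟩

theorem bottom_le_of_mem_vert {e : T.E} (hl : ∀ e' ∈ T.inputs T.root, e' ≠ e → e' ∉ T.vert)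
    {x : T.E} (hx : x ∈ T.vert) (hx' : x ≠ T.root) : e ≤ x := by
  obtain ⟨b, hb, hb', hb''⟩ := exists_child (lt_of_le_of_ne (root_le x) (Ne.symm hx'))
  by_cases hbe : b = e
  · exact hbe ▸ hb
  · have hbl := hl b (mem_inputs.2 ⟨hb', hb''⟩) hbe
    rcases hb.eq_or_lt with rfl | h
    · exact absurd hx hbl
    · obtain ⟨c, -, hc, hc'⟩ := exists_child h
      exact absurd (hc' ▸ T.next_mem c hc) hbl

theorem removesVertex (a : T.Face) : RemovesVertex a.map a.removed := by
  cases a with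
  | inner e he hv =>
    exact ⟨Subtype.val_injective, hv, fun y => ⟨fun h => ⟨h, y.2⟩, fun h => h.1⟩,
      fun x _ hx' => exists_onEdges_map_eq_iff.2 hx'⟩
  | top w hw hl =>
    exact ⟨Subtype.val_injective, hw, fun y => Iff.rfl,
      fun x hx _ => exists_onEdges_map_eq_iff.2 fun h => hl x h hx⟩
  | bottom e he hl =>
    have he' := mem_inputs.1 he
    have hr : T.root ∈ T.vert := he'.2 ▸ T.next_mem e he'.1
    refine ⟨Subtype.val_injective, hr, fun y => ⟨fun h => ⟨h, ?_⟩,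
      fun h => h.1⟩, fun x hx hx' => exists_onEdges_map_eq_iff.2 (bottom_le_of_mem_vert hl hx hx')⟩
    intro h
    have h1 : e ≤ T.root := le_of_le_of_eq y.2 h
    exact he'.1 (le_antisymm h1 (root_le e))

theorem inj (a : T.Face) : Function.Injective (onEdges a.map) := a.removesVertex.inj

/-- The face of `T` corresponding to a face of `S` under an isomorphism `S ≅ T`. -/
def transport (τ : S ≅ T) : S.Face → T.Face
  | inner e he hv =>
    inner (onEdges τ.hom e) ((onEdges_hom_ne_root τ).2 he) ((onEdges_hom_mem_vert τ).2 hv)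
  | top w hw hl => top (onEdges τ.hom w) ((onEdges_hom_mem_vert τ).2 hw) fun e he => by
      rw [← onEdges_hom_inv τ e] at he ⊢
      rw [onEdges_hom_mem_vert]
      exact hl _ ((onEdges_hom_mem_inputs τ).1 he)
  | bottom e he hl => bottom (onEdges τ.hom e)
      (by rw [← onEdges_hom_root τ, onEdges_hom_mem_inputs]; exact he) fun e' he' hne => by
        rw [← onEdges_hom_inv τ e'] at he' hne ⊢
        rw [← onEdges_hom_root τ, onEdges_hom_mem_inputs] at he'
        rw [onEdges_hom_mem_vert]
        exact hl _ he' fun h => hne (by rw [h])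

theorem transport_symm (τ : S ≅ T) (a : S.Face) : transport τ.symm (transport τ a) = a := by
  cases a <;> simp [transport]

/-- An isomorphism of trees induces a bijection of faces. -/
def transportEquiv (τ : S ≅ T) : S.Face ≃ T.Face where
  toFun := transport τ
  invFun := transport τ.symm
  left_inv := transport_symm τ
  right_inv := transport_symm τ.symm

theorem removed_transport (τ : S ≅ T) (a : S.Face) :
    (transport τ a).removed = onEdges τ.hom a.removed := by
  cases a with
  | inner e he hv => rfl
  | top w hw hl => rfl
  | bottom e he hl => exact (onEdges_hom_root τ).symm

theorem kind_transport (τ : S ≅ T) (a : S.Face) : (transport τ a).kind = a.kind := by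
  cases a <;> rfl

theorem mem_transport (τ : S ≅ T) (a : S.Face) (x : S.E) :
    (transport τ a).Mem (onEdges τ.hom x) ↔ a.Mem x := by
  cases a with
  | inner e he hv => exact (onEdges_hom_injective τ).ne_iff
  | top w hw hl => exact not_congr (onEdges_hom_mem_inputs τ)
  | bottom e he hl => exact onEdges_le_iff τ.hom (onEdges_hom_injective τ)

theorem exists_iso_transport (τ : S ≅ T) (a : S.Face) :
    ∃ φ : a.tree ≅ (transport τ a).tree, φ.hom ≫ (transport τ a).map = a.map ≫ τ.hom := by
  refine exists_iso_of_range_eq _ _ ((onEdges_hom_injective τ).comp a.inj) (transport τ a).inj ?_ ?_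
  · ext x
    obtain ⟨x, rfl⟩ := (onEdges_hom_bijective τ).2 x
    have h1 : onEdges τ.hom x ∈ Set.range (onEdges (a.map ≫ τ.hom)) ↔ ∃ y, onEdges a.map y = x :=
      exists_congr fun y => (onEdges_hom_injective τ).eq_iff
    rw [h1, Set.mem_range, exists_onEdges_map_eq_iff, exists_onEdges_map_eq_iff, mem_transport]
  · intro x y hxy
    rw [(a.removesVertex.iso_comp τ).mem_iff, (transport τ a).removesVertex.mem_iff,
      removed_transport, hxy]

end Face

end OTree

namespace DSet

open OTree

variable {X : DSet.{u}} {n m : ℕ} {R S T : OTree}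

theorem res_comp (f : R ⟶ S) (g : S ⟶ T) (x : X.Dendrex T) :
    res (f ≫ g) x = res f (res g x) := by
  simp [res]

@[simp]
theorem res_id (x : X.Dendrex T) : res (𝟙 T) x = x := by
  simp [res]

/-- The class `[T, p, x]`. -/
noncomputable def cls (g : X.Gen n) : X.UnGroup n := (X.A n).mkQ (Finsupp.single g 1)

theorem cls_iso {g g' : X.Gen n} (τ : g'.tree ≅ g.tree) (h : g'.dendrex = res τ.hom g.dendrex) :
    cls g = Planar.sgn g'.planar (g.planar.pullback τ.hom) • cls g' := by
  have h1 : Finsupp.single g 1 -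
      Finsupp.single g' (OTree.Planar.sgn g'.planar (g.planar.pullback τ.hom)) ∈ X.A n :=
    Submodule.subset_span ⟨g, g', τ, h, rfl⟩
  have h2 := (Submodule.Quotient.eq _).2 h1
  rw [cls, cls, ← map_smul, Finsupp.smul_single, smul_eq_mul, mul_one]
  exact h2

theorem cls_eq_of_iso {g g' : X.Gen n} (τ : g'.tree ≅ g.tree)
    (h : g'.dendrex = res τ.hom g.dendrex) (hp : g'.planar = g.planar.pullback τ.hom) :
    cls g = cls g' := by
  rw [cls_iso τ h, hp, Planar.sgn_self, one_smul]

/-- The triple `(S, f^* p, f^* x)` obtained from `(T, p, x)` by restriction along `f : S ⟶ T`. -/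
def Gen.pull (g : X.Gen m) (f : S ⟶ g.tree) (h : S.size = n) : X.Gen n where
  tree := S
  size_eq := h
  planar := g.planar.pullback f
  dendrex := res f g.dendrex

theorem Gen.pull_pull (g : X.Gen m) {n' : ℕ} (f : S ⟶ g.tree) (h : S.size = n) (f' : R ⟶ S)
    (h' : R.size = n') : (g.pull f h).pull f' h' = g.pull (f' ≫ f) h' := by
  simp only [Gen.pull, res_comp, Planar.pullback_comp]

theorem cls_pull_iso (g : X.Gen m) (φ : R ≅ S) {f : S ⟶ g.tree} {f' : R ⟶ g.tree}
    (hf : φ.hom ≫ f = f') (hR : R.size = n) (hS : S.size = n) :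
    cls (g.pull f hS) = cls (g.pull f' hR) := by
  subst hf
  exact cls_eq_of_iso (g := g.pull f hS) (g' := g.pull (φ.hom ≫ f) hR) φ (res_comp _ _ _)
    (Planar.pullback_comp _ _ _)

/-- The sum over the faces defining `d[T, p, x]`. -/
noncomputable def boundaryCls (g : X.Gen (n + 1)) : X.UnGroup n :=
  ∑ a : g.tree.Face, a.sgn g.planar • cls (g.face a)

theorem mkQ_boundary (g : X.Gen (n + 1)) :
    (X.A n).mkQ (X.boundary n (Finsupp.single g 1)) = boundaryCls g := by
  rw [boundary, Finsupp.linearCombination_single, one_smul, map_sum, boundaryCls]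
  refine Finset.sum_congr rfl fun a _ => ?_
  rw [cls, ← map_smul, Finsupp.smul_single, smul_eq_mul, mul_one]

theorem cls_face_transport {g g' : X.Gen (n + 1)} (τ : g'.tree ≅ g.tree)
    (h : g'.dendrex = res τ.hom g.dendrex) (a : g'.tree.Face) :
    cls (g.face (Face.transport τ a)) = Planar.sgn (g'.planar.pullback a.map)
      ((g.planar.pullback τ.hom).pullback a.map) • cls (g'.face a) := by
  obtain ⟨φ, hφ⟩ := Face.exists_iso_transport τ a
  have planar_eq : (g.planar.pullback (Face.transport τ a).map).pullback φ.hom =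
      (g.planar.pullback τ.hom).pullback a.map := by
    rw [← Planar.pullback_comp, ← Planar.pullback_comp, hφ]
  have dendrex_eq : res a.map g'.dendrex =
      res φ.hom (res (Face.transport τ a).map g.dendrex) := by
    rw [h, ← res_comp, ← res_comp, hφ]
  rw [← planar_eq]
  exact cls_iso (g := g.face (Face.transport τ a)) (g' := g'.face a) φ dendrex_eq

theorem boundaryCls_iso {g g' : X.Gen (n + 1)} (τ : g'.tree ≅ g.tree)
    (h : g'.dendrex = res τ.hom g.dendrex) :
    boundaryCls g = Planar.sgn g'.planar (g.planar.pullback τ.hom) • boundaryCls g' := by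
  rw [boundaryCls, boundaryCls, ← Equiv.sum_comp (Face.transportEquiv τ), Finset.smul_sum]
  refine Finset.sum_congr rfl fun a _ => ?_
  change (Face.transport τ a).sgn g.planar • cls (g.face (Face.transport τ a)) = _
  rw [cls_face_transport τ h, smul_smul, smul_smul]
  congr 1
  rw [Face.sgn_eq, Face.sgn_eq, Face.removed_transport, Face.kind_transport,
    ← Planar.label_pullback_hom, Planar.sgn_eq_mul_of_removesVertex a.removesVertex]
  have sign_mul_self :
      ((-1 : ℤ) ^ g'.planar.label a.removed) * (-1) ^ g'.planar.label a.removed = 1 := by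
    rw [← mul_pow]; simp
  linear_combination (-1 : ℤ) * a.kind.eps * (-1) ^ (g.planar.pullback τ.hom).label a.removed *
    Planar.sgn (g'.planar.pullback a.map) ((g.planar.pullback τ.hom).pullback a.map) *
      sign_mul_self

theorem boundaryDescends (X : DSet.{u}) : X.BoundaryDescends := by
  intro n
  rw [A, Submodule.span_le]
  rintro _ ⟨g, g', τ, h, rfl⟩
  have single_eq (k : ℤ) : Finsupp.single g' k = k • Finsupp.single g' 1 := by
    rw [Finsupp.smul_single, smul_eq_mul, mul_one]
  rw [SetLike.mem_coe, Submodule.mem_comap, ← Submodule.ker_mkQ (X.A n), LinearMap.mem_ker,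
    single_eq, map_sub, map_sub, map_smul, map_smul, mkQ_boundary, mkQ_boundary,
    boundaryCls_iso τ h, sub_self]

theorem d_cls (h : X.BoundaryDescends) (g : X.Gen (n + 1)) : d h n (cls g) = boundaryCls g :=
  ((X.A (n + 1)).mapQ_apply (X.A n) (X.boundary n) (h := h n) _).trans (mkQ_boundary g)

theorem hom_ext_cls {M : Type*} [AddCommGroup M] {f f' : X.UnGroup n →ₗ[ℤ] M}
    (h : ∀ g, f (cls g) = f' (cls g)) : f = f' := by
  refine Submodule.linearMap_qext _ (Finsupp.lhom_ext' fun g => LinearMap.ext_ring ?_)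
  exact h g

end DSet

/-! ### Pairs of successive faces -/

theorem sum_eq_zero_of_partner {ι κ M : Type*} [Fintype ι] [AddCommMonoid M] (F : ι → M)
    (c : ι → κ) (hc : Function.Injective c) (g : κ → κ)
    (H : ∀ x, ∃ y, c y = g (c x) ∧ c x = g (c y) ∧ y ≠ x ∧ F x + F y = 0) :
    ∑ x, F x = 0 := by
  choose partner h1 h2 h3 h4 using H
  refine Finset.sum_involution (fun x _ => partner x) (fun x _ => h4 x) (fun x _ _ => h3 x)
    (fun x _ => Finset.mem_univ _) fun x _ => hc ?_
  rw [h1 (partner x), ← h2 x]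

namespace OTree

variable {R S T : OTree}

namespace Face

/-- The edge by which the face is indexed; for a top face, the output of the chopped-off vertex. -/
def edge : T.Face → T.E
  | inner e _ _ => e
  | top w _ _ => w
  | bottom e _ _ => e

theorem ext_kind_edge {a b : T.Face} (h : a.kind = b.kind) (h' : a.edge = b.edge) : a = b := by
  cases a <;> cases b <;> simp_all [kind, edge]

/-- The edge of `T` which is the root of a face. -/
def rootEdge : T.Face → T.E
  | inner _ _ _ => T.root
  | top _ _ _ => T.root
  | bottom e _ _ => e

theorem onEdges_map_root (a : T.Face) : onEdges a.map a.tree.root = a.rootEdge := by cases a <;> rfl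

/-- `x` is an input of `v` in a face, in terms of the edges of `T`. -/
def IsInput : T.Face → T.E → T.E → Prop
  | inner e _ _, v, x => x ∈ T.inputs v ∨ (T.next e = v ∧ x ∈ T.inputs e)
  | top _ _ _, v, x => x ∈ T.inputs v
  | bottom _ _ _, v, x => x ∈ T.inputs v

theorem mem_inputs_tree (a : T.Face) (v x : a.tree.E) :
    x ∈ a.tree.inputs v ↔ a.IsInput (onEdges a.map v) (onEdges a.map x) := by
  cases a with
  | inner e he hv => exact innerFace_mem_inputs he
  | top w hw hl => exact topFace_mem_inputs hl
  | bottom e he hl => exact bottomFace_mem_inputs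

/-- The edge `f` of `T` defines a face of the face `a`, of the given kind. -/
def Valid (a : T.Face) : Kind → T.E → Prop
  | .inner, f => a.Mem f ∧ f ≠ a.rootEdge ∧ f ∈ T.vert ∧ f ≠ a.removed
  | .top, w => a.Mem w ∧ w ∈ T.vert ∧ w ≠ a.removed ∧
      ∀ x, a.Mem x → a.IsInput w x → x ∈ T.vert → x = a.removed
  | .bottom, f => a.Mem f ∧ a.IsInput a.rootEdge f ∧
      ∀ x, a.Mem x → a.IsInput a.rootEdge x → x ≠ f → x ∈ T.vert → x = a.removed

/-- The edges of `T` which belong to a face of the face `a`. -/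
def Mem₂ (a : T.Face) : Kind → T.E → T.E → Prop
  | .inner, f, x => a.Mem x ∧ x ≠ f
  | .top, w, x => a.Mem x ∧ ¬ a.IsInput w x
  | .bottom, f, x => a.Mem x ∧ f ≤ x

/-- The vertex of `T` removed by a face of the face `a`. -/
def removed₂ (a : T.Face) : Kind → T.E → T.E
  | .inner, f => f
  | .top, w => w
  | .bottom, _ => a.rootEdge

theorem valid_kind_edge (a : T.Face) (b : a.tree.Face) : a.Valid b.kind (onEdges a.map b.edge) := by
  have mem_vert_iff := a.removesVertex.mem_iff
  cases b with
  | inner f hf hv =>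
    exact ⟨mem_onEdges_map f, fun h => hf (a.inj (h.trans a.onEdges_map_root.symm)),
      (mem_vert_iff f).1 hv⟩
  | top w hw hl =>
    refine ⟨mem_onEdges_map w, ((mem_vert_iff w).1 hw).1, ((mem_vert_iff w).1 hw).2, ?_⟩
    intro x hx hx' hv
    obtain ⟨y, rfl⟩ := exists_onEdges_map_eq_iff.2 hx
    by_contra hne
    exact hl y ((a.mem_inputs_tree _ _).2 hx') ((mem_vert_iff y).2 ⟨hv, hne⟩)
  | bottom f hf hl =>
    refine ⟨mem_onEdges_map f, a.onEdges_map_root ▸ (a.mem_inputs_tree _ _).1 hf, ?_⟩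
    intro x hx hx' hxf hv
    obtain ⟨y, rfl⟩ := exists_onEdges_map_eq_iff.2 hx
    by_contra hne
    exact hl y ((a.mem_inputs_tree _ _).2 (by rw [onEdges_map_root]; exact hx'))
      (fun h => hxf (by rw [h]; rfl)) ((mem_vert_iff y).2 ⟨hv, hne⟩)

theorem exists_face_of_valid {a : T.Face} {k : Kind} {f : T.E} (h : a.Valid k f) :
    ∃ b : a.tree.Face, b.kind = k ∧ onEdges a.map b.edge = f := by
  have mem_vert_iff := a.removesVertex.mem_iff
  cases k with
  | inner =>
    obtain ⟨h1, h2, h3⟩ := h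
    obtain ⟨y, rfl⟩ := exists_onEdges_map_eq_iff.2 h1
    exact ⟨inner y (fun h => h2 (by rw [h, onEdges_map_root])) ((mem_vert_iff y).2 h3), rfl, rfl⟩
  | top =>
    obtain ⟨h1, h2, h3, h4⟩ := h
    obtain ⟨y, rfl⟩ := exists_onEdges_map_eq_iff.2 h1
    refine ⟨top y ((mem_vert_iff y).2 ⟨h2, h3⟩) fun e he hv => ?_, rfl, rfl⟩
    exact ((mem_vert_iff e).1 hv).2
      (h4 _ (mem_onEdges_map e) ((a.mem_inputs_tree _ _).1 he) ((mem_vert_iff e).1 hv).1)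
  | bottom =>
    obtain ⟨h1, h2, h3⟩ := h
    obtain ⟨y, rfl⟩ := exists_onEdges_map_eq_iff.2 h1
    refine ⟨bottom y ((a.mem_inputs_tree _ _).2 (by rw [onEdges_map_root]; exact h2))
      fun e he hne hv => ?_, rfl, rfl⟩
    exact ((mem_vert_iff e).1 hv).2 (h3 _ (mem_onEdges_map e)
      (by rw [← onEdges_map_root]; exact (a.mem_inputs_tree _ _).1 he) (a.inj.ne hne)
      ((mem_vert_iff e).1 hv).1)

theorem exists_onEdges_comp_map_eq_iff (a : T.Face) (b : a.tree.Face) (x : T.E) :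
    (∃ z, onEdges (b.map ≫ a.map) z = x) ↔ a.Mem₂ b.kind (onEdges a.map b.edge) x := by
  have factor : (∃ z, onEdges (b.map ≫ a.map) z = x) ↔ ∃ y, b.Mem y ∧ onEdges a.map y = x := by
    constructor
    · rintro ⟨z, rfl⟩
      exact ⟨_, mem_onEdges_map z, rfl⟩
    · rintro ⟨y, hy, rfl⟩
      obtain ⟨z, rfl⟩ := exists_onEdges_map_eq_iff.2 hy
      exact ⟨z, rfl⟩
  have image_iff : ∀ P : T.E → Prop, (∀ y, b.Mem y ↔ P (onEdges a.map y)) →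
      ((∃ y, b.Mem y ∧ onEdges a.map y = x) ↔ a.Mem x ∧ P x) := by
    intro P hP
    constructor
    · rintro ⟨y, hy, rfl⟩
      exact ⟨mem_onEdges_map y, (hP y).1 hy⟩
    · rintro ⟨hx, hx'⟩
      obtain ⟨y, rfl⟩ := exists_onEdges_map_eq_iff.2 hx
      exact ⟨y, (hP y).2 hx', rfl⟩
  rw [factor]
  cases b with
  | inner f hf hv => exact image_iff (· ≠ onEdges a.map f) fun y => a.inj.ne_iff.symm
  | top w hw hl =>
    exact image_iff (fun x => ¬ a.IsInput (onEdges a.map w) x) fun y =>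
      not_congr (a.mem_inputs_tree _ _)
  | bottom f hf hl =>
    exact image_iff (onEdges a.map f ≤ ·) fun y => (onEdges_le_iff _ a.inj).symm

theorem onEdges_map_removed (a : T.Face) (b : a.tree.Face) :
    onEdges a.map b.removed = a.removed₂ b.kind (onEdges a.map b.edge) := by
  cases b with
  | inner f hf hv => rfl
  | top w hw hl => rfl
  | bottom f hf hl => exact a.onEdges_map_root

/-- The pairs of successive faces `(a, b)` and `(a', b')`, where `b` and `b'` are given by `(k, f)`
and `(k', f')`, lead to the same subtree with opposite signs: either they remove the same two
vertices in different orders, or they remove them in the same order but have opposite relative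
signs. -/
def Opposite (a : T.Face) (k : Kind) (f : T.E) (a' : T.Face) (k' : Kind) (f' : T.E) : Prop :=
  (∀ x, a.Mem₂ k f x ↔ a'.Mem₂ k' f' x) ∧
    ((a.removed = a'.removed₂ k' f' ∧ a.removed₂ k f = a'.removed ∧
        a.kind.eps * k.eps = a'.kind.eps * k'.eps) ∨
      (a.removed = a'.removed ∧ a.removed₂ k f = a'.removed₂ k' f' ∧
        a.kind.eps * k.eps = -(a'.kind.eps * k'.eps)))

theorem Opposite.symm {a a' : T.Face} {k k' : Kind} {f f' : T.E} (h : Opposite a k f a' k' f') :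
    Opposite a' k' f' a k f := by
  refine ⟨fun x => (h.1 x).symm, h.2.imp ?_ ?_⟩
  · exact fun ⟨h1, h2, h3⟩ => ⟨h2.symm, h1.symm, h3.symm⟩
  · exact fun ⟨h1, h2, h3⟩ => ⟨h1.symm, h2.symm, by rw [h3, neg_neg]⟩

theorem not_opposite_self (a : T.Face) (b : a.tree.Face) :
    ¬ Opposite a b.kind (onEdges a.map b.edge) a b.kind (onEdges a.map b.edge) := by
  rintro ⟨-, ⟨h, -⟩ | ⟨-, -, h⟩⟩
  · rw [← onEdges_map_removed] at h
    exact ((a.removesVertex.mem_iff _).1 b.removesVertex.mem).2 h.symm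
  · cases a <;> cases b <;> simp [kind, Kind.eps] at h

theorem opposite_inner_top_top_top {e he hv hl} :
    Opposite (inner e he hv : T.Face) .top (T.next e) (top e hv hl) .top (T.next e) := by
  refine ⟨fun x => ?_, Or.inr ⟨rfl, rfl, rfl⟩⟩
  simp only [Mem₂, Mem, IsInput, mem_inputs]
  grind

theorem opposite_inner_top_top_inner {e he hv w hw hl} (h : w ≠ T.next e) :
    Opposite (inner e he hv : T.Face) .top w (top w hw hl) .inner e := by
  refine ⟨fun x => ?_, Or.inl ⟨rfl, rfl, rfl⟩⟩
  simp only [Mem₂, Mem, IsInput]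
  grind

theorem opposite_inner_bottom_bottom_bottom {f : T.E} (hf : f ≠ T.root) {he hv he' hl} :
    Opposite (inner (T.next f) he hv) .bottom f (bottom (T.next f) he' hl) .bottom f := by
  have hlt : T.next f < f := next_lt hf
  exact ⟨fun x => and_congr_left fun hx =>
    ⟨fun _ => hlt.le.trans hx, fun _ => (hlt.trans_le hx).ne'⟩, Or.inl ⟨rfl, rfl, rfl⟩⟩

theorem opposite_inner_bottom_top_bottom {e f : T.E} (hs : T.Sib f e) (hne : f ≠ e) {he hv hl} :
    Opposite (inner e he hv) .bottom f (top e hv hl) .bottom f := by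
  refine ⟨fun x => and_congr_left fun hx => ⟨fun _ hxi => ?_, fun _ hxe => ?_⟩,
    Or.inr ⟨rfl, rfl, rfl⟩⟩
  · have hxi := mem_inputs.1 hxi
    rcases hx.eq_or_lt with rfl | h
    · exact next_ne he (hs.2.2.symm.trans hxi.2)
    · exact hne (hs.eq_of_le (hxi.2 ▸ le_next_of_lt h))
  · exact hne (hs.eq_of_le (hxe ▸ hx))

open Classical in
/-- The involution on pairs of successive faces which matches the two ways of removing two
vertices. The second face is a face of the first, so to avoid dependent types a pair is encoded by
the kinds and edges of its faces, cf. `code`. -/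
noncomputable def partner (T : OTree) : Kind × T.E × Kind × T.E → Kind × T.E × Kind × T.E
  | (.inner, e, .inner, f) => (.inner, f, .inner, e)
  | (.inner, e, .top, w) => if w = T.next e then (.top, e, .top, w) else (.top, w, .inner, e)
  | (.inner, e, .bottom, f) =>
      if T.next e = T.root then
        if T.next f = e then (.bottom, e, .bottom, f) else (.top, e, .bottom, f)
      else (.bottom, f, .inner, e)
  | (.top, w, .inner, e) => (.inner, e, .top, w)
  | (.top, w, .top, u) => if u = T.next w then (.inner, w, .top, u) else (.top, u, .top, w)
  | (.top, w, .bottom, f) =>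
      if w ≠ f ∧ T.next w = T.root then (.inner, w, .bottom, f) else (.bottom, f, .top, w)
  | (.bottom, e, .inner, f) => (.inner, f, .bottom, e)
  | (.bottom, e, .top, w) => (.top, w, .bottom, e)
  | (.bottom, e, .bottom, f) => (.inner, e, .bottom, f)

/-- The kinds and edges of a pair of successive faces, the second one given by `(k, f)`. -/
def code (a : T.Face) (k : Kind) (f : T.E) : Kind × T.E × Kind × T.E := (a.kind, a.edge, k, f)

/-- The pair of successive faces given by `a` and `(k, f)` is matched by `partner` with a pair of
the opposite sign. -/
def HasPartner (a : T.Face) (k : Kind) (f : T.E) : Prop :=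
  ∃ (a' : T.Face) (k' : Kind) (f' : T.E), a'.Valid k' f' ∧ code a' k' f' = partner T (code a k f) ∧
    code a k f = partner T (code a' k' f') ∧ Opposite a k f a' k' f'

theorem mem_vert_of_lt {a b : T.E} (h : a < b) : a ∈ T.vert := by
  obtain ⟨c, -, hc, hc'⟩ := exists_child h
  exact hc' ▸ T.next_mem c hc

theorem hasPartner_inner_inner {e he hv f} (h : (inner e he hv : T.Face).Valid .inner f) :
    HasPartner (inner e he hv) .inner f := by
  obtain ⟨h1, h2, h3, _⟩ := h
  exact ⟨inner f h2 h3, .inner, e, ⟨h1.symm, he, hv, h1.symm⟩, rfl, rfl, fun _ => and_comm,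
    Or.inl ⟨rfl, rfl, rfl⟩⟩

theorem hasPartner_inner_top {e he hv w} (h : (inner e he hv : T.Face).Valid .top w) :
    HasPartner (inner e he hv) .top w := by
  obtain ⟨h1, h2, h3, h4⟩ := h
  simp only [Mem, IsInput, removed, mem_inputs] at h1 h4 h3
  by_cases hw : w = T.next e
  · subst hw
    refine ⟨top e hv fun x hx hxv => ?_, .top, T.next e, ?_, ?_, ?_, opposite_inner_top_top_top⟩
    · have hx := mem_inputs.1 hx
      have hxe : x ≠ e := by rintro rfl; exact next_ne he hx.2
      exact hxe (h4 x hxe (Or.inr ⟨rfl, hx⟩) hxv)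
    · simp only [Valid, Mem, IsInput, removed, mem_inputs]
      grind
    · simp [code, partner, kind, edge]
    · simp [code, partner, kind, edge]
  · refine ⟨top w h2 fun x hx hxv => ?_, .inner, e, ?_, ?_, ?_, opposite_inner_top_top_inner hw⟩
    · have hx := mem_inputs.1 hx
      have hxe : x ≠ e := fun h => hw (by rw [← h, hx.2])
      exact hxe (h4 x hxe (Or.inl hx) hxv)
    · simp only [Valid, Mem, removed, rootEdge, mem_inputs]
      grind
    · simp [code, partner, kind, edge, hw]
    · simp [code, partner, kind, edge]

theorem hasPartner_top_inner {w hw hl e} (h : (top w hw hl : T.Face).Valid .inner e) :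
    HasPartner (top w hw hl) .inner e := by
  obtain ⟨h1, h2, h3, h4⟩ := h
  simp only [Mem, rootEdge, removed] at h1 h2 h4
  have hwe : w ≠ T.next e := fun h => h1 (mem_inputs.2 ⟨h2, h.symm⟩)
  refine ⟨inner e h2 h3, .top, w, ?_, ?_, ?_, (opposite_inner_top_top_inner hwe).symm⟩
  · simp only [Valid, Mem, IsInput, removed]
    grind
  · simp [code, partner, kind, edge]
  · simp [code, partner, kind, edge, hwe]

theorem next_ne_of_top {w u : T.E} (hl : ∀ x ∈ T.inputs w, x ∉ T.vert) (hu : u ∈ T.vert)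
    (h : u ≠ T.root) : T.next u ≠ w :=
  fun h' => hl u (mem_inputs.2 ⟨h, h'⟩) hu

theorem ne_root_of_top {w u : T.E} (hl : ∀ x ∈ T.inputs w, x ∉ T.vert) (hu : u ∈ T.vert)
    (h : u ≠ w) : w ≠ T.root := by
  rintro rfl
  obtain ⟨b, hb, hb', hb''⟩ := exists_child (lt_of_le_of_ne (root_le u) h.symm)
  refine hl b (mem_inputs.2 ⟨hb', hb''⟩) ?_
  rcases hb.eq_or_lt with rfl | hb
  · exact hu
  · exact mem_vert_of_lt hb

theorem hasPartner_top_top {w hw hl u} (h : (top w hw hl : T.Face).Valid .top u) :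
    HasPartner (top w hw hl) .top u := by
  obtain ⟨h1, h2, h3, h4⟩ := h
  simp only [Mem, IsInput, removed] at h1 h3 h4
  have hwr : w ≠ T.root := ne_root_of_top hl h2 h3
  by_cases hu : u = T.next w
  · subst hu
    refine ⟨inner w hwr hw, .top, T.next w, ⟨h3, h2, h3, ?_⟩, ?_, ?_,
      opposite_inner_top_top_top.symm⟩
    · rintro x _ (hx' | ⟨-, hx'⟩) hv
      · exact h4 x (fun h => hl x h hv) hx' hv
      · exact absurd hv (hl x hx')
    · simp [code, partner, kind, edge]
    · simp [code, partner, kind, edge]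
  · have hl' : ∀ x ∈ T.inputs u, x ∉ T.vert := fun x hx hv => by
      obtain rfl := h4 x (fun h => hl x h hv) hx hv
      exact hu (mem_inputs.1 hx).2.symm
    have hwu : w ≠ T.next u := (next_ne_of_top hl h2 (ne_root_of_top hl' hw h3.symm)).symm
    refine ⟨top u h2 hl', .top, w, ?_, ?_, ?_, fun _ => and_comm, Or.inl ⟨rfl, rfl, rfl⟩⟩
    · simp only [Valid, Mem, IsInput, removed]
      grind
    · simp [code, partner, kind, edge, hu]
    · simp [code, partner, kind, edge, hwu]

theorem hasPartner_inner_bottom_of_next_eq {e he hv f}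
    (h : (inner e he hv : T.Face).Valid .bottom f) (hr : T.next e = T.root) (hf : T.next f = e) :
    HasPartner (inner e he hv) .bottom f := by
  obtain ⟨h1, h2, h3⟩ := h
  simp only [Mem, IsInput, removed, rootEdge] at h1 h2 h3
  subst hf
  have hfr : f ≠ T.root := fun h => he (by rw [h, T.next_root])
  refine ⟨bottom (T.next f) (mem_inputs.2 ⟨he, hr⟩) fun x hx hxe hxv => ?_, .bottom, f,
    ⟨next_le f, mem_inputs.2 ⟨hfr, rfl⟩, fun x hx hx' hxf hv => ?_⟩, ?_, ?_,
    opposite_inner_bottom_bottom_bottom hfr⟩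
  · have hxf : x ≠ f := by
      rintro rfl
      exact he (mem_inputs.1 hx).2
    exact hxe (h3 x hxe (Or.inl hx) hxf hxv)
  · have hxe : x ≠ T.next f := fun h => next_ne he (h ▸ (mem_inputs.1 hx').2)
    exact absurd (h3 x hxe (Or.inr ⟨hr, hx'⟩) hxf hv) hxe
  · simp [code, partner, kind, edge, hr]
  · simp [code, partner, kind, edge]

theorem hasPartner_inner_bottom_of_next_ne {e he hv f}
    (h : (inner e he hv : T.Face).Valid .bottom f) (hr : T.next e = T.root) (hf : T.next f ≠ e) :
    HasPartner (inner e he hv) .bottom f := by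
  obtain ⟨h1, h2, h3⟩ := h
  simp only [Mem, IsInput, removed, rootEdge] at h1 h2 h3
  have hfi : f ∈ T.inputs T.root := h2.resolve_right fun h => hf (mem_inputs.1 h.2).2
  have hs : T.Sib f e := ⟨(mem_inputs.1 hfi).1, he, (mem_inputs.1 hfi).2.trans hr.symm⟩
  refine ⟨top e hv fun x hx hxv => ?_, .bottom, f,
    ⟨fun h => hf (mem_inputs.1 h).2, hfi, fun x _ hx' hxf hv => ?_⟩, ?_, ?_,
    opposite_inner_bottom_top_bottom hs h1⟩
  · have hxe : x ≠ e := by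
      rintro rfl
      exact next_ne he (mem_inputs.1 hx).2
    have hxf : x ≠ f := by
      rintro rfl
      exact hf (mem_inputs.1 hx).2
    exact hxe (h3 x hxe (Or.inr ⟨hr, hx⟩) hxf hxv)
  · by_contra hxe
    exact hxe (h3 x hxe (Or.inl hx') hxf hv)
  · simp [code, partner, kind, edge, hr, hf]
  · simp [code, partner, kind, edge, hr, h1.symm]

theorem hasPartner_inner_bottom_of_next_ne_root {e he hv f}
    (h : (inner e he hv : T.Face).Valid .bottom f) (hr : T.next e ≠ T.root) :
    HasPartner (inner e he hv) .bottom f := by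
  obtain ⟨h1, h2, h3⟩ := h
  simp only [Mem, IsInput, removed, rootEdge] at h1 h2 h3
  have hfi : f ∈ T.inputs T.root := h2.resolve_right fun h => hr h.1
  have hl : ∀ x ∈ T.inputs T.root, x ≠ f → x ∉ T.vert := fun x hx hxf hxv => by
    have hxe : x ≠ e := by
      rintro rfl
      exact hr (mem_inputs.1 hx).2
    exact hxe (h3 x hxe (Or.inl hx) hxf hxv)
  refine ⟨bottom f hfi hl, .inner, e, ⟨bottom_le_of_mem_vert hl hv he, h1.symm, hv, he⟩, ?_, ?_,
    fun _ => and_comm, Or.inl ⟨rfl, rfl, rfl⟩⟩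
  · simp [code, partner, kind, edge, hr]
  · simp [code, partner, kind, edge]

theorem hasPartner_inner_bottom {e he hv f} (h : (inner e he hv : T.Face).Valid .bottom f) :
    HasPartner (inner e he hv) .bottom f := by
  by_cases hr : T.next e = T.root
  · by_cases hf : T.next f = e
    · exact hasPartner_inner_bottom_of_next_eq h hr hf
    · exact hasPartner_inner_bottom_of_next_ne h hr hf
  · exact hasPartner_inner_bottom_of_next_ne_root h hr

theorem hasPartner_top_bottom {w hw hl f} (h : (top w hw hl : T.Face).Valid .bottom f) :
    HasPartner (top w hw hl) .bottom f := by
  obtain ⟨h1, h2, h3⟩ := h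
  simp only [Mem, IsInput, removed, rootEdge] at h1 h2 h3
  have hf := mem_inputs.1 h2
  have hwr : w ≠ T.root := by
    rintro rfl
    exact h1 h2
  by_cases hc : w ≠ f ∧ T.next w = T.root
  · have hfw : T.next f ≠ w := fun h => h1 (mem_inputs.2 ⟨hf.1, h⟩)
    have hs : T.Sib f w := ⟨hf.1, hwr, hf.2.trans hc.2.symm⟩
    refine ⟨inner w hwr hw, .bottom, f, ⟨hc.1.symm, Or.inl h2, ?_⟩, ?_, ?_,
      (opposite_inner_bottom_top_bottom hs hc.1.symm).symm⟩
    · rintro x _ (hx' | ⟨-, hx'⟩) hxf hv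
      · exact h3 x (fun h => hl x h hv) hx' hxf hv
      · exact absurd hv (hl x hx')
    · simp [code, partner, kind, edge, hc]
    · simp [code, partner, kind, edge, hc.2, hfw]
  · have hl' : ∀ x ∈ T.inputs T.root, x ≠ f → x ∉ T.vert := fun x hx hxf hxv => by
      obtain rfl := h3 x (fun h => hl x h hxv) hx hxf hxv
      exact hc ⟨hxf, (mem_inputs.1 hx).2⟩
    refine ⟨bottom f h2 hl', .top, w, ⟨bottom_le_of_mem_vert hl' hw hwr, hw, hwr,
      fun x _ hx hv => absurd hv (hl x hx)⟩, ?_, ?_, fun _ => and_comm, Or.inl ⟨rfl, rfl, rfl⟩⟩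
    · simp only [code, partner, kind, edge]
      rw [if_neg hc]
    · simp [code, partner, kind, edge]

theorem hasPartner_bottom_inner {e he hl f} (h : (bottom e he hl : T.Face).Valid .inner f) :
    HasPartner (bottom e he hl) .inner f := by
  obtain ⟨h1, h2, h3, h4⟩ := h
  simp only [Mem, rootEdge, removed] at h1 h2 h4
  have hef : e < f := lt_of_le_of_ne h1 h2.symm
  have hr : T.next f ≠ T.root := fun h => (mem_inputs.1 he).1
    (le_antisymm (h ▸ le_next_of_lt hef) (root_le e))
  refine ⟨inner f h4 h3, .bottom, e, ⟨h2.symm, Or.inl he, ?_⟩, ?_, ?_, fun _ => and_comm,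
    Or.inl ⟨rfl, rfl, rfl⟩⟩
  · rintro x _ (hx' | ⟨hx', -⟩) hxe hv
    · exact absurd hv (hl x hx' hxe)
    · exact absurd hx' hr
  · simp [code, partner, kind, edge]
  · simp [code, partner, kind, edge, hr]

theorem hasPartner_bottom_top {e he hl w} (h : (bottom e he hl : T.Face).Valid .top w) :
    HasPartner (bottom e he hl) .top w := by
  obtain ⟨h1, h2, h3, h4⟩ := h
  simp only [Mem, IsInput, removed] at h1 h3 h4
  have he' := mem_inputs.1 he
  have hlw : ∀ x ∈ T.inputs w, x ∉ T.vert := fun x hx hv =>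
    (mem_inputs.1 hx).1 (h4 x (h1.trans ((mem_inputs.1 hx).2 ▸ next_le x)) hx hv)
  have hc : ¬ (w ≠ e ∧ T.next w = T.root) := by
    rintro ⟨hwe, hr⟩
    exact he'.1 (le_antisymm (hr ▸ le_next_of_lt (lt_of_le_of_ne h1 (Ne.symm hwe))) (root_le e))
  refine ⟨top w h2 hlw, .bottom, e, ⟨fun h => h3 (le_antisymm ?_ (root_le w)), he,
    fun x _ hx hxe hv => absurd hv (hl x hx hxe)⟩, ?_, ?_, fun _ => and_comm,
    Or.inl ⟨rfl, rfl, rfl⟩⟩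
  · rw [← he'.2, (mem_inputs.1 h).2]
  · simp [code, partner, kind, edge]
  · simp only [code, partner, kind, edge]
    rw [if_neg hc]

theorem hasPartner_bottom_bottom {e he hl f} (h : (bottom e he hl : T.Face).Valid .bottom f) :
    HasPartner (bottom e he hl) .bottom f := by
  obtain ⟨h1, h2, h3⟩ := h
  simp only [Mem, IsInput, removed, rootEdge] at h1 h2 h3
  obtain ⟨hfr, rfl⟩ := mem_inputs.1 h2
  have he' := mem_inputs.1 he
  refine ⟨inner (T.next f) he'.1 (T.next_mem f hfr), .bottom, f,
    ⟨(next_lt hfr).ne', Or.inr ⟨he'.2, h2⟩, ?_⟩, ?_, ?_,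
    (opposite_inner_bottom_bottom_bottom hfr).symm⟩
  · rintro x hx (hx' | ⟨-, hx'⟩) hxf hv
    · exact absurd hv (hl x hx' hx)
    · exact absurd (h3 x ((mem_inputs.1 hx').2 ▸ next_le x) hx' hxf hv) (mem_inputs.1 hx').1
  · simp [code, partner, kind, edge]
  · simp [code, partner, kind, edge, he'.2]

theorem hasPartner {a : T.Face} {k : Kind} {f : T.E} (h : a.Valid k f) : HasPartner a k f := by
  cases a <;> cases k
  exacts [hasPartner_inner_inner h, hasPartner_inner_top h, hasPartner_inner_bottom h,
    hasPartner_top_inner h, hasPartner_top_top h, hasPartner_top_bottom h,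
    hasPartner_bottom_inner h, hasPartner_bottom_top h, hasPartner_bottom_bottom h]

variable {a a' : T.Face} {b : a.tree.Face} {b' : a'.tree.Face}

theorem mem_vert_tree_tree (a : T.Face) (b : a.tree.Face) (x : b.tree.E) :
    x ∈ b.tree.vert ↔ onEdges (b.map ≫ a.map) x ∈ T.vert ∧
      onEdges (b.map ≫ a.map) x ≠ a.removed ∧
      onEdges (b.map ≫ a.map) x ≠ onEdges a.map b.removed := by
  rw [b.removesVertex.mem_iff, a.removesVertex.mem_iff, onEdges_comp, a.inj.ne_iff, and_assoc]

theorem Opposite.exists_iso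
    (h : Opposite a b.kind (onEdges a.map b.edge) a' b'.kind (onEdges a'.map b'.edge)) :
    ∃ φ : b.tree ≅ b'.tree, φ.hom ≫ b'.map ≫ a'.map = b.map ≫ a.map := by
  obtain ⟨hmem, hremoved⟩ := h
  rw [← onEdges_map_removed, ← onEdges_map_removed] at hremoved
  refine exists_iso_of_range_eq _ _ (a.inj.comp b.inj) (a'.inj.comp b'.inj) ?_ ?_
  · ext x
    rw [Set.mem_range, Set.mem_range, exists_onEdges_comp_map_eq_iff,
      exists_onEdges_comp_map_eq_iff, hmem]
  · intro x y hxy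
    rw [mem_vert_tree_tree, mem_vert_tree_tree, hxy]
    rcases hremoved with ⟨h1, h2, -⟩ | ⟨h1, h2, -⟩
    · rw [h1, h2, and_comm (a := _ ≠ _)]
    · rw [h1, h2]

open Classical in
theorem sgn_mul_sgn (p : Planar T) (a : T.Face) (b : a.tree.Face) :
    a.sgn p * b.sgn (p.pullback a.map) = (a.kind.eps * b.kind.eps) *
      ((-1) ^ p.label a.removed * (-1) ^ p.label (onEdges a.map b.removed)) *
        (if p.Before a.removed (onEdges a.map b.removed) then -1 else 1) := by
  rw [sgn_eq, sgn_eq, Planar.label_onEdges_of_removesVertex a.removesVertex]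
  split_ifs <;> ring

theorem Opposite.sgn_add_sgn (p : Planar T)
    (h : Opposite a b.kind (onEdges a.map b.edge) a' b'.kind (onEdges a'.map b'.edge)) :
    a.sgn p * b.sgn (p.pullback a.map) + a'.sgn p * b'.sgn (p.pullback a'.map) = 0 := by
  classical
  have hne : onEdges a.map b.removed ≠ a.removed :=
    ((a.removesVertex.mem_iff _).1 b.removesVertex.mem).2
  have hremoved := h.2
  rw [← onEdges_map_removed, ← onEdges_map_removed] at hremoved
  rw [sgn_mul_sgn, sgn_mul_sgn]
  rcases hremoved with ⟨h1, h2, h3⟩ | ⟨h1, h2, h3⟩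
  · rw [← h1, ← h2, h3]
    by_cases hb : p.Before a.removed (onEdges a.map b.removed)
    · rw [if_pos hb, if_neg hb.asymm]
      ring
    · rw [if_neg hb, if_pos ((Planar.not_before_iff hne.symm).1 hb)]
      ring
  · rw [← h1, ← h2, h3]
    ring

theorem code_injective (T : OTree) : Function.Injective
    fun x : Σ a : T.Face, a.tree.Face => code x.1 x.2.kind (onEdges x.1.map x.2.edge) := by
  rintro ⟨a, b⟩ ⟨a', b'⟩ hab
  simp only [code, Prod.mk.injEq] at hab
  obtain ⟨hk, he, hk', he'⟩ := hab
  obtain rfl := ext_kind_edge hk he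
  obtain rfl := ext_kind_edge hk' (a.inj he')
  rfl

end Face

end OTree

namespace DSet

open OTree

variable {X : DSet.{u}} {n : ℕ}

theorem cls_face_face_eq (g : X.Gen (n + 1 + 1)) {a a' : g.tree.Face} {b : a.tree.Face}
    {b' : a'.tree.Face} (φ : b.tree ≅ b'.tree)
    (hφ : φ.hom ≫ b'.map ≫ a'.map = b.map ≫ a.map) :
    cls ((g.face a').face b') = cls ((g.face a).face b) := by
  refine cls_eq_of_iso (g := (g.face a').face b') (g' := (g.face a).face b) φ ?_ ?_
  · change res b.map (res a.map g.dendrex) = res φ.hom (res b'.map (res a'.map g.dendrex))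
    rw [← res_comp, ← res_comp, ← res_comp, ← hφ, Category.assoc]
  · change (g.planar.pullback a.map).pullback b.map =
      ((g.planar.pullback a'.map).pullback b'.map).pullback φ.hom
    rw [← Planar.pullback_comp, ← Planar.pullback_comp, ← Planar.pullback_comp, ← hφ,
      Category.assoc]

theorem d_boundaryCls (h : X.BoundaryDescends) (g : X.Gen (n + 1 + 1)) :
    d h n (boundaryCls g) = 0 := by
  rw [boundaryCls, map_sum]
  simp only [map_smul, d_cls, boundaryCls, Finset.smul_sum, smul_smul]
  rw [Finset.sum_sigma']
  refine sum_eq_zero_of_partner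
    (fun x : (Σ a : g.tree.Face, a.tree.Face) =>
      (x.1.sgn g.planar * x.2.sgn (g.planar.pullback x.1.map)) • cls ((g.face x.1).face x.2))
    _ (Face.code_injective g.tree) (Face.partner g.tree) ?_
  rintro ⟨a, b⟩
  obtain ⟨a', k', f', hv, hcode, hcode', hopp⟩ := Face.hasPartner (a.valid_kind_edge b)
  obtain ⟨b', rfl, rfl⟩ := Face.exists_face_of_valid hv
  refine ⟨⟨a', b'⟩, hcode, hcode', ?_, ?_⟩
  · rintro ⟨⟩
    exact Face.not_opposite_self a b hopp
  · obtain ⟨φ, hφ⟩ := hopp.exists_iso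
    rw [cls_face_face_eq g φ hφ, ← add_smul, hopp.sgn_add_sgn, zero_smul]

theorem d_comp_d (h : X.BoundaryDescends) (n : ℕ) : d h n ∘ₗ d h (n + 1) = 0 :=
  hom_ext_cls fun g => by rw [LinearMap.comp_apply, d_cls, d_boundaryCls, LinearMap.zero_apply]

end DSet

/-! ### Unary vertices and degeneracies -/

namespace OTree

variable {R S T R' S' T' : OTree}

theorem IsUnary.iso {v i : S.E} (h : S.IsUnary v i) (τ : S ≅ T) :
    T.IsUnary (onEdges τ.hom v) (onEdges τ.hom i) := by
  refine ⟨(onEdges_hom_mem_vert τ).2 h.mem, ?_⟩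
  ext x
  rw [← onEdges_hom_inv τ x, onEdges_hom_mem_inputs, h.inputs_eq, Finset.mem_singleton,
    Finset.mem_singleton, (onEdges_hom_injective τ).eq_iff]

namespace Face

/-- `e` is the only edge of the tree which is not an edge of the face. -/
def Omits (a : T.Face) (e : T.E) : Prop := ∀ x, a.Mem x ↔ x ≠ e

theorem Omits.eq_edge_of_inner {e f : T.E} {hf hv} (h : (inner f hf hv : T.Face).Omits e) :
    f = e :=
  by_contra fun hne => (h f).2 hne rfl

theorem Omits.isUnary_of_top {e w : T.E} {hw hl} (h : (top w hw hl : T.Face).Omits e) :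
    T.IsUnary w e := by
  refine ⟨hw, ?_⟩
  ext x
  rw [Finset.mem_singleton]
  exact not_iff_not.1 (h x)

theorem Omits.eq_root_of_bottom {e f : T.E} {hf hl} (h : (bottom f hf hl : T.Face).Omits e) :
    e = T.root := by
  by_contra hne
  exact (mem_inputs.1 hf).1 (le_antisymm ((h T.root).2 (Ne.symm hne)) (root_le f))

theorem Omits.eq {a b : T.Face} {e : T.E} (ha : a.Omits e) (hb : b.Omits e) : a = b := by
  cases a with
  | inner f hf hv =>
    obtain rfl := ha.eq_edge_of_inner
    cases b with
    | inner f' hf' hv' =>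
      obtain rfl := hb.eq_edge_of_inner
      rfl
    | top w hw hl => exact absurd hv (hl _ hb.isUnary_of_top.mem_inputs)
    | bottom f' hf' hl => exact absurd hb.eq_root_of_bottom hf
  | top w hw hl =>
    have unary := ha.isUnary_of_top
    cases b with
    | inner f' hf' hv' =>
      exact absurd (hb.eq_edge_of_inner ▸ hv') (hl _ unary.mem_inputs)
    | top w' hw' hl' =>
      obtain rfl : w = w' := unary.next_eq.symm.trans hb.isUnary_of_top.next_eq
      rfl
    | bottom f' hf' hl => exact absurd hb.eq_root_of_bottom unary.ne_root
  | bottom f hf hl =>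
    obtain rfl := ha.eq_root_of_bottom
    cases b with
    | inner f' hf' hv' => exact absurd hb.eq_edge_of_inner hf'
    | top w' hw' hl' => exact absurd rfl hb.isUnary_of_top.ne_root
    | bottom f' hf' hl' =>
      obtain rfl : f = f' :=
        le_antisymm ((ha f').2 (mem_inputs.1 hf').1) ((hb f).2 (mem_inputs.1 hf).1)
      rfl

end Face

namespace IsUnary

variable {v i : T.E}

open Classical in
/-- The elementary face of `T` which removes the output edge of the unary vertex `v`. -/
noncomputable def outputFace (h : T.IsUnary v i) : T.Face :=
  if hv : v = T.root then
    .bottom i (hv ▸ h.mem_inputs) fun e he hne => by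
      rw [← hv, h.inputs_eq, Finset.mem_singleton] at he
      exact absurd he hne
  else .inner v hv h.mem

open Classical in
/-- The elementary face of `T` which removes the input edge `i` of the unary vertex `v`. -/
noncomputable def inputFace (h : T.IsUnary v i) : T.Face :=
  if hi : i ∈ T.vert then .inner i h.ne_root hi
  else .top v h.mem fun e he => by
    rw [h.inputs_eq, Finset.mem_singleton] at he
    exact he ▸ hi

theorem input_le_iff_ne (h : T.IsUnary v i) (hv : v = T.root) {x : T.E} : i ≤ x ↔ x ≠ v := by
  rw [← h.vertex_lt_iff_le]
  subst hv
  exact (root_le x).lt_iff_ne'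

theorem outputFace_omits (h : T.IsUnary v i) : h.outputFace.Omits v := by
  intro x
  unfold outputFace
  split_ifs with hv
  · exact h.input_le_iff_ne hv
  · rfl

theorem removed_outputFace (h : T.IsUnary v i) : h.outputFace.removed = v := by
  unfold outputFace
  split_ifs with hv
  exacts [hv.symm, rfl]

theorem sgn_outputFace (h : T.IsUnary v i) (p : Planar T) :
    h.outputFace.sgn p = (-1) ^ p.label v := by
  unfold outputFace
  split_ifs with hv
  · change 1 = _
    rw [hv, Planar.label_root, pow_zero]
  · rfl

theorem isInput_outputFace (h : T.IsUnary v i) (u x : T.E) :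
    h.outputFace.IsInput u x ↔ x ∈ T.inputs u ∨ (v ∈ T.inputs u ∧ x = i) := by
  unfold outputFace
  split_ifs with hv
  · have : v ∉ T.inputs u := fun h' => (OTree.mem_inputs.1 h').1 hv
    simp [Face.IsInput, this]
  · simp only [Face.IsInput, h.inputs_eq, Finset.mem_singleton]
    simp [OTree.mem_inputs, hv]

theorem inputFace_omits (h : T.IsUnary v i) : h.inputFace.Omits i := by
  intro x
  unfold inputFace
  split_ifs with hi
  · rfl
  · simp [Face.Mem, h.inputs_eq]

theorem sgn_inputFace (h : T.IsUnary v i) (p : Planar T) :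
    h.inputFace.sgn p = (-1) ^ p.label i := by
  unfold inputFace
  split_ifs with hi
  · rfl
  · rw [Planar.label_input_of_isUnary h]
    rfl

theorem inputFace_ne_outputFace (h : T.IsUnary v i) : h.inputFace ≠ h.outputFace := by
  intro heq
  have := (h.inputFace_omits v).2 h.lt.ne
  rw [heq] at this
  exact (h.outputFace_omits v).1 this rfl

theorem exists_isUnary_of_mem (h : T.IsUnary v i) (a : T.Face) (hv : a.Mem v) (hi : a.Mem i)
    (hr : v ≠ a.removed) (hin : ∀ x, a.IsInput v x ↔ x = i) :
    ∃ v' i', a.tree.IsUnary v' i' ∧ onEdges a.map v' = v ∧ onEdges a.map i' = i := by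
  obtain ⟨v', hv'⟩ := Face.exists_onEdges_map_eq_iff.2 hv
  obtain ⟨i', hi'⟩ := Face.exists_onEdges_map_eq_iff.2 hi
  refine ⟨v', i', ⟨(a.removesVertex.mem_iff v').2 ⟨hv' ▸ h.mem, hv' ▸ hr⟩, ?_⟩, hv', hi'⟩
  ext x
  rw [Finset.mem_singleton, Face.mem_inputs_tree, hv', hin, ← hi', a.inj.eq_iff]

theorem omits_or_exists_isUnary (h : T.IsUnary v i) (a : T.Face) :
    a.Omits v ∨ a.Omits i ∨
      ∃ v' i', a.tree.IsUnary v' i' ∧ onEdges a.map v' = v ∧ onEdges a.map i' = i := by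
  cases a with
  | inner e he hv =>
    by_cases hev : e = v
    · exact Or.inl fun x => by rw [← hev]; rfl
    by_cases hei : e = i
    · exact Or.inr (Or.inl fun x => by rw [← hei]; rfl)
    refine Or.inr (Or.inr (h.exists_isUnary_of_mem _ (Ne.symm hev) (Ne.symm hei) (Ne.symm hev)
      fun x => ?_))
    simp only [Face.IsInput, h.inputs_eq, Finset.mem_singleton]
    exact or_iff_left fun h' => hei (h.eq_input_of_next_eq he h'.1)
  | top w hw hl =>
    by_cases hwv : w = v
    · exact Or.inr (Or.inl fun x => by simp [Face.Mem, hwv, h.inputs_eq])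
    refine Or.inr (Or.inr (h.exists_isUnary_of_mem _ (fun hv => hl v hv h.mem) (fun hi => ?_)
      (Ne.symm hwv) fun x => ?_))
    · exact hwv ((OTree.mem_inputs.1 hi).2.symm.trans h.next_eq)
    · simp [Face.IsInput, h.inputs_eq]
  | bottom e he hl =>
    by_cases hv : v = T.root
    · left
      intro x
      have : e = i := by simpa [← hv, h.inputs_eq] using he
      rw [← h.input_le_iff_ne hv, ← this]
      rfl
    have hev := Face.bottom_le_of_mem_vert hl h.mem hv
    exact Or.inr (Or.inr (h.exists_isUnary_of_mem _ hev (hev.trans h.lt.le) hv fun x => by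
      simp [Face.IsInput, h.inputs_eq]))

end IsUnary

/-- `π` collapses the unary vertex `v` with input `i`, and `s` is its section which avoids `v`. -/
structure Split (T S : OTree) (v i : T.E) where
  unary : T.IsUnary v i
  π : T ⟶ S
  s : S ⟶ T
  s_π : s ≫ π = 𝟙 S
  π_s_apply : ∀ e, e ≠ v → onEdges s (onEdges π e) = e
  π_s_self : onEdges s (onEdges π v) = i

theorem IsUnary.op_map_inputs {v i : T.E} (h : T.IsUnary v i) {k : T.E → h.outputFace.tree.E}
    (hk : ∀ e, e ≠ v → onEdges h.outputFace.map (k e) = e)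
    (hkv : onEdges h.outputFace.map (k v) = i) {u : T.E} (hu : u ∈ T.vert) (huv : u ≠ v) :
    h.outputFace.tree.Op ((T.inputs u).val.map k) (k u) := by
  have hku : k u ∈ h.outputFace.tree.vert := (h.outputFace.removesVertex.mem_iff _).2 (by
    rw [hk u huv, h.removed_outputFace]
    exact ⟨hu, huv⟩)
  have hi : i ∉ T.inputs u := fun hi => huv ((OTree.mem_inputs.1 hi).2.symm.trans h.next_eq)
  refine (Op.vertex hku).map_inputs ?_ fun x => ?_
  · intro x hx y hy hxy
    have heq := congrArg (onEdges h.outputFace.map) hxy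
    by_cases hxv : x = v <;> by_cases hyv : y = v
    · rw [hxv, hyv]
    · rw [hxv, hkv, hk y hyv] at heq
      exact absurd (heq ▸ hy) hi
    · rw [hyv, hkv, hk x hxv] at heq
      exact absurd (heq ▸ hx) hi
    · rwa [hk x hxv, hk y hyv] at heq
  · rw [Finset.mem_val, Face.mem_inputs_tree, hk u huv, h.isInput_outputFace]
    constructor
    · rintro ⟨y, hy, rfl⟩
      by_cases hyv : y = v
      · exact Or.inr ⟨hyv ▸ hy, by rw [hyv, hkv]⟩
      · exact Or.inl (by rwa [hk y hyv])
    · rintro (hx | ⟨hv, hx⟩)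
      · exact ⟨_, hx, h.outputFace.inj
          (hk _ ((h.outputFace_omits _).1 (Face.mem_onEdges_map x)))⟩
      · exact ⟨v, hv, h.outputFace.inj (hkv.trans hx.symm)⟩

theorem exists_split {v i : T.E} (h : T.IsUnary v i) : ∃ S, Nonempty (Split T S v i) := by
  classical
  have hmem : ∀ e, h.outputFace.Mem (if e = v then i else e) := fun e => by
    rw [h.outputFace_omits]
    split_ifs with he
    exacts [h.lt.ne', he]
  choose k hk using fun e => Face.exists_onEdges_map_eq_iff.2 (hmem e)
  have hkv : onEdges h.outputFace.map (k v) = i := by rw [hk, if_pos rfl]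
  have hke : ∀ e, e ≠ v → onEdges h.outputFace.map (k e) = e := fun e he => by rw [hk, if_neg he]
  have hki : k v = k i := h.outputFace.inj (by rw [hkv, hke i h.lt.ne'])
  refine ⟨h.outputFace.tree, ⟨⟨h, Hom.mk k fun u hu => ?_, h.outputFace.map, ?_, hke, hkv⟩⟩⟩
  · by_cases huv : u = v
    · subst huv
      rw [h.inputs_eq, Finset.singleton_val, Multiset.map_singleton, hki]
      exact Op.id _
    · exact h.op_map_inputs hke hkv hu huv
  · exact hom_ext fun y => h.outputFace.inj
      (hke _ ((h.outputFace_omits _).1 (Face.mem_onEdges_map y)))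

namespace Split

variable {v i : T.E} (σ : Split T S v i)

theorem s_π_apply (y : S.E) : onEdges σ.π (onEdges σ.s y) = y := by
  rw [← onEdges_comp, σ.s_π, onEdges_id]

theorem s_injective : Function.Injective (onEdges σ.s) :=
  Function.LeftInverse.injective σ.s_π_apply

theorem π_s_of_eq {e : T.E} (h : e = v) : onEdges σ.s (onEdges σ.π e) = i := by
  subst h
  exact σ.π_s_self

theorem s_ne (y : S.E) : onEdges σ.s y ≠ v := fun h => σ.unary.lt.ne
  (h.symm.trans ((congrArg (onEdges σ.s) (σ.s_π_apply y)).symm.trans (σ.π_s_of_eq h)))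

theorem π_eq : onEdges σ.π v = onEdges σ.π i :=
  σ.s_injective (by rw [σ.π_s_self, σ.π_s_apply i σ.unary.lt.ne'])

theorem exists_s_eq_iff {e : T.E} : (∃ y, onEdges σ.s y = e) ↔ e ≠ v :=
  ⟨by rintro ⟨y, rfl⟩; exact σ.s_ne y, fun h => ⟨_, σ.π_s_apply e h⟩⟩

theorem s_lt_iff {a b : S.E} : onEdges σ.s a < onEdges σ.s b ↔ a < b :=
  onEdges_lt_iff _ σ.s_injective

theorem le_π_s (e : T.E) : e ≤ onEdges (σ.π ≫ σ.s) e := by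
  by_cases he : e = v
  · rw [he, onEdges_comp, σ.π_s_self]
    exact σ.unary.lt.le
  · exact (σ.π_s_apply e he).ge

theorem π_s_comp {θ : T ⟶ R} (h : onEdges θ v = onEdges θ i) : (σ.π ≫ σ.s) ≫ θ = θ := by
  ext e
  by_cases he : e = v
  · rw [he, onEdges_comp, onEdges_comp, σ.π_s_self, h]
  · rw [onEdges_comp, onEdges_comp, σ.π_s_apply e he]

theorem π_s_unique (σ' : Split T S' v i) : σ.π ≫ σ.s = σ'.π ≫ σ'.s := by
  ext e
  by_cases he : e = v
  · rw [he, onEdges_comp, onEdges_comp, σ.π_s_self, σ'.π_s_self]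
  · rw [onEdges_comp, onEdges_comp, σ.π_s_apply e he, σ'.π_s_apply e he]

theorem eq_or_of_π_eq {a b : T.E} (h : onEdges σ.π a = onEdges σ.π b) :
    a = b ∨ (a = v ∧ b = i) ∨ (a = i ∧ b = v) := by
  have hs := congrArg (onEdges σ.s) h
  by_cases ha : a = v <;> by_cases hb : b = v
  · exact Or.inl (ha.trans hb.symm)
  · rw [σ.π_s_of_eq ha, σ.π_s_apply b hb] at hs
    exact Or.inr (Or.inl ⟨ha, hs.symm⟩)
  · rw [σ.π_s_of_eq hb, σ.π_s_apply a ha] at hs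
    exact Or.inr (Or.inr ⟨hs, hb⟩)
  · rw [σ.π_s_apply a ha, σ.π_s_apply b hb] at hs
    exact Or.inl hs

theorem mem_vert_of_s_mem_vert {y : S.E} (hy : onEdges σ.s y ∈ T.vert) : y ∈ S.vert := by
  by_contra h
  have hop : S.Op ((T.inputs (onEdges σ.s y)).val.map (onEdges σ.π)) y := by
    have hop := σ.π.map_vert _ hy
    rwa [show σ.π.toFun (onEdges σ.s y) = y from σ.s_π_apply y] at hop
  obtain ⟨b, hb, hby⟩ := Multiset.mem_map.1
    ((hop.eq_singleton_of_leaf h).symm ▸ Multiset.mem_singleton_self y)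
  obtain ⟨hb, hnext⟩ := OTree.mem_inputs.1 (Finset.mem_def.2 hb)
  rcases σ.eq_or_of_π_eq (hby.trans (σ.s_π_apply y).symm) with rfl | ⟨hbv, hi⟩ | ⟨-, hv⟩
  · exact next_ne hb hnext
  · exact absurd (next_le b) (by rw [hnext, hi, hbv]; exact σ.unary.lt.not_ge)
  · exact σ.s_ne y hv

theorem removesVertex : RemovesVertex σ.s v :=
  ⟨σ.s_injective, σ.unary.mem,
    fun y => ⟨fun hy => ⟨onEdges_mem_vert _ σ.s_injective hy, σ.s_ne y⟩,
      fun hy => σ.mem_vert_of_s_mem_vert hy.1⟩,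
    fun _ _ hx => σ.exists_s_eq_iff.2 hx⟩

theorem s_mem_vert_iff {y : S.E} : onEdges σ.s y ∈ T.vert ↔ y ∈ S.vert :=
  ((σ.removesVertex.mem_iff y).trans (and_iff_left (σ.s_ne y))).symm

theorem size_eq (σ : Split T S v i) : S.size + 1 = T.size := σ.removesVertex.size_eq

theorem le_iff {a b : T.E} :
    a ≤ b ↔ onEdges σ.π a ≤ onEdges σ.π b ∧
      (b = v → a ≠ v → onEdges σ.π a ≠ onEdges σ.π v) := by
  have hs : ∀ x y, onEdges σ.s x ≤ onEdges σ.s y ↔ x ≤ y := fun x y =>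
    onEdges_le_iff _ σ.s_injective
  by_cases ha : a = v <;> by_cases hb : b = v
  · simp [ha, hb]
  · subst ha
    rw [← hs, σ.π_s_self, σ.π_s_apply b hb, ← σ.unary.vertex_lt_iff_le]
    simp only [hb, false_imp_iff, and_true]
    exact ⟨fun h => lt_of_le_of_ne h (Ne.symm hb), le_of_lt⟩
  · subst hb
    rw [← hs, σ.π_s_self, σ.π_s_apply a ha, ← σ.unary.lt_input_iff_le, lt_iff_le_and_ne]
    simp only [ha, ne_eq, not_false_eq_true, true_imp_iff]
    rw [σ.π_eq, ← σ.s_injective.eq_iff, σ.π_s_apply a ha, σ.π_s_apply i σ.unary.lt.ne']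
  · rw [← hs, σ.π_s_apply a ha, σ.π_s_apply b hb]
    simp [hb]

theorem mem_vert_iff {e : T.E} : e ∈ T.vert ↔ e = v ∨ onEdges σ.π e ∈ S.vert := by
  by_cases he : e = v
  · simp [he, σ.unary.mem]
  · rw [σ.removesVertex.mem_iff, σ.π_s_apply e he]
    simp [he]

theorem bijective_comp {f : R ⟶ T} (hf : Function.Injective (onEdges f)) {w : T.E}
    (hw : w = v ∨ w = i) (hr : ∀ e, (∃ y, onEdges f y = e) ↔ e ≠ w) :
    Function.Bijective (onEdges (f ≫ σ.π)) := by
  have hne : ∀ y, onEdges f y ≠ w := fun y => (hr _).1 ⟨y, rfl⟩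
  constructor
  · intro x y hxy
    rw [onEdges_comp, onEdges_comp] at hxy
    rcases σ.eq_or_of_π_eq hxy with h | ⟨hx, hy⟩ | ⟨hx, hy⟩
    · exact hf h
    · rcases hw with rfl | rfl
      exacts [absurd hx (hne x), absurd hy (hne y)]
    · rcases hw with rfl | rfl
      exacts [absurd hy (hne y), absurd hx (hne x)]
  · intro y
    by_cases hy : onEdges σ.s y = w
    · have hi : w = i := hw.resolve_left fun h => σ.s_ne y (hy.trans h)
      obtain ⟨x, hx⟩ := (hr v).2 (hi ▸ σ.unary.lt.ne)
      refine ⟨x, ?_⟩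
      rw [onEdges_comp, hx, σ.π_eq, congrArg (onEdges σ.π) (hi.symm.trans hy.symm), σ.s_π_apply]
    · obtain ⟨x, hx⟩ := (hr _).2 hy
      exact ⟨x, by rw [onEdges_comp, hx, σ.s_π_apply]⟩

theorem exists_orderIso {v' i' : T'.E} (σ' : Split T' S' v' i') (φ : S ≅ S')
    (h : onEdges φ.hom (onEdges σ.π v) = onEdges σ'.π v') :
    ∃ K : T.E ≃o T'.E, (∀ e, K e = v' ↔ e = v) ∧
      ∀ e, onEdges σ'.π (K e) = onEdges φ.hom (onEdges σ.π e) := by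
  classical
  let k : T.E → T'.E := fun e =>
    if e = v then v' else onEdges σ'.s (onEdges φ.hom (onEdges σ.π e))
  have hkv : k v = v' := if_pos rfl
  have hke : ∀ e, e ≠ v → k e = onEdges σ'.s (onEdges φ.hom (onEdges σ.π e)) :=
    fun e he => if_neg he
  have hkv' : ∀ e, k e = v' ↔ e = v := by
    refine fun e => ⟨fun h' => ?_, fun h' => h' ▸ hkv⟩
    by_contra he
    rw [hke e he] at h'
    exact σ'.s_ne _ h'
  have hkπ : ∀ e, onEdges σ'.π (k e) = onEdges φ.hom (onEdges σ.π e) := by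
    intro e
    by_cases he : e = v
    · rw [he, hkv, h]
    · rw [hke e he, σ'.s_π_apply]
  have hle : ∀ a b, k a ≤ k b ↔ a ≤ b := by
    intro a b
    rw [σ.le_iff, σ'.le_iff, hkπ, hkπ, onEdges_le_iff _ (onEdges_hom_injective φ), hkv', ne_eq,
      hkv', ← h, ne_eq, (onEdges_hom_injective φ).eq_iff]
  have hsurj : Function.Surjective k := by
    intro e
    by_cases he : e = v'
    · exact ⟨v, by rw [hkv, he]⟩
    · refine ⟨onEdges σ.s (onEdges φ.inv (onEdges σ'.π e)), ?_⟩
      rw [hke _ (σ.s_ne _), σ.s_π_apply, onEdges_hom_inv, σ'.π_s_apply e he]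
  exact ⟨RelIso.ofSurjective (OrderEmbedding.ofMapLEIff k hle) hsurj, hkv', hkπ⟩

theorem exists_iso {v' i' : T'.E} (σ' : Split T' S' v' i') (φ : S ≅ S')
    (h : onEdges φ.hom (onEdges σ.π v) = onEdges σ'.π v') :
    ∃ ψ : T ≅ T', ψ.hom ≫ σ'.π = σ.π ≫ φ.hom ∧ onEdges ψ.hom v = v' ∧
      σ.s ≫ ψ.hom = φ.hom ≫ σ'.s := by
  obtain ⟨K, hKv, hKπ⟩ := σ.exists_orderIso σ' φ h
  refine ⟨isoOfOrderIso K fun x => ?_, hom_ext hKπ, (hKv v).2 rfl, hom_ext fun y => ?_⟩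
  · rw [σ.mem_vert_iff, σ'.mem_vert_iff, hKv, hKπ, onEdges_hom_mem_vert]
  · change K (onEdges σ.s y) = onEdges σ'.s (onEdges φ.hom y)
    rw [← σ'.π_s_apply (K (onEdges σ.s y)) fun h' => σ.s_ne y ((hKv _).1 h'), hKπ, σ.s_π_apply]

theorem pullback_π_s (p : Planar T) : p.pullback (σ.π ≫ σ.s) = p := by
  ext a b
  rw [Planar.lt_iff_sib_and_leftOf (p := p)]
  refine and_congr_right fun hs => ⟨fun h => ?_, fun h => h.mono (σ.le_π_s a) (σ.le_π_s b)⟩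
  have hne : a ≠ b := by
    rintro rfl
    exact h.irrefl
  refine (Planar.LeftOf.total (p := p) (fun h' => hne (hs.eq_of_le h'))
    fun h' => hne (hs.symm.eq_of_le h').symm).resolve_right fun h' => ?_
  exact h.asymm (h'.mono (σ.le_π_s b) (σ.le_π_s a))

/-- Composition of the collapse of a unary vertex with an isomorphism. -/
def transIso (φ : S ≅ R) : Split T R v i where
  unary := σ.unary
  π := σ.π ≫ φ.hom
  s := φ.inv ≫ σ.s
  s_π := by rw [Category.assoc, ← Category.assoc σ.s, σ.s_π, Category.id_comp, φ.inv_hom_id]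
  π_s_apply e he := by simp [σ.π_s_apply e he]
  π_s_self := by simp [σ.π_s_self]

theorem range_comp {w j : S.E} (τ : Split S R w j) :
    Set.range (onEdges (τ.s ≫ σ.s)) = {e | e ≠ v ∧ e ≠ onEdges σ.s w} := by
  ext e
  constructor
  · rintro ⟨y, rfl⟩
    exact ⟨σ.s_ne _, fun h => τ.s_ne y (σ.s_injective h)⟩
  · rintro ⟨h1, h2⟩
    obtain ⟨y, rfl⟩ := σ.exists_s_eq_iff.2 h1
    obtain ⟨z, rfl⟩ := τ.exists_s_eq_iff.2 fun h => h2 (congrArg _ h)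
    exact ⟨z, rfl⟩

theorem exists_iso_of_comm {w j : S.E} (τ : Split S R w j) {v' i' : T.E} (σ' : Split T S' v' i')
    {w' j' : S'.E} (τ' : Split S' R' w' j') (h : onEdges σ.s w = v') (h' : onEdges σ'.s w' = v) :
    ∃ φ : R ≅ R', φ.hom ≫ τ'.s ≫ σ'.s = τ.s ≫ σ.s := by
  refine exists_iso_of_range_eq _ _ (σ.s_injective.comp τ.s_injective)
    (σ'.s_injective.comp τ'.s_injective) ?_ fun x y hxy => ?_
  · rw [range_comp, range_comp, h, h']
    ext e
    exact and_comm
  · rw [← τ.s_mem_vert_iff, ← σ.s_mem_vert_iff, ← τ'.s_mem_vert_iff, ← σ'.s_mem_vert_iff,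
      ← onEdges_comp, hxy, onEdges_comp]

end Split

theorem degen_isUnary (T : OTree) (e : T.E) :
    (T.degen e).IsUnary (some e : Option T.E) (none : Option T.E) := by
  refine ⟨Or.inr rfl, ?_⟩
  ext x
  refine (degen_mem_inputs_some (v := e)).trans (Iff.trans ?_ Finset.mem_singleton.symm)
  simp only [ne_eq, true_and, not_true_eq_false, false_and, or_false]
  exact Iff.rfl

theorem exists_degenSplit (T : OTree) (e : T.E) :
    ∃ σ : Split (T.degen e) T (some e : Option T.E) (none : Option T.E), σ.π = T.degenMap e := by
  obtain ⟨S, ⟨σ⟩⟩ := exists_split (degen_isUnary T e)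
  have hd : onEdges (T.degenMap e) (some e : Option T.E) =
    onEdges (T.degenMap e) (none : Option T.E) := rfl
  have hinj : ∀ x y : (T.degen e).E, x ≠ (some e : Option T.E) → y ≠ (some e : Option T.E) →
      onEdges (T.degenMap e) x = onEdges (T.degenMap e) y → x = y := by
    rintro (_ | x) (_ | y) hx hy h
    · rfl
    · exact absurd (congrArg some h).symm hy
    · exact absurd (congrArg some h) hx
    · exact congrArg some h
  have hb : Function.Bijective (onEdges (σ.s ≫ T.degenMap e)) := by
    constructor
    · intro x y h
      exact σ.s_injective (hinj _ _ (σ.s_ne x) (σ.s_ne y) h)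
    · intro x
      by_cases hx : x = e
      · refine ⟨onEdges σ.π (none : Option T.E), ?_⟩
        rw [onEdges_comp, σ.π_s_apply _ (Option.some_ne_none e).symm, hx]
        rfl
      · refine ⟨onEdges σ.π (some x : Option T.E), ?_⟩
        rw [onEdges_comp, σ.π_s_apply _ fun h => hx (Option.some_injective _ h)]
        rfl
  have := isIso_of_bijective (σ.s ≫ T.degenMap e) hb
    (by have h1 := σ.size_eq; have h2 := T.size_degen e; omega)
  refine ⟨σ.transIso (asIso (σ.s ≫ T.degenMap e)), ?_⟩
  change σ.π ≫ σ.s ≫ T.degenMap e = T.degenMap e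
  rw [← Category.assoc, σ.π_s_comp hd]

end OTree

namespace DSet

open OTree

variable {X : DSet.{u}} {n m : ℕ} {R S T S' T' : OTree}

/-- The vertex `v` is unary and `x` is the pullback of a dendrex along the collapse of `v`; in terms
of a split of `v`, the dendrex is fixed by the idempotent `π ≫ s`. -/
def IsDegenerateAt (x : X.Dendrex T) (v : T.E) : Prop :=
  ∃ (i : T.E) (S : OTree) (σ : Split T S v i), res (σ.π ≫ σ.s) x = x

theorem IsDegenerateAt.mem_vert {x : X.Dendrex T} {v : T.E} (h : IsDegenerateAt x v) :
    v ∈ T.vert := by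
  obtain ⟨i, S, σ, -⟩ := h
  exact σ.unary.mem

theorem IsDegenerateAt.res_eq {x : X.Dendrex T} {v i : T.E} (h : IsDegenerateAt x v)
    (σ : Split T S v i) : res (σ.π ≫ σ.s) x = x := by
  obtain ⟨j, S', σ', h'⟩ := h
  obtain rfl := σ.unary.input_unique σ'.unary
  rw [σ.π_s_unique σ', h']

theorem isDegenerateAt_of_eq {x : X.Dendrex T} {y : X.Dendrex R} (θ : T ⟶ R) (h : x = res θ y)
    {v i : T.E} (hu : T.IsUnary v i) (hθ : onEdges θ v = onEdges θ i) : IsDegenerateAt x v := by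
  obtain ⟨S, ⟨σ⟩⟩ := exists_split hu
  exact ⟨i, S, σ, by rw [h, ← res_comp, σ.π_s_comp hθ]⟩

theorem IsDegenerateAt.res_of_isUnary {x : X.Dendrex T} {v i : T.E} (h : IsDegenerateAt x v)
    (hu : T.IsUnary v i) (f : R ⟶ T) {v' i' : R.E} (hu' : R.IsUnary v' i') (hv : onEdges f v' = v)
    (hi : onEdges f i' = i) : IsDegenerateAt (res f x) v' := by
  obtain ⟨S, ⟨σ⟩⟩ := exists_split hu
  refine isDegenerateAt_of_eq (f ≫ σ.π) (y := res σ.s x) ?_ hu' ?_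
  · rw [← res_comp, Category.assoc, res_comp f, h.res_eq σ]
  · rw [onEdges_comp, onEdges_comp, hv, hi, σ.π_eq]

theorem isDegenerate_iff {x : X.Dendrex T} : IsDegenerate x ↔ ∃ v, IsDegenerateAt x v := by
  constructor
  · rintro ⟨S, e, φ, y, rfl⟩
    refine ⟨onEdges φ.inv (some e : Option S.E), isDegenerateAt_of_eq (φ.hom ≫ S.degenMap e)
      (res_comp _ _ _).symm ((degen_isUnary S e).iso φ.symm) ?_⟩
    exact (congrArg (onEdges (S.degenMap e)) (onEdges_hom_inv φ (some e : Option S.E))).trans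
      (congrArg (onEdges (S.degenMap e)) (onEdges_hom_inv φ (none : Option S.E))).symm
  · rintro ⟨v, i, S, σ, h⟩
    obtain ⟨σ', hσ'⟩ := exists_degenSplit S (onEdges σ.π v)
    obtain ⟨ψ, hψ, -, -⟩ := σ.exists_iso σ' (Iso.refl S) (by rw [hσ']; rfl)
    refine ⟨S, onEdges σ.π v, ψ, res σ.s x, ?_⟩
    rw [← hσ', ← res_comp, hψ, ← res_comp, Iso.refl_hom, Category.comp_id, h]

theorem cls_pull_split {g : X.Gen (n + 1)} {v i : g.tree.E} (h : IsDegenerateAt g.dendrex v)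
    (σ : Split g.tree S v i) (hS : S.size = n) (f : R ⟶ g.tree) (hR : R.size = n)
    (hf : Function.Injective (onEdges f)) {w : g.tree.E} (hw : w = v ∨ w = i)
    (hr : ∀ e, (∃ y, onEdges f y = e) ↔ e ≠ w) :
    cls (g.pull f hR) = cls (g.pull σ.s hS) := by
  have := isIso_of_bijective (f ≫ σ.π) (σ.bijective_comp hf hw hr) (by omega)
  let φ : R ≅ S := asIso (f ≫ σ.π)
  refine (cls_eq_of_iso (g := g.pull σ.s hS) (g' := g.pull f hR) φ ?_ ?_).symm
  · change res f g.dendrex = res (f ≫ σ.π) (res σ.s g.dendrex)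
    rw [← res_comp, Category.assoc, res_comp, h.res_eq σ]
  · change g.planar.pullback f = (g.planar.pullback σ.s).pullback (f ≫ σ.π)
    rw [← Planar.pullback_comp, Category.assoc, Planar.pullback_comp, σ.pullback_π_s]

theorem cls_face_split {g : X.Gen (n + 1)} {v i : g.tree.E} (h : IsDegenerateAt g.dendrex v)
    (σ : Split g.tree S v i) (hS : S.size = n) (a : g.tree.Face)
    {w : g.tree.E} (hw : w = v ∨ w = i) (ha : a.Omits w) :
    cls (g.face a) = cls (g.pull σ.s hS) :=
  cls_pull_split h σ hS a.map (g.face a).size_eq a.inj hw fun e =>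
    Face.exists_onEdges_map_eq_iff.trans (ha e)

theorem cls_mem_D {g : X.Gen n} (h : ∃ v, IsDegenerateAt g.dendrex v) : cls g ∈ X.D n :=
  Submodule.subset_span ⟨g, isDegenerate_iff.2 h, rfl⟩

theorem boundaryCls_mem_D {g : X.Gen (n + 1)} (h : ∃ v, IsDegenerateAt g.dendrex v) :
    boundaryCls g ∈ X.D n := by
  classical
  obtain ⟨v, hv⟩ := h
  obtain ⟨i, S, σ, -⟩ := id hv
  have hu := σ.unary
  have hS : S.size = n := by have h1 := σ.size_eq; have h2 := g.size_eq; omega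
  have cancel : hu.outputFace.sgn g.planar • cls (g.face hu.outputFace) +
      hu.inputFace.sgn g.planar • cls (g.face hu.inputFace) = 0 := by
    rw [hu.sgn_outputFace, hu.sgn_inputFace,
      cls_face_split hv σ hS _ (Or.inl rfl) hu.outputFace_omits,
      cls_face_split hv σ hS _ (Or.inr rfl) hu.inputFace_omits,
      Planar.label_input_of_isUnary hu, pow_succ, mul_neg_one, neg_smul, add_neg_cancel]
  rw [boundaryCls, ← Finset.add_sum_erase _ _ (Finset.mem_univ hu.outputFace),
    ← Finset.add_sum_erase _ _
      (Finset.mem_erase.2 ⟨hu.inputFace_ne_outputFace, Finset.mem_univ _⟩),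
    ← add_assoc, cancel, zero_add]
  refine Submodule.sum_mem _ fun c hc => Submodule.smul_mem _ _ (cls_mem_D ?_)
  rw [Finset.mem_erase, Finset.mem_erase] at hc
  rcases hu.omits_or_exists_isUnary c with hc' | hc' | ⟨v', i', hu', hv', hi'⟩
  · exact absurd (hc'.eq hu.outputFace_omits) hc.2.1
  · exact absurd (hc'.eq hu.inputFace_omits) hc.1
  · exact ⟨v', hv.res_of_isUnary hu c.map hu' hv' hi'⟩

theorem D_le_comap (h : X.BoundaryDescends) (n : ℕ) : X.D (n + 1) ≤ (X.D n).comap (d h n) := by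
  rw [D, Submodule.span_le]
  rintro _ ⟨g, hg, rfl⟩
  rw [SetLike.mem_coe, Submodule.mem_comap]
  change d h n (cls g) ∈ _
  rw [d_cls]
  exact boundaryCls_mem_D (isDegenerate_iff.1 hg)

end DSet

/-! ### Cores and colours -/

namespace OTree

variable {R S T : OTree}

/-- The class of the composites of degeneracies, described by their sections: every edge lies in
the image of a section of `π`. -/
def EdgeSplit (π : T ⟶ S) : Prop :=
  ∀ e, ∃ s : S ⟶ T, s ≫ π = 𝟙 S ∧ onEdges s (onEdges π e) = e

theorem EdgeSplit.comp {π : T ⟶ S} {ρ : S ⟶ R} (h : EdgeSplit π) (h' : EdgeSplit ρ) :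
    EdgeSplit (π ≫ ρ) := by
  intro e
  obtain ⟨s, hs, hs'⟩ := h e
  obtain ⟨t, ht, ht'⟩ := h' (onEdges π e)
  refine ⟨t ≫ s, ?_, ?_⟩
  · rw [Category.assoc, ← Category.assoc s, hs, Category.id_comp, ht]
  · rw [onEdges_comp, onEdges_comp, ht', hs']

theorem EdgeSplit.iso (τ : T ≅ S) : EdgeSplit τ.hom := fun e =>
  ⟨τ.inv, τ.inv_hom_id, onEdges_inv_hom τ e⟩

theorem EdgeSplit.id (T : OTree) : EdgeSplit (𝟙 T) := EdgeSplit.iso (Iso.refl T)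

theorem Split.edgeSplit {v i : T.E} (σ : Split T S v i) : EdgeSplit σ.π := by
  intro e
  by_cases he : e = v
  · let a := σ.unary.inputFace
    have ha := σ.unary.inputFace_omits
    have := isIso_of_bijective (a.map ≫ σ.π)
      (σ.bijective_comp a.inj (Or.inr rfl) fun e => Face.exists_onEdges_map_eq_iff.trans (ha e))
      (by have h1 := σ.size_eq; have h2 := a.size_add_one; omega)
    let φ := asIso (a.map ≫ σ.π)
    refine ⟨φ.inv ≫ a.map, ?_, ?_⟩
    · rw [Category.assoc]
      exact φ.inv_hom_id
    · obtain ⟨y, hy⟩ := Face.exists_onEdges_map_eq_iff.2 ((ha e).2 (he ▸ σ.unary.lt.ne))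
      rw [← hy]
      exact congrArg (onEdges a.map) (onEdges_inv_hom φ y)
  · exact ⟨σ.s, σ.s_π, σ.π_s_apply e he⟩

end OTree

namespace DSet

open OTree

variable {X : DSet.{u}} {R S T : OTree}

/-- An Eilenberg–Zilber decomposition `x = π^* y` of a dendrex `x`: here `y = dendrex` is
nondegenerate, and `π` is a composite of degeneracies. -/
structure Core (x : X.Dendrex T) where
  tree : OTree
  π : T ⟶ tree
  dendrex : X.Dendrex tree
  edgeSplit : EdgeSplit π
  eq : x = res π dendrex
  nondeg : ∀ v, ¬ IsDegenerateAt dendrex v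

theorem nonempty_core (x : X.Dendrex T) : Nonempty (Core x) := by
  induction hk : T.size generalizing T with
  | zero =>
    refine ⟨⟨T, 𝟙 T, x, EdgeSplit.id T, (res_id x).symm, ?_⟩⟩
    rintro v ⟨i, S, σ, -⟩
    have := σ.size_eq
    omega
  | succ k ih =>
    by_cases h : ∃ v, IsDegenerateAt x v
    · obtain ⟨v, i, S, σ, h⟩ := h
      obtain ⟨c⟩ := ih (res σ.s x) (by have := σ.size_eq; omega)
      refine ⟨⟨c.tree, σ.π ≫ c.π, c.dendrex, σ.edgeSplit.comp c.edgeSplit, ?_, c.nondeg⟩⟩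
      rw [res_comp, ← c.eq, ← res_comp, h]
    · exact ⟨⟨T, 𝟙 T, x, EdgeSplit.id T, (res_id x).symm, not_exists.1 h⟩⟩

/-- The chosen core of a dendrex. -/
noncomputable def core (x : X.Dendrex T) : Core x := Classical.choice (nonempty_core x)

theorem eq_id_of_res_eq (hX : X.IsNormal) {y : X.Dendrex S} (hy : ∀ v, ¬ IsDegenerateAt y v)
    {θ : S ⟶ S} (h : res θ y = y) : θ = 𝟙 S := by
  have hinj : Function.Injective (onEdges θ) := by
    by_contra hi
    obtain ⟨b, hb, hb'⟩ := exists_onEdges_next_eq θ hi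
    exact hy _ (isDegenerateAt_of_eq θ h.symm (isUnary_of_onEdges_next_eq θ hb hb') hb')
  have := isIso_of_bijective θ (Finite.injective_iff_bijective.1 hinj) le_rfl
  exact congrArg Iso.hom (hX S (asIso θ) y h)

theorem Core.res_section {x : X.Dendrex T} (c : Core x) {s : c.tree ⟶ T} (hs : s ≫ c.π = 𝟙 _) :
    res s x = c.dendrex :=
  (congrArg (res s) c.eq).trans (by rw [← res_comp, hs, res_id])

theorem Core.exists_iso (hX : X.IsNormal) {x : X.Dendrex T} (c c' : Core x) :
    ∃ φ : c.tree ≅ c'.tree, c.π ≫ φ.hom = c'.π ∧ res φ.hom c'.dendrex = c.dendrex := by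
  have key : ∀ (c c' : Core x) (s : c.tree ⟶ T), s ≫ c.π = 𝟙 _ →
      res (s ≫ c'.π) c'.dendrex = c.dendrex := by
    intro c c' s hs
    rw [res_comp, ← c'.eq, c.res_section hs]
  obtain ⟨s, hs, -⟩ := c.edgeSplit T.root
  obtain ⟨s', hs', -⟩ := c'.edgeSplit T.root
  have h1 : res (s ≫ c'.π) c'.dendrex = c.dendrex := key c c' s hs
  have h2 : res (s' ≫ c.π) c.dendrex = c'.dendrex := key c' c s' hs'
  refine ⟨⟨s ≫ c'.π, s' ≫ c.π, ?_, ?_⟩, ?_, h1⟩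
  · exact eq_id_of_res_eq hX c.nondeg (by rw [res_comp, h2, h1])
  · exact eq_id_of_res_eq hX c'.nondeg (by rw [res_comp, h1, h2])
  · ext e
    obtain ⟨t, ht, ht'⟩ := c'.edgeSplit e
    have h3 : t ≫ c.π ≫ s ≫ c'.π = 𝟙 _ := eq_id_of_res_eq hX c'.nondeg (by
      rw [res_comp, res_comp, h1, ← c.eq, c'.res_section ht])
    conv_lhs => rw [← ht']
    exact congrArg (fun f => onEdges f (onEdges c'.π e)) h3

variable (X) in
/-- The dendrices of `X` with a marked edge. -/
structure Marked where
  tree : OTree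
  dendrex : X.Dendrex tree
  edge : tree.E

instance : Setoid X.Marked where
  r a b := ∃ φ : a.tree ≅ b.tree, res φ.hom b.dendrex = a.dendrex ∧
    onEdges φ.hom a.edge = b.edge
  iseqv := by
    refine ⟨fun a => ⟨Iso.refl _, res_id _, rfl⟩, ?_, ?_⟩
    · rintro a b ⟨φ, h1, h2⟩
      refine ⟨φ.symm, ?_, ?_⟩
      · rw [← h1, ← res_comp, Iso.symm_hom, φ.inv_hom_id, res_id]
      · rw [← h2, Iso.symm_hom, onEdges_inv_hom]
    · rintro a b c ⟨φ, h1, h2⟩ ⟨ψ, h3, h4⟩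
      refine ⟨φ ≪≫ ψ, ?_, ?_⟩
      · rw [Iso.trans_hom, res_comp, h3, h1]
      · rw [Iso.trans_hom, onEdges_comp, h2, h4]

variable (X) in
/-- The isomorphism classes of dendrices with a marked edge. -/
abbrev Color := Quotient (inferInstance : Setoid X.Marked)

/-- The colour of an edge `e` of `x` is the class of the core of `x`, marked at the image of `e`.
Two edges have the same colour exactly if the projection to the core identifies them. -/
noncomputable def color (x : X.Dendrex T) (e : T.E) : X.Color :=
  Quotient.mk _ ⟨(core x).tree, (core x).dendrex, onEdges (core x).π e⟩

variable {x : X.Dendrex T}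

theorem color_eq_core (hX : X.IsNormal) (c : Core x) (e : T.E) :
    color x e = Quotient.mk _ ⟨c.tree, c.dendrex, onEdges c.π e⟩ := by
  obtain ⟨φ, h1, h2⟩ := Core.exists_iso hX (core x) c
  exact Quotient.sound ⟨φ, h2, by rw [← h1]; rfl⟩

theorem color_res (hX : X.IsNormal) (x : X.Dendrex T) {ρ : R ⟶ T} (h : EdgeSplit ρ) (e : R.E) :
    color (res ρ x) e = color x (onEdges ρ e) :=
  color_eq_core hX (x := res ρ x) ⟨(core x).tree, ρ ≫ (core x).π, (core x).dendrex,
    h.comp (core x).edgeSplit, by rw [res_comp, ← (core x).eq], (core x).nondeg⟩ e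

theorem color_eq_iff (hX : X.IsNormal) {a b : T.E} :
    color x a = color x b ↔ onEdges (core x).π a = onEdges (core x).π b := by
  constructor
  · intro h
    obtain ⟨φ, h1, h2⟩ := Quotient.exact h
    have h3 : φ.hom = 𝟙 _ := eq_id_of_res_eq hX (core x).nondeg h1
    exact (congrArg (fun f => onEdges f (onEdges (core x).π a)) h3).symm.trans h2
  · intro h
    rw [color, h]
    rfl

theorem le_or_le_of_color_eq (hX : X.IsNormal) {a b : T.E} (h : color x a = color x b) :
    a ≤ b ∨ b ≤ a :=
  le_or_le_of_onEdges_le _ ((color_eq_iff hX).1 h).le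

theorem color_eq_of_between (hX : X.IsNormal) {a b c : T.E} (h : color x a = color x c)
    (hab : a ≤ b) (hbc : b ≤ c) : color x b = color x a := by
  rw [color_eq_iff hX] at h ⊢
  exact le_antisymm (h ▸ onEdges_mono _ hbc) (onEdges_mono _ hab)

theorem IsDegenerateAt.color_eq (hX : X.IsNormal) {v i : T.E} (h : IsDegenerateAt x v)
    (hu : T.IsUnary v i) : color x i = color x v := by
  obtain ⟨S, ⟨σ⟩⟩ := exists_split hu
  have h1 : x = res σ.π (res σ.s x) := by rw [← res_comp, h.res_eq σ]
  rw [h1, color_res hX _ σ.edgeSplit, color_res hX _ σ.edgeSplit, σ.π_eq]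

theorem isUnary_of_color_eq (hX : X.IsNormal) {b : T.E} (hb : b ≠ T.root)
    (h : color x (T.next b) = color x b) :
    T.IsUnary (T.next b) b ∧ IsDegenerateAt x (T.next b) := by
  have h1 := (color_eq_iff hX).1 h
  have h2 := isUnary_of_onEdges_next_eq (core x).π hb h1
  exact ⟨h2, isDegenerateAt_of_eq _ (core x).eq h2 h1⟩

theorem isDegenerateAt_iff (hX : X.IsNormal) {v : T.E} :
    IsDegenerateAt x v ↔ ∃ b, v < b ∧ color x b = color x v := by
  constructor
  · intro h
    obtain ⟨i, S, σ, -⟩ := id h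
    exact ⟨i, σ.unary.lt, h.color_eq hX σ.unary⟩
  · rintro ⟨b, hb, h⟩
    obtain ⟨c, hc, hc', rfl⟩ := exists_child hb
    exact (isUnary_of_color_eq hX hc' (color_eq_of_between hX h.symm (next_le c) hc).symm).2

theorem color_split (hX : X.IsNormal) {v i : T.E} (h : IsDegenerateAt x v)
    (σ : Split T S v i) (y : S.E) : color (res σ.s x) y = color x (onEdges σ.s y) := by
  have h1 : x = res σ.π (res σ.s x) := by rw [← res_comp, h.res_eq σ]
  have h2 := color_res hX (res σ.s x) σ.edgeSplit (onEdges σ.s y)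
  rw [σ.s_π_apply, ← h1] at h2
  exact h2.symm

theorem isDegenerateAt_split_iff (hX : X.IsNormal) {v i : T.E} (h : IsDegenerateAt x v)
    (σ : Split T S v i) (y : S.E) :
    IsDegenerateAt (res σ.s x) y ↔ IsDegenerateAt x (onEdges σ.s y) := by
  rw [isDegenerateAt_iff hX, isDegenerateAt_iff hX]
  simp only [color_split hX h]
  constructor
  · rintro ⟨b, hb, hb'⟩
    exact ⟨_, σ.s_lt_iff.2 hb, hb'⟩
  · rintro ⟨b, hb, hb'⟩
    by_cases hbv : b = v
    · subst hbv
      obtain ⟨y', hy'⟩ := σ.exists_s_eq_iff.2 σ.unary.lt.ne'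
      refine ⟨y', σ.s_lt_iff.1 ?_, ?_⟩
      · rw [hy']
        exact hb.trans σ.unary.lt
      · rw [hy', h.color_eq hX σ.unary, hb']
    · obtain ⟨y', rfl⟩ := σ.exists_s_eq_iff.2 hbv
      exact ⟨y', σ.s_lt_iff.1 hb, hb'⟩

theorem isDegenerateAt_iso_iff (hX : X.IsNormal) (τ : S ≅ T) (y : S.E) :
    IsDegenerateAt (res τ.hom x) y ↔ IsDegenerateAt x (onEdges τ.hom y) := by
  rw [isDegenerateAt_iff hX, isDegenerateAt_iff hX]
  simp only [color_res hX x (EdgeSplit.iso τ)]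
  constructor
  · rintro ⟨b, hb, hb'⟩
    exact ⟨_, (onEdges_lt_iff _ (onEdges_hom_injective τ)).2 hb, hb'⟩
  · rintro ⟨b, hb, hb'⟩
    obtain ⟨b, rfl⟩ := (onEdges_hom_bijective τ).2 b
    exact ⟨b, (onEdges_lt_iff _ (onEdges_hom_injective τ)).1 hb, hb'⟩

end DSet

/-! ### The filtration of the degenerate subcomplex -/

theorem sum_neg_one_pow_card_filter_lt {α : Type*} [PartialOrder α] [DecidableLT α]
    (A : Finset α) (hA : IsChain (· ≤ ·) (A : Set α)) :
    ∑ e ∈ A, (-1 : ℤ) ^ (A.filter (· < e)).card = if Odd A.card then 1 else 0 := by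
  classical
  induction hk : A.card generalizing A with
  | zero => simp [Finset.card_eq_zero.1 hk]
  | succ k ih =>
    obtain ⟨t, ht⟩ := A.exists_maximal (Finset.card_pos.1 (by omega))
    have hle : ∀ a ∈ A, a ≤ t := fun a ha =>
      (hA.total ha ht.1).elim _root_.id fun h => ht.2 ha h
    have h1 : A.filter (· < t) = A.erase t := by
      ext a
      simp only [Finset.mem_filter, Finset.mem_erase]
      exact ⟨fun h => ⟨h.2.ne, h.1⟩, fun h => ⟨h.2, lt_of_le_of_ne (hle a h.2) h.1⟩⟩
    have h2 : ∀ e ∈ A.erase t, A.filter (· < e) = (A.erase t).filter (· < e) := by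
      intro e he
      ext a
      simp only [Finset.mem_filter, Finset.mem_erase]
      refine ⟨fun h => ⟨⟨fun hat => ?_, h.1⟩, h.2⟩, fun h => ⟨h.1.2, h.2⟩⟩
      exact absurd (hle e (Finset.mem_of_mem_erase he)) (not_le_of_gt (hat ▸ h.2))
    have h3 : (A.erase t).card = k := by rw [Finset.card_erase_of_mem ht.1, hk]; rfl
    rw [← Finset.add_sum_erase _ _ ht.1, h1, h3, Finset.sum_congr rfl fun e he => by rw [h2 e he],
      ih _ (hA.mono (Finset.coe_subset.2 (A.erase_subset t))) h3]
    rcases Nat.even_or_odd k with h | h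
    · rw [if_neg (Nat.not_odd_iff_even.2 h), if_pos h.add_one, h.neg_one_pow, add_zero]
    · rw [if_pos h, if_neg (Nat.not_odd_iff_even.2 h.add_one), h.neg_one_pow]
      rfl

namespace DSet

open OTree

variable {X : DSet.{u}} {n : ℕ} {R S T : OTree} {x : X.Dendrex T}

open Classical in
/-- The degenerate vertices of a dendrex. -/
noncomputable def degenerateVerts (x : X.Dendrex T) : Finset T.E :=
  Finset.univ.filter (IsDegenerateAt x)

@[simp]
theorem mem_degenerateVerts {v : T.E} : v ∈ degenerateVerts x ↔ IsDegenerateAt x v := by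
  simp [degenerateVerts]

theorem card_degenerateVerts_le (x : X.Dendrex T) : (degenerateVerts x).card ≤ T.size := by
  rw [← card_verts]
  exact Finset.card_le_card fun v hv => mem_verts.2 (mem_degenerateVerts.1 hv).mem_vert

/-- The number of nondegenerate vertices of a dendrex. -/
noncomputable def rank (x : X.Dendrex T) : ℕ := T.size - (degenerateVerts x).card

theorem rank_split (hX : X.IsNormal) {v i : T.E} (h : IsDegenerateAt x v) (σ : Split T S v i) :
    rank (res σ.s x) = rank x := by
  classical
  have h1 : degenerateVerts x = insert v ((degenerateVerts (res σ.s x)).image (onEdges σ.s)) := by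
    ext e
    simp only [mem_degenerateVerts, Finset.mem_insert, Finset.mem_image,
      isDegenerateAt_split_iff hX h]
    constructor
    · intro he
      refine or_iff_not_imp_left.2 fun hv => ?_
      obtain ⟨y, rfl⟩ := σ.exists_s_eq_iff.2 hv
      exact ⟨y, he, rfl⟩
    · rintro (rfl | ⟨y, hy, rfl⟩)
      · exact h
      · exact hy
  have h2 : v ∉ (degenerateVerts (res σ.s x)).image (onEdges σ.s) := by
    rw [Finset.mem_image]
    rintro ⟨y, -, hy⟩
    exact σ.s_ne y hy
  rw [rank, rank, h1, Finset.card_insert_of_notMem h2,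
    Finset.card_image_of_injective _ σ.s_injective]
  have := σ.size_eq
  omega

theorem rank_face_lt (f : S ⟶ T) (hf : S.size + 1 = T.size)
    (h : ∀ v, IsDegenerateAt x v → ∃ v', IsDegenerateAt (res f x) v' ∧ onEdges f v' = v) :
    rank (res f x) < rank x := by
  classical
  have h1 : degenerateVerts x ⊆ (degenerateVerts (res f x)).image (onEdges f) := by
    intro v hv
    obtain ⟨v', h1, h2⟩ := h v (mem_degenerateVerts.1 hv)
    exact Finset.mem_image.2 ⟨v', mem_degenerateVerts.2 h1, h2⟩
  have h2 := (Finset.card_le_card h1).trans Finset.card_image_le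
  have h3 := card_degenerateVerts_le (res f x)
  rw [rank, rank]
  omega

variable (X) in
/-- The filtration of the degenerate subcomplex by the number of nondegenerate vertices: step `k` is
spanned by the degenerate generators with fewer than `k` nondegenerate vertices. -/
noncomputable def degenerateFiltration (k n : ℕ) : Submodule ℤ (X.UnGroup n) :=
  Submodule.span ℤ
    {c | ∃ g : X.Gen n, (∃ v, IsDegenerateAt g.dendrex v) ∧ rank g.dendrex < k ∧ c = cls g}

theorem cls_mem_degenerateFiltration {g : X.Gen n} {k : ℕ}
    (h : ∃ v, IsDegenerateAt g.dendrex v) (h' : rank g.dendrex < k) :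
    cls g ∈ X.degenerateFiltration k n :=
  Submodule.subset_span ⟨g, h, h', rfl⟩

theorem degenerateFiltration_le_D (k n : ℕ) : X.degenerateFiltration k n ≤ X.D n := by
  rw [degenerateFiltration, Submodule.span_le]
  rintro _ ⟨g, hg, -, rfl⟩
  exact cls_mem_D hg

theorem D_le_degenerateFiltration (n : ℕ) : X.D n ≤ X.degenerateFiltration (n + 1) n := by
  rw [D, Submodule.span_le]
  rintro _ ⟨g, hg, rfl⟩
  refine cls_mem_degenerateFiltration (isDegenerate_iff.1 hg) ?_
  have := g.size_eq
  rw [rank]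
  omega

theorem degenerateFiltration_zero (n : ℕ) : X.degenerateFiltration 0 n = ⊥ := by
  rw [degenerateFiltration, Submodule.span_eq_bot]
  rintro _ ⟨g, -, h, -⟩
  exact absurd h (Nat.not_lt_zero _)

open Classical in
/-- The edges of the same colour as `v`. They form a linear branch of `T` all of whose inner
vertices are degenerate. -/
noncomputable def chain (x : X.Dendrex T) (v : T.E) : Finset T.E :=
  Finset.univ.filter fun e => color x e = color x v

@[simp]
theorem mem_chain {v e : T.E} : e ∈ chain x v ↔ color x e = color x v := by simp [chain]

theorem isChain_chain (hX : X.IsNormal) (v : T.E) : IsChain (· ≤ ·) (chain x v : Set T.E) :=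
  fun _ ha _ hb _ => le_or_le_of_color_eq hX
    ((mem_chain.1 (Finset.mem_coe.1 ha)).trans (mem_chain.1 (Finset.mem_coe.1 hb)).symm)

/-- `v` is the lowest vertex of a maximal linear branch of degenerate vertices. -/
def IsChainBottom (x : X.Dendrex T) (v : T.E) : Prop :=
  IsDegenerateAt x v ∧ ∀ b, b < v → color x b ≠ color x v

theorem IsChainBottom.le (hX : X.IsNormal) {v e : T.E} (h : IsChainBottom x v)
    (he : color x e = color x v) : v ≤ e := by
  rcases le_or_le_of_color_eq hX he with h' | h'
  · rcases h'.eq_or_lt with h' | h'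
    · exact h'.ge
    · exact absurd he (h.2 e h')
  · exact h'

theorem IsChainBottom.eq (hX : X.IsNormal) {v w : T.E} (h : IsChainBottom x v)
    (h' : IsChainBottom x w) (he : color x v = color x w) : v = w :=
  le_antisymm (h.le hX he.symm) (h'.le hX he)

theorem exists_isChainBottom (hX : X.IsNormal) {a b : T.E} (hab : a ≠ b)
    (h : color x a = color x b) : ∃ v, IsChainBottom x v ∧ color x v = color x a := by
  obtain ⟨v, hv⟩ := (chain x a).exists_minimal ⟨a, by simp⟩
  have hc := mem_chain.1 hv.1
  have hmin : ∀ e, color x e = color x a → v ≤ e := fun e he =>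
    (le_or_le_of_color_eq hX (hc.trans he.symm)).elim _root_.id
      fun h => hv.2 (mem_chain.2 he) h
  refine ⟨v, ⟨(isDegenerateAt_iff hX).2 ?_, fun b hb hb' => ?_⟩, hc⟩
  · by_cases hva : v = a
    · exact ⟨b, lt_of_le_of_ne (hmin b h.symm) (hva ▸ hab), h.symm.trans hc.symm⟩
    · exact ⟨a, lt_of_le_of_ne (hmin a rfl) hva, hc.symm⟩
  · exact absurd (hmin b (hb'.trans hc)) (not_le_of_gt hb)

theorem IsChainBottom.step (hX : X.IsNormal) {v e : T.E} (h : IsChainBottom x v)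
    (he : color x e = color x v) (hne : e ≠ v) :
    T.IsUnary (T.next e) e ∧ IsDegenerateAt x (T.next e) ∧
      color x (T.next e) = color x v ∧ T.height (T.next e) < T.height e := by
  have h1 : v < e := lt_of_le_of_ne (h.le hX he) hne.symm
  have h2 : e ≠ T.root := ne_root_of_lt h1
  have h3 : color x (T.next e) = color x v :=
    color_eq_of_between hX he.symm (le_next_of_lt h1) (next_le e)
  obtain ⟨h4, h5⟩ := isUnary_of_color_eq hX h2 (h3.trans he.symm)
  exact ⟨h4, h5, h3, by rw [T.height_next e h2]; omega⟩

open Classical in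
theorem IsChainBottom.label_eq (hX : X.IsNormal) (p : Planar T) {v : T.E}
    (h : IsChainBottom x v) {e : T.E} (he : color x e = color x v) :
    p.label e = p.label v + ((chain x v).filter (· < e)).card := by
  induction hk : T.height e using Nat.strong_induction_on generalizing e with
  | _ k ih =>
    by_cases hne : e = v
    · subst hne
      have : (chain x e).filter (· < e) = ∅ := by
        rw [Finset.filter_eq_empty_iff]
        exact fun b hb hb' => h.2 b hb' (mem_chain.1 hb)
      rw [this, Finset.card_empty, add_zero]
    · obtain ⟨hu, -, hc, hh⟩ := h.step hX he hne
      rw [Planar.label_input_of_isUnary hu, ih _ (hk ▸ hh) hc rfl, add_assoc]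
      congr 1
      rw [← Finset.card_insert_of_notMem (a := T.next e)
        (s := (chain x v).filter (· < T.next e)) (by simp)]
      congr 1
      ext b
      simp only [Finset.mem_insert, Finset.mem_filter, mem_chain, hu.lt_input_iff_le]
      constructor
      · rintro (rfl | ⟨h1, h2⟩)
        · exact ⟨hc, le_rfl⟩
        · exact ⟨h1, h2.le⟩
      · rintro ⟨h1, h2⟩
        rcases h2.eq_or_lt with h2 | h2
        · exact Or.inl h2
        · exact Or.inr ⟨h1, h2⟩

open Classical in
theorem IsChainBottom.sum_label (hX : X.IsNormal) (p : Planar T) {v : T.E}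
    (h : IsChainBottom x v) :
    ∑ e ∈ chain x v, (-1 : ℤ) ^ p.label e =
      if Odd (chain x v).card then (-1) ^ p.label v else 0 := by
  rw [Finset.sum_congr rfl fun e he => by rw [h.label_eq hX p (mem_chain.1 he), pow_add],
    ← Finset.mul_sum, sum_neg_one_pow_card_filter_lt _ (isChain_chain hX v)]
  split_ifs <;> simp

open Classical in
/-- The class obtained by collapsing the unary vertex `v`, and the junk value `0` if `v` is not
unary. -/
noncomputable def collapse (g : X.Gen (n + 1)) (v : g.tree.E) : X.UnGroup n :=
  if h : ∃ i, g.tree.IsUnary v i then cls (g.face h.choose_spec.outputFace) else 0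

theorem Gen.size_split (g : X.Gen (n + 1)) {v i : g.tree.E} (σ : Split g.tree S v i) :
    S.size = n := by
  have h1 := σ.size_eq
  have h2 := g.size_eq
  omega

theorem collapse_eq {g : X.Gen (n + 1)} {v i : g.tree.E} (h : IsDegenerateAt g.dendrex v)
    (σ : Split g.tree S v i) (hS : S.size = n) : collapse g v = cls (g.pull σ.s hS) := by
  have hu : ∃ i, g.tree.IsUnary v i := ⟨i, σ.unary⟩
  rw [collapse, dif_pos hu]
  exact cls_face_split h σ hS _ (Or.inl rfl) hu.choose_spec.outputFace_omits

theorem cls_face_eq_collapse {g : X.Gen (n + 1)} {v i w : g.tree.E}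
    (h : IsDegenerateAt g.dendrex v) (hu : g.tree.IsUnary v i) {a : g.tree.Face}
    (hw : w = v ∨ w = i) (ha : a.Omits w) : cls (g.face a) = collapse g v := by
  obtain ⟨S, ⟨σ⟩⟩ := exists_split hu
  rw [cls_face_split h σ (g.size_split σ) a hw ha, collapse_eq h σ (g.size_split σ)]

theorem IsDegenerateAt.exists_isUnary {v : T.E} (h : IsDegenerateAt x v) :
    ∃ i, T.IsUnary v i := by
  obtain ⟨i, S, σ, -⟩ := h
  exact ⟨i, σ.unary⟩

theorem IsChainBottom.exists_face_omits (hX : X.IsNormal) {g : X.Gen (n + 1)} {v : g.tree.E}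
    (h : IsChainBottom g.dendrex v) {e : g.tree.E} (he : color g.dendrex e = color g.dendrex v) :
    ∃ a : g.tree.Face, a.Omits e ∧ a.sgn g.planar = (-1) ^ g.planar.label e ∧
      cls (g.face a) = collapse g v := by
  induction hk : g.tree.height e using Nat.strong_induction_on generalizing e with
  | _ k ih =>
    by_cases hne : e = v
    · subst hne
      obtain ⟨i, hu⟩ := h.1.exists_isUnary
      exact ⟨hu.outputFace, hu.outputFace_omits, hu.sgn_outputFace _,
        cls_face_eq_collapse h.1 hu (Or.inl rfl) hu.outputFace_omits⟩
    · obtain ⟨hu, hd, hc, hh⟩ := h.step hX he hne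
      obtain ⟨b, hb, -, hb'⟩ := ih _ (hk ▸ hh) hc rfl
      refine ⟨hu.inputFace, hu.inputFace_omits, hu.sgn_inputFace _, ?_⟩
      rw [cls_face_eq_collapse hd hu (Or.inr rfl) hu.inputFace_omits, ← hb',
        cls_face_eq_collapse hd hu (Or.inl rfl) hb]

open Classical in
/-- The lowest vertices of the maximal linear branches of degenerate vertices. -/
noncomputable def chainBottoms (x : X.Dendrex T) : Finset T.E :=
  Finset.univ.filter (IsChainBottom x)

@[simp]
theorem mem_chainBottoms {v : T.E} : v ∈ chainBottoms x ↔ IsChainBottom x v := by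
  simp [chainBottoms]

open Classical in
/-- The lowest vertices of the maximal linear branches with an even number of degenerate vertices,
and hence with an odd number of edges. -/
noncomputable def evenChainBottoms (x : X.Dendrex T) : Finset T.E :=
  (chainBottoms x).filter fun v => Odd (chain x v).card

@[simp]
theorem mem_evenChainBottoms {v : T.E} :
    v ∈ evenChainBottoms x ↔ IsChainBottom x v ∧ Odd (chain x v).card := by
  simp [evenChainBottoms]

theorem sum_evenChainBottoms (hX : X.IsNormal) (p : Planar T) {M : Type*} [AddCommGroup M]
    (f : T.E → M) :
    ∑ v ∈ evenChainBottoms x, (-1 : ℤ) ^ p.label v • f v =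
      ∑ v ∈ chainBottoms x, ∑ e ∈ chain x v, (-1 : ℤ) ^ p.label e • f v := by
  rw [evenChainBottoms, Finset.sum_filter]
  refine Finset.sum_congr rfl fun v hv => ?_
  rw [← Finset.sum_smul, (mem_chainBottoms.1 hv).sum_label hX]
  split_ifs <;> simp

open Classical in
/-- The elementary faces of the tree of `x` which omit an edge adjacent to a degenerate vertex. -/
noncomputable def chainFaces (x : X.Dendrex T) : Finset T.Face :=
  Finset.univ.filter fun a => ∃ v, IsChainBottom x v ∧ ∃ e, color x e = color x v ∧ a.Omits e

theorem mem_chainFaces {a : T.Face} :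
    a ∈ chainFaces x ↔ ∃ v, IsChainBottom x v ∧ ∃ e, color x e = color x v ∧ a.Omits e := by
  simp [chainFaces]

theorem IsDegenerateAt.mem_chainFaces (hX : X.IsNormal) {v i w : T.E} (h : IsDegenerateAt x v)
    (hu : T.IsUnary v i) (hw : w = v ∨ w = i) {a : T.Face} (ha : a.Omits w) :
    a ∈ chainFaces x := by
  obtain ⟨b, hb, hbi⟩ := exists_isChainBottom hX hu.lt.ne' (h.color_eq hX hu)
  refine DSet.mem_chainFaces.2 ⟨b, hb, w, ?_, ha⟩
  rcases hw with rfl | rfl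
  · rw [hbi, h.color_eq hX hu]
  · exact hbi.symm

theorem sum_chainFaces (hX : X.IsNormal) (g : X.Gen (n + 1)) :
    ∑ a ∈ chainFaces g.dendrex, a.sgn g.planar • cls (g.face a) =
      ∑ v ∈ evenChainBottoms g.dendrex, (-1 : ℤ) ^ g.planar.label v • collapse g v := by
  rw [sum_evenChainBottoms hX, Finset.sum_sigma']
  have hface : ∀ x ∈ (chainBottoms g.dendrex).sigma (chain g.dendrex), ∃ a : g.tree.Face,
      a.Omits x.2 ∧ a.sgn g.planar = (-1) ^ g.planar.label x.2 ∧
        cls (g.face a) = collapse g x.1 := fun x hx =>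
    (mem_chainBottoms.1 (Finset.mem_sigma.1 hx).1).exists_face_omits hX
      (mem_chain.1 (Finset.mem_sigma.1 hx).2)
  symm
  choose face homits hsgn hcls using hface
  refine Finset.sum_bij face ?_ ?_ ?_ fun x hx => by rw [hsgn, hcls]
  · intro x hx
    obtain ⟨hv, he⟩ := Finset.mem_sigma.1 hx
    exact mem_chainFaces.2 ⟨x.1, mem_chainBottoms.1 hv, x.2, mem_chain.1 he, homits x hx⟩
  · rintro ⟨v, e⟩ hx ⟨v', e'⟩ hx' h
    obtain rfl : e = e' := by
      by_contra hne
      exact (homits _ hx e).1 (h ▸ (homits _ hx' e).2 hne) rfl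
    obtain ⟨hv, he⟩ := Finset.mem_sigma.1 hx
    obtain ⟨hv', he'⟩ := Finset.mem_sigma.1 hx'
    obtain rfl : v = v' := (mem_chainBottoms.1 hv).eq hX (mem_chainBottoms.1 hv')
      ((mem_chain.1 he).symm.trans (mem_chain.1 he'))
    rfl
  · intro a ha
    obtain ⟨v, hv, e, he, hae⟩ := mem_chainFaces.1 ha
    have hx : (⟨v, e⟩ : Σ _ : g.tree.E, g.tree.E) ∈
        (chainBottoms g.dendrex).sigma (chain g.dendrex) :=
      Finset.mem_sigma.2 ⟨mem_chainBottoms.2 hv, mem_chain.2 he⟩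
    exact ⟨_, hx, (homits _ hx).eq hae⟩

theorem exists_isDegenerateAt_of_notMem_chainFaces (hX : X.IsNormal) {a : T.Face}
    (ha : a ∉ chainFaces x) {v : T.E} (hv : IsDegenerateAt x v) :
    ∃ v', IsDegenerateAt (res a.map x) v' ∧ onEdges a.map v' = v := by
  obtain ⟨i, hu⟩ := hv.exists_isUnary
  rcases hu.omits_or_exists_isUnary a with h | h | ⟨v', i', hu', hv', hi'⟩
  · exact absurd (hv.mem_chainFaces hX hu (Or.inl rfl) h) ha
  · exact absurd (hv.mem_chainFaces hX hu (Or.inr rfl) h) ha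
  · exact ⟨v', hv.res_of_isUnary hu a.map hu' hv' hi', hv'⟩

theorem cls_face_mem_degenerateFiltration (hX : X.IsNormal) {g : X.Gen (n + 1)}
    (hg : ∃ v, IsDegenerateAt g.dendrex v) {a : g.tree.Face} (ha : a ∉ chainFaces g.dendrex) :
    cls (g.face a) ∈ X.degenerateFiltration (rank g.dendrex) n := by
  obtain ⟨v, hv⟩ := hg
  obtain ⟨v', hv', -⟩ := exists_isDegenerateAt_of_notMem_chainFaces hX ha hv
  exact cls_mem_degenerateFiltration ⟨v', hv'⟩ (rank_face_lt a.map a.size_add_one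
    fun _ => exists_isDegenerateAt_of_notMem_chainFaces hX ha)

-- The signs of the faces along a branch of degenerate vertices alternate, so that these cancel
-- except for one if the number of edges of the branch is odd.
theorem boundaryCls_sub_mem_degenerateFiltration (hX : X.IsNormal) (g : X.Gen (n + 1))
    (hg : ∃ v, IsDegenerateAt g.dendrex v) :
    boundaryCls g - ∑ v ∈ evenChainBottoms g.dendrex, (-1 : ℤ) ^ g.planar.label v • collapse g v ∈
      X.degenerateFiltration (rank g.dendrex) n := by
  classical
  rw [← sum_chainFaces hX, boundaryCls, ← Finset.sum_sdiff (Finset.subset_univ _),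
    add_sub_cancel_right]
  exact Submodule.sum_mem _ fun a ha => Submodule.smul_mem _ _
    (cls_face_mem_degenerateFiltration hX hg (Finset.mem_sdiff.1 ha).2)

/-! ### The contracting homotopy -/

/-- The colours of the degenerate vertices. Insertion and removal of degenerate vertices preserve
this set as long as every branch of degenerate vertices keeps at least one of them. -/
def degenerateColors (x : X.Dendrex T) : Set X.Color :=
  {c | ∃ v, IsDegenerateAt x v ∧ color x v = c}

/-- `v` is the lowest vertex of the chosen branch of degenerate vertices. The choice is made once
and for all for every nonempty set of colours, so that it only depends on `degenerateColors x`. -/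
def IsChosen (x : X.Dendrex T) (v : T.E) : Prop :=
  IsChainBottom x v ∧ ∃ h : (degenerateColors x).Nonempty, color x v = h.some

theorem IsChosen.eq (hX : X.IsNormal) {v w : T.E} (h : IsChosen x v) (h' : IsChosen x w) :
    v = w := by
  obtain ⟨hv, _, hvc⟩ := h
  obtain ⟨hw, _, hwc⟩ := h'
  exact hv.eq hX hw (hvc.trans hwc.symm)

theorem exists_isChosen (hX : X.IsNormal) (h : ∃ v, IsDegenerateAt x v) : ∃ v, IsChosen x v := by
  have hne : (degenerateColors x).Nonempty := h.elim fun v hv => ⟨_, v, hv, rfl⟩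
  obtain ⟨v, hv, hc⟩ := hne.some_mem
  obtain ⟨b, hb, hb'⟩ := (isDegenerateAt_iff hX).1 hv
  obtain ⟨w, hw, hw'⟩ := exists_isChainBottom hX hb.ne hb'.symm
  exact ⟨w, hw, hne, hw'.trans hc⟩

theorem degenerateColors_iso (hX : X.IsNormal) (τ : S ≅ T) :
    degenerateColors (res τ.hom x) = degenerateColors x := by
  have hcolor := color_res hX x (EdgeSplit.iso τ)
  ext c
  constructor
  · rintro ⟨v, hv, hc⟩
    exact ⟨_, (isDegenerateAt_iso_iff hX τ v).1 hv, (hcolor v).symm.trans hc⟩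
  · rintro ⟨v, hv, hc⟩
    obtain ⟨y, rfl⟩ := (onEdges_hom_bijective τ).2 v
    exact ⟨y, (isDegenerateAt_iso_iff hX τ y).2 hv, (hcolor y).trans hc⟩

theorem IsChosen.iso (hX : X.IsNormal) (τ : S ≅ T) {v : S.E} (h : IsChosen (res τ.hom x) v) :
    IsChosen x (onEdges τ.hom v) := by
  have hcolor := color_res hX x (EdgeSplit.iso τ)
  obtain ⟨⟨hv, hmin⟩, hpick⟩ := h
  rw [degenerateColors_iso hX, hcolor] at hpick
  refine ⟨⟨(isDegenerateAt_iso_iff hX τ v).1 hv, fun b hb hb' => ?_⟩, hpick⟩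
  obtain ⟨y, rfl⟩ := (onEdges_hom_bijective τ).2 b
  exact hmin y ((onEdges_lt_iff _ (onEdges_hom_injective τ)).1 hb)
    (by rw [hcolor, hcolor, hb'])

section Split

variable {v i : T.E}

theorem degenerateColors_split (hX : X.IsNormal) (h : IsDegenerateAt x v)
    (hi : IsDegenerateAt x i) (σ : Split T S v i) :
    degenerateColors (res σ.s x) = degenerateColors x := by
  ext c
  constructor
  · rintro ⟨y, hy, hc⟩
    exact ⟨_, (isDegenerateAt_split_iff hX h σ y).1 hy, (color_split hX h σ y).symm.trans hc⟩
  · rintro ⟨e, he, hc⟩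
    obtain ⟨e', he', hc', hne⟩ : ∃ e', IsDegenerateAt x e' ∧ color x e' = c ∧ e' ≠ v := by
      by_cases hev : e = v
      · subst hev
        exact ⟨i, hi, (h.color_eq hX σ.unary).trans hc, σ.unary.lt.ne'⟩
      · exact ⟨e, he, hc, hev⟩
    obtain ⟨y, rfl⟩ := σ.exists_s_eq_iff.2 hne
    exact ⟨y, (isDegenerateAt_split_iff hX h σ y).2 he', (color_split hX h σ y).trans hc'⟩

theorem color_π (hX : X.IsNormal) (h : IsDegenerateAt x v) (σ : Split T S v i) (e : T.E) :
    color (res σ.s x) (onEdges σ.π e) = color x e := by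
  rw [color_split hX h]
  by_cases he : e = v
  · rw [he, σ.π_s_self, h.color_eq hX σ.unary]
  · rw [σ.π_s_apply e he]

theorem IsChainBottom.split (hX : X.IsNormal) {c : T.E} (hc : IsChainBottom x c)
    (h : IsDegenerateAt x v) (hi : IsDegenerateAt x i) (σ : Split T S v i) :
    IsChainBottom (res σ.s x) (onEdges σ.π c) := by
  refine ⟨(isDegenerateAt_split_iff hX h σ _).2 ?_, fun b hb hb' => ?_⟩
  · by_cases hcv : c = v
    · rwa [hcv, σ.π_s_self]
    · rw [σ.π_s_apply c hcv]
      exact hc.1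
  · rw [color_π hX h, color_split hX h] at hb'
    have hle := hc.le hX hb'
    rw [← σ.s_lt_iff] at hb
    by_cases hcv : c = v
    · subst hcv
      rw [σ.π_s_self, σ.unary.lt_input_iff_le] at hb
      exact σ.s_ne b (le_antisymm hb hle)
    · rw [σ.π_s_apply c hcv] at hb
      exact absurd hb (not_lt_of_ge hle)

theorem IsChosen.split (hX : X.IsNormal) {c : T.E} (hc : IsChosen x c) (h : IsDegenerateAt x v)
    (hi : IsDegenerateAt x i) (σ : Split T S v i) :
    IsChosen (res σ.s x) (onEdges σ.π c) := by
  refine ⟨hc.1.split hX h hi σ, ?_⟩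
  rw [degenerateColors_split hX h hi, color_π hX h]
  exact hc.2

theorem IsChosen.of_split (hX : X.IsNormal) (h : IsDegenerateAt x v) (σ : Split T S v i)
    (hc : IsChosen (res σ.s x) (onEdges σ.π v)) : IsChosen x v ∧ IsDegenerateAt x i := by
  obtain ⟨⟨hd, hmin⟩, hpick⟩ := hc
  have hi : IsDegenerateAt x i := by
    rwa [isDegenerateAt_split_iff hX h, σ.π_s_self] at hd
  rw [degenerateColors_split hX h hi, color_π hX h] at hpick
  refine ⟨⟨⟨h, fun b hb hb' => ?_⟩, hpick⟩, hi⟩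
  obtain ⟨y, rfl⟩ := σ.exists_s_eq_iff.2 hb.ne
  refine hmin y ?_ ?_
  · rw [← σ.s_lt_iff, σ.π_s_self]
    exact hb.trans σ.unary.lt
  · rw [color_π hX h, color_split hX h, hb']

theorem card_chain_split (hX : X.IsNormal) (h : IsDegenerateAt x v) (σ : Split T S v i) {w : S.E}
    (hw : color x (onEdges σ.s w) ≠ color x v) :
    (chain (res σ.s x) w).card = (chain x (onEdges σ.s w)).card := by
  classical
  rw [← Finset.card_image_of_injective _ σ.s_injective]
  congr 1
  ext e
  simp only [Finset.mem_image, mem_chain, color_split hX h]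
  constructor
  · rintro ⟨y, hy, rfl⟩
    exact hy
  · intro he
    obtain ⟨y, rfl⟩ := (σ.exists_s_eq_iff (e := e)).2 (by rintro rfl; exact hw he.symm)
    exact ⟨y, he, rfl⟩

theorem card_chain_π (hX : X.IsNormal) (h : IsDegenerateAt x v) (σ : Split T S v i) :
    (chain x v).card = (chain (res σ.s x) (onEdges σ.π v)).card + 1 := by
  classical
  rw [← Finset.card_image_of_injective _ σ.s_injective,
    ← Finset.card_insert_of_notMem (a := v) (by
      rw [Finset.mem_image]
      rintro ⟨y, -, hy⟩
      exact σ.s_ne y hy)]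
  congr 1
  ext e
  simp only [Finset.mem_insert, Finset.mem_image, mem_chain, color_split hX h, σ.π_s_self,
    h.color_eq hX σ.unary]
  constructor
  · intro he
    refine or_iff_not_imp_left.2 fun hv => ?_
    obtain ⟨y, rfl⟩ := σ.exists_s_eq_iff.2 hv
    exact ⟨y, he, rfl⟩
  · rintro (rfl | ⟨y, hy, rfl⟩)
    · rfl
    · exact hy

theorem isChainBottom_split_iff (hX : X.IsNormal) (h : IsDegenerateAt x v) (σ : Split T S v i)
    {w : S.E} (hw : color x (onEdges σ.s w) ≠ color x v) :
    IsChainBottom (res σ.s x) w ↔ IsChainBottom x (onEdges σ.s w) := by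
  refine and_congr (isDegenerateAt_split_iff hX h σ w)
    ⟨fun hmin b hb hb' => ?_, fun hmin b hb hb' => ?_⟩
  · obtain ⟨y, rfl⟩ := (σ.exists_s_eq_iff (e := b)).2 (by rintro rfl; exact hw hb'.symm)
    refine hmin y (σ.s_lt_iff.1 hb) ?_
    rw [color_split hX h, color_split hX h, hb']
  · refine hmin _ (σ.s_lt_iff.2 hb) ?_
    rw [← color_split hX h, ← color_split hX h, hb']

end Split

theorem IsChainBottom.isDegenerateAt_iff_three_le_card (hX : X.IsNormal) {v i : T.E}
    (h : IsChainBottom x v) (hu : T.IsUnary v i) :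
    IsDegenerateAt x i ↔ 3 ≤ (chain x v).card := by
  classical
  have hi := h.1.color_eq hX hu
  rw [isDegenerateAt_iff hX, hi]
  constructor
  · rintro ⟨b, hb, hb'⟩
    rw [← Finset.card_eq_three.2 ⟨v, i, b, hu.lt.ne, (hu.lt.trans hb).ne, hb.ne, rfl⟩]
    refine Finset.card_le_card fun e he => ?_
    simp only [Finset.mem_insert, Finset.mem_singleton] at he
    rcases he with rfl | rfl | rfl <;> simp [*]
  · intro hc
    obtain ⟨e, he, he'⟩ := Finset.exists_mem_notMem_of_card_lt_card
      (s := {v, i}) (t := chain x v) (Finset.card_le_two.trans_lt hc)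
    simp only [Finset.mem_insert, Finset.mem_singleton, not_or] at he'
    have hev := mem_chain.1 he
    exact ⟨e, lt_of_le_of_ne
      (hu.vertex_lt_iff_le.1 (lt_of_le_of_ne (h.le hX hev) (Ne.symm he'.1))) (Ne.symm he'.2), hev⟩

theorem isDegenerateAt_of_mem_evenChainBottoms (hX : X.IsNormal) {v i : T.E}
    (h : v ∈ evenChainBottoms x) (hu : T.IsUnary v i) : IsDegenerateAt x i := by
  classical
  obtain ⟨hv, r, hr⟩ := mem_evenChainBottoms.1 h
  have hcard : 1 < (chain x v).card := Finset.one_lt_card.2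
    ⟨v, by simp, i, by simpa using hv.1.color_eq hX hu, hu.lt.ne⟩
  rw [hv.isDegenerateAt_iff_three_le_card hX hu]
  omega

theorem evenChainBottoms_split (hX : X.IsNormal) [DecidableEq S.E] [DecidableEq T.E] {c i : T.E}
    (h : IsChainBottom x c) (hi : IsDegenerateAt x i) (σ : Split T S c i) :
    ((evenChainBottoms (res σ.s x)).erase (onEdges σ.π c)).image (onEdges σ.s) =
      (evenChainBottoms x).erase c := by
  ext e
  simp only [Finset.mem_image, Finset.mem_erase, mem_evenChainBottoms]
  constructor
  · rintro ⟨w, ⟨hne, hb, hodd⟩, rfl⟩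
    have hw : color x (onEdges σ.s w) ≠ color x c := by
      intro hw
      refine hne (hb.eq hX (h.split hX h.1 hi σ) ?_)
      rw [color_π hX h.1, color_split hX h.1, hw]
    refine ⟨σ.s_ne w, (isChainBottom_split_iff hX h.1 σ hw).1 hb, ?_⟩
    rwa [← card_chain_split hX h.1 σ hw]
  · rintro ⟨hne, hb, hodd⟩
    have hw : color x e ≠ color x c := fun hw => hne (hb.eq hX h hw)
    obtain ⟨w, rfl⟩ := σ.exists_s_eq_iff.2 hne
    refine ⟨w, ⟨?_, (isChainBottom_split_iff hX h.1 σ hw).2 hb, ?_⟩, rfl⟩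
    · rintro rfl
      rw [σ.π_s_self] at hw
      exact hw (h.1.color_eq hX σ.unary)
    · rwa [card_chain_split hX h.1 σ hw]

/-- `k` is obtained from `g` by lengthening the chosen branch of degenerate vertices by the new
lowest vertex `c`. -/
def IsChainExtension (k : X.Gen (n + 1)) (c : k.tree.E) (g : X.Gen n) : Prop :=
  ∃ (i : k.tree.E) (σ : Split k.tree g.tree c i), IsDegenerateAt k.dendrex c ∧
    g.dendrex = res σ.s k.dendrex ∧ g.planar = k.planar.pullback σ.s ∧
    IsChosen g.dendrex (onEdges σ.π c)

theorem isChainExtension_pull (hX : X.IsNormal) {k : X.Gen (n + 1)} {c i : k.tree.E}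
    (hc : IsChosen k.dendrex c) (hi : IsDegenerateAt k.dendrex i) (σ : Split k.tree S c i)
    (hS : S.size = n) : IsChainExtension k c (k.pull σ.s hS) :=
  ⟨i, σ, hc.1.1, rfl, rfl, hc.split hX hc.1.1 hi σ⟩

theorem exists_isChainExtension (hX : X.IsNormal) {g : X.Gen n}
    (h : ∃ v, IsDegenerateAt g.dendrex v) :
    ∃ (k : X.Gen (n + 1)) (c : k.tree.E), IsChainExtension k c g := by
  obtain ⟨v, hv⟩ := exists_isChosen hX h
  obtain ⟨σ, hσ⟩ := exists_degenSplit g.tree v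
  refine ⟨⟨g.tree.degen v, (size_degen _ _).trans (congrArg (· + 1) g.size_eq),
    g.planar.pullback σ.π, res σ.π g.dendrex⟩, (some v : Option g.tree.E), none, σ,
    isDegenerateAt_of_eq σ.π rfl σ.unary σ.π_eq, ?_, ?_, ?_⟩
  · rw [← res_comp, σ.s_π, res_id]
  · rw [← Planar.pullback_comp, σ.s_π, Planar.pullback_id]
  · rw [hσ]
    exact hv

namespace IsChainExtension

variable {k : X.Gen (n + 1)} {c : k.tree.E} {g : X.Gen n}

theorem exists_isDegenerateAt (h : IsChainExtension k c g) :
    ∃ v, IsDegenerateAt g.dendrex v := by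
  obtain ⟨i, σ, -, -, -, h⟩ := h
  exact ⟨_, h.1.1⟩

theorem isDegenerateAt (h : IsChainExtension k c g) : IsDegenerateAt k.dendrex c := by
  obtain ⟨i, σ, h, -⟩ := h
  exact h

theorem rank_eq (hX : X.IsNormal) (h : IsChainExtension k c g) :
    rank g.dendrex = rank k.dendrex := by
  obtain ⟨i, σ, hc, hg, -⟩ := h
  rw [hg, rank_split hX hc]

theorem eq (hX : X.IsNormal) {k' : X.Gen (n + 1)} {c' : k'.tree.E} {g' : X.Gen n}
    (h : IsChainExtension k c g) (h' : IsChainExtension k' c' g') (τ : g'.tree ≅ g.tree)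
    (hτ : g'.dendrex = res τ.hom g.dendrex) :
    (-1 : ℤ) ^ k.planar.label c • cls k = Planar.sgn g'.planar (g.planar.pullback τ.hom) •
      (-1 : ℤ) ^ k'.planar.label c' • cls k' := by
  obtain ⟨i, σ, h1, h2, h3, h4⟩ := h
  obtain ⟨i', σ', h1', h2', h3', h4'⟩ := h'
  rw [hτ] at h4'
  obtain ⟨ψ, hπ, hc, hs⟩ := σ'.exists_iso σ τ ((h4'.iso hX).eq hX h4)
  have hk : k'.dendrex = res ψ.hom k.dendrex := by
    have hcomm : (σ'.π ≫ τ.hom) ≫ σ.s = ψ.hom ≫ σ.π ≫ σ.s := by rw [← hπ, Category.assoc]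
    rw [← h1'.res_eq σ', res_comp, ← h2', hτ, h2, ← res_comp, ← res_comp, hcomm, res_comp,
      h1.res_eq σ]
  have hsq : ((-1 : ℤ) ^ k.planar.label c) * (-1) ^ k.planar.label c = 1 := by
    rw [← mul_pow]
    simp
  rw [cls_iso ψ hk, Planar.sgn_eq_mul_of_removesVertex σ'.removesVertex,
    Planar.label_pullback_hom, hc, ← h3', ← Planar.pullback_comp, hs, Planar.pullback_comp, ← h3,
    smul_smul, smul_smul]
  congr 1
  linear_combination Planar.sgn g'.planar (g.planar.pullback τ.hom) *
    (-1 : ℤ) ^ k'.planar.label c' * hsq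

end IsChainExtension

open Classical in
/-- The contracting homotopy on generators: lengthen the chosen branch of degenerate vertices. The
value is `0` if there are no degenerate vertices. -/
noncomputable def homotopyGen (g : X.Gen n) : X.UnGroup (n + 1) :=
  if h : ∃ (k : X.Gen (n + 1)) (c : k.tree.E), IsChainExtension k c g then
    (-1 : ℤ) ^ h.choose.planar.label h.choose_spec.choose • cls h.choose
  else 0

theorem exists_isDegenerateAt_iso_iff (hX : X.IsNormal) (τ : S ≅ T) :
    (∃ v, IsDegenerateAt (res τ.hom x) v) ↔ ∃ v, IsDegenerateAt x v := by
  rw [(onEdges_hom_bijective τ).2.exists]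
  exact exists_congr (isDegenerateAt_iso_iff hX τ)

theorem homotopyGen_iso (hX : X.IsNormal) {g g' : X.Gen n} (τ : g'.tree ≅ g.tree)
    (hτ : g'.dendrex = res τ.hom g.dendrex) :
    homotopyGen g = Planar.sgn g'.planar (g.planar.pullback τ.hom) • homotopyGen g' := by
  have hiff : (∃ v, IsDegenerateAt g'.dendrex v) ↔ ∃ v, IsDegenerateAt g.dendrex v := by
    rw [hτ]
    exact exists_isDegenerateAt_iso_iff hX τ
  by_cases h : ∃ (k : X.Gen (n + 1)) (c : k.tree.E), IsChainExtension k c g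
  · have h' : ∃ (k : X.Gen (n + 1)) (c : k.tree.E), IsChainExtension k c g' :=
      exists_isChainExtension hX (hiff.2 h.choose_spec.choose_spec.exists_isDegenerateAt)
    rw [homotopyGen, homotopyGen, dif_pos h, dif_pos h']
    exact h.choose_spec.choose_spec.eq hX h'.choose_spec.choose_spec τ hτ
  · have h' : ¬ ∃ (k : X.Gen (n + 1)) (c : k.tree.E), IsChainExtension k c g' := fun h' =>
      h (exists_isChainExtension hX (hiff.1 h'.choose_spec.choose_spec.exists_isDegenerateAt))
    rw [homotopyGen, homotopyGen, dif_neg h, dif_neg h', smul_zero]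

/-- The homotopy which contracts the successive quotients of the filtration of the degenerate
chains by the number of nondegenerate vertices. -/
noncomputable def homotopy (hX : X.IsNormal) (n : ℕ) : X.UnGroup n →ₗ[ℤ] X.UnGroup (n + 1) :=
  (X.A n).liftQ (Finsupp.linearCombination ℤ homotopyGen) <| by
    rw [A, Submodule.span_le]
    rintro _ ⟨g, g', τ, h, rfl⟩
    rw [SetLike.mem_coe, LinearMap.mem_ker, map_sub, Finsupp.linearCombination_single,
      Finsupp.linearCombination_single, one_smul, homotopyGen_iso hX τ h, sub_self]

theorem homotopy_cls (hX : X.IsNormal) {k : X.Gen (n + 1)} {c : k.tree.E} {g : X.Gen n}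
    (h : IsChainExtension k c g) :
    homotopy hX n (cls g) = (-1 : ℤ) ^ k.planar.label c • cls k := by
  have hgen : homotopy hX n (cls g) = homotopyGen g := by
    refine ((X.A n).liftQ_apply _ _).trans ?_
    rw [Finsupp.linearCombination_single, one_smul]
  have hex : ∃ (k : X.Gen (n + 1)) (c : k.tree.E), IsChainExtension k c g := ⟨k, c, h⟩
  rw [hgen, homotopyGen, dif_pos hex,
    hex.choose_spec.choose_spec.eq hX h (Iso.refl _) (res_id _).symm, Iso.refl_hom,
    Planar.pullback_id, Planar.sgn_self, one_smul]

theorem IsChainBottom.isDegenerateAt_input_split (hX : X.IsNormal) {x : X.Dendrex T}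
    {c i v i' : T.E} (hc : IsChainBottom x c) (hu : T.IsUnary c i) (hi : IsDegenerateAt x i)
    (hv : IsChainBottom x v) (hcv : c ≠ v) (σ : Split T S v i')
    (hc' : IsChainBottom (res σ.s x) (onEdges σ.π c)) {j : S.E}
    (hj : S.IsUnary (onEdges σ.π c) j) : IsDegenerateAt (res σ.s x) j := by
  have hsc : onEdges σ.s (onEdges σ.π c) = c := σ.π_s_apply c hcv
  have hcolor : color x c ≠ color x v := fun h => hcv (hc.eq hX hv h)
  rw [hc'.isDegenerateAt_iff_three_le_card hX hj, card_chain_split hX hv.1 σ (by rwa [hsc]), hsc]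
  exact (hc.isDegenerateAt_iff_three_le_card hX hu).1 hi

section Pull

variable {k : X.Gen (n + 1 + 1)} {c i : k.tree.E} (σ : Split k.tree S c i) (hS : S.size = n + 1)

theorem collapse_pull {S' : OTree} {w : S.E} {i' : k.tree.E}
    (hw : IsDegenerateAt (res σ.s k.dendrex) w) (σ' : Split k.tree S' (onEdges σ.s w) i')
    (hS' : S'.size = n + 1) {j : S'.E} (τ : Split S' R (onEdges σ'.π c) j) (hR : R.size = n) :
    collapse (k.pull σ.s hS) w = cls ((k.pull σ'.s hS').pull τ.s hR) := by
  obtain ⟨j', R', τ', -⟩ := id hw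
  have hR' : R'.size = n := (k.pull σ.s hS).size_split τ'
  obtain ⟨φ, hφ⟩ := σ.exists_iso_of_comm τ' σ' τ rfl (σ'.π_s_apply c (σ.s_ne w).symm)
  calc collapse (k.pull σ.s hS) w
      = cls ((k.pull σ.s hS).pull τ'.s hR') := collapse_eq (g := k.pull σ.s hS) hw τ' hR'
    _ = cls (k.pull (τ'.s ≫ σ.s) hR') := congrArg cls (k.pull_pull σ.s hS τ'.s hR')
    _ = cls (k.pull (τ.s ≫ σ'.s) hR) := (cls_pull_iso k φ hφ hR' hR).symm
    _ = cls ((k.pull σ'.s hS').pull τ.s hR) := (congrArg cls (k.pull_pull σ'.s hS' τ.s hR)).symm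

variable (hX : X.IsNormal) (hc : IsChosen k.dendrex c) (hi : IsDegenerateAt k.dendrex i)

include hc hi

theorem homotopy_collapse {w : S.E} (hw : onEdges σ.s w ∈ evenChainBottoms k.dendrex) :
    (-1 : ℤ) ^ (k.planar.pullback σ.s).label w • homotopy hX n (collapse (k.pull σ.s hS) w) =
      -((-1 : ℤ) ^ k.planar.label c • (-1 : ℤ) ^ k.planar.label (onEdges σ.s w) •
        collapse k (onEdges σ.s w)) := by
  obtain ⟨hb, -⟩ := mem_evenChainBottoms.1 hw
  have hcv : c ≠ onEdges σ.s w := (σ.s_ne w).symm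
  obtain ⟨i', S', σ', -⟩ := id hb.1
  have hi' : IsDegenerateAt k.dendrex i' := isDegenerateAt_of_mem_evenChainBottoms hX hw σ'.unary
  have hS' := k.size_split σ'
  have hc' : IsChosen (res σ'.s k.dendrex) (onEdges σ'.π c) := hc.split hX hb.1 hi' σ'
  obtain ⟨j, R, τ, -⟩ := id hc'.1.1
  have hj : IsDegenerateAt (res σ'.s k.dendrex) j :=
    hc.1.isDegenerateAt_input_split hX σ.unary hi hb hcv σ' hc'.1 τ.unary
  have hR : R.size = n := (k.pull σ'.s hS').size_split τ
  have hext : IsChainExtension (k.pull σ'.s hS') (onEdges σ'.π c)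
      ((k.pull σ'.s hS').pull τ.s hR) :=
    isChainExtension_pull (k := k.pull σ'.s hS') hX hc' hj τ hR
  have hlabel : k.planar.label (onEdges σ.s w) + k.planar.label c =
      (k.planar.pullback σ.s).label w + (k.planar.pullback σ'.s).label (onEdges σ'.π c) + 1 := by
    have hlw := Planar.label_onEdges_of_removesVertex σ.removesVertex k.planar w
    have hlc := Planar.label_onEdges_of_removesVertex σ'.removesVertex k.planar (onEdges σ'.π c)
    have hlt := Planar.before_add_before (p := k.planar) hcv
    rw [σ'.π_s_apply c hcv] at hlc
    omega
  rw [collapse_pull σ hS ((isDegenerateAt_split_iff hX hc.1.1 σ w).2 hb.1) σ' hS' τ hR,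
    homotopy_cls hX hext, collapse_eq hb.1 σ' hS', smul_smul, smul_smul, ← neg_smul, ← pow_add,
    ← pow_add, add_comm (k.planar.label c), hlabel, pow_succ, mul_neg_one, neg_neg]
  rfl

theorem sum_homotopy_collapse_add_sum_collapse [DecidableEq S.E] [DecidableEq k.tree.E] :
    ∑ w ∈ (evenChainBottoms (res σ.s k.dendrex)).erase (onEdges σ.π c),
        (-1 : ℤ) ^ (k.planar.pullback σ.s).label w • homotopy hX n (collapse (k.pull σ.s hS) w) +
      ∑ w ∈ (evenChainBottoms k.dendrex).erase c,
        (-1 : ℤ) ^ k.planar.label c • (-1 : ℤ) ^ k.planar.label w • collapse k w = 0 := by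
  rw [← evenChainBottoms_split hX hc.1 hi σ, Finset.sum_image fun _ _ _ _ h => σ.s_injective h,
    ← Finset.sum_add_distrib]
  refine Finset.sum_eq_zero fun w hw => ?_
  have hsw := Finset.mem_image_of_mem (onEdges σ.s) hw
  rw [evenChainBottoms_split hX hc.1 hi σ] at hsw
  rw [homotopy_collapse σ hS hX hc hi (Finset.mem_of_mem_erase hsw), neg_add_cancel]

-- Lengthening the branch of `c` changes the parity of its number of edges, so exactly one of the
-- two sums has a term at `c`, and that term is `cls (k.pull σ.s hS)`.
theorem homotopy_sum_collapse_add_sum_collapse :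
    homotopy hX n (∑ w ∈ evenChainBottoms (res σ.s k.dendrex),
        (-1 : ℤ) ^ (k.planar.pullback σ.s).label w • collapse (k.pull σ.s hS) w) +
      (-1 : ℤ) ^ k.planar.label c •
        ∑ w ∈ evenChainBottoms k.dendrex, (-1 : ℤ) ^ k.planar.label w • collapse k w =
      cls (k.pull σ.s hS) := by
  classical
  have hcancel := sum_homotopy_collapse_add_sum_collapse σ hS hX hc hi
  have hcard := card_chain_π hX hc.1.1 σ
  have hc' := hc.split hX hc.1.1 hi σ
  have hsq (m : ℕ) : (-1 : ℤ) ^ m * (-1) ^ m = 1 := by rw [← mul_pow, neg_mul_neg, one_mul, one_pow]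
  rw [map_sum, Finset.smul_sum]
  simp only [map_smul]
  by_cases hodd : Odd (chain k.dendrex c).card
  · have hmem : c ∈ evenChainBottoms k.dendrex := mem_evenChainBottoms.2 ⟨hc.1, hodd⟩
    have hnotMem : onEdges σ.π c ∉ evenChainBottoms (res σ.s k.dendrex) := fun h =>
      Nat.not_odd_iff_even.2 (mem_evenChainBottoms.1 h).2.add_one (hcard ▸ hodd)
    rw [Finset.erase_eq_of_notMem hnotMem] at hcancel
    rw [← Finset.add_sum_erase _ _ hmem, add_left_comm, hcancel, add_zero, smul_smul, hsq, one_smul,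
      collapse_eq hc.1.1 σ hS]
  · have hmem : onEdges σ.π c ∈ evenChainBottoms (res σ.s k.dendrex) := by
      rw [hcard, Nat.odd_add_one, not_not] at hodd
      exact mem_evenChainBottoms.2 ⟨hc'.1, hodd⟩
    have hnotMem : c ∉ evenChainBottoms k.dendrex := fun h => hodd (mem_evenChainBottoms.1 h).2
    rw [Finset.erase_eq_of_notMem hnotMem] at hcancel
    obtain ⟨j, R, τ, -⟩ := id hc'.1.1
    have hj := isDegenerateAt_of_mem_evenChainBottoms hX hmem τ.unary
    have hR := (k.pull σ.s hS).size_split τ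
    have hext : IsChainExtension (k.pull σ.s hS) (onEdges σ.π c) ((k.pull σ.s hS).pull τ.s hR) :=
      isChainExtension_pull (k := k.pull σ.s hS) hX hc' hj τ hR
    rw [← Finset.add_sum_erase _ _ hmem, add_assoc, hcancel, add_zero,
      collapse_eq (g := k.pull σ.s hS) hc'.1.1 τ hR, homotopy_cls hX hext, smul_smul]
    exact (congrArg (· • cls (k.pull σ.s hS)) (hsq _)).trans (one_smul ℤ _)

end Pull

theorem IsChainExtension.homotopy_sum_add_sum (hX : X.IsNormal) {k : X.Gen (n + 1 + 1)}
    {c : k.tree.E} {g : X.Gen (n + 1)} (h : IsChainExtension k c g) :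
    homotopy hX n
        (∑ w ∈ evenChainBottoms g.dendrex, (-1 : ℤ) ^ g.planar.label w • collapse g w) +
      (-1 : ℤ) ^ k.planar.label c •
        ∑ w ∈ evenChainBottoms k.dendrex, (-1 : ℤ) ^ k.planar.label w • collapse k w = cls g := by
  obtain ⟨T, hT, p, x⟩ := g
  obtain ⟨i, σ, hd, hx, hp, hc⟩ := h
  dsimp only at σ hx hp hc ⊢
  subst hx hp
  obtain ⟨hc, hi⟩ := hc.of_split hX hd σ
  exact homotopy_sum_collapse_add_sum_collapse σ hT hX hc hi

theorem degenerateFiltration_mono {a b : ℕ} (hab : a ≤ b) (n : ℕ) :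
    X.degenerateFiltration a n ≤ X.degenerateFiltration b n := by
  rw [degenerateFiltration, Submodule.span_le]
  rintro _ ⟨g, h, h', rfl⟩
  exact cls_mem_degenerateFiltration h (h'.trans_le hab)

theorem homotopy_mem_degenerateFiltration (hX : X.IsNormal) {k : ℕ} {z : X.UnGroup n}
    (hz : z ∈ X.degenerateFiltration k n) :
    homotopy hX n z ∈ X.degenerateFiltration k (n + 1) := by
  suffices X.degenerateFiltration k n ≤
    (X.degenerateFiltration k (n + 1)).comap (homotopy hX n) from this hz
  rw [degenerateFiltration, Submodule.span_le]
  rintro _ ⟨g, h, h', rfl⟩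
  rw [SetLike.mem_coe, Submodule.mem_comap]
  obtain ⟨l, c, hl⟩ := exists_isChainExtension hX h
  rw [homotopy_cls hX hl]
  exact Submodule.smul_mem _ _
    (cls_mem_degenerateFiltration ⟨c, hl.isDegenerateAt⟩ (by rwa [← hl.rank_eq hX]))

theorem homotopy_sub_mem_degenerateFiltration (hX : X.IsNormal) (h : X.BoundaryDescends) {k : ℕ}
    {z : X.UnGroup (n + 1)} (hz : z ∈ X.degenerateFiltration (k + 1) (n + 1)) :
    homotopy hX n (d h n z) + d h (n + 1) (homotopy hX (n + 1) z) - z ∈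
      X.degenerateFiltration k (n + 1) := by
  suffices X.degenerateFiltration (k + 1) (n + 1) ≤ (X.degenerateFiltration k (n + 1)).comap
      (homotopy hX n ∘ₗ d h n + d h (n + 1) ∘ₗ homotopy hX (n + 1) - LinearMap.id) from this hz
  rw [degenerateFiltration, Submodule.span_le]
  rintro _ ⟨g, hg, hr, rfl⟩
  change homotopy hX n (d h n (cls g)) + d h (n + 1) (homotopy hX (n + 1) (cls g)) - cls g ∈
    X.degenerateFiltration k (n + 1)
  obtain ⟨l, c, hl⟩ := exists_isChainExtension hX hg
  rw [homotopy_cls hX hl, map_smul, d_cls, d_cls]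
  have hdg := homotopy_mem_degenerateFiltration hX
    (boundaryCls_sub_mem_degenerateFiltration hX g hg)
  have hdl := Submodule.smul_mem _ ((-1 : ℤ) ^ l.planar.label c)
    (boundaryCls_sub_mem_degenerateFiltration hX l ⟨c, hl.isDegenerateAt⟩)
  rw [← hl.rank_eq hX] at hdl
  convert degenerateFiltration_mono (Nat.le_of_lt_succ hr) _
    ((X.degenerateFiltration _ _).add_mem hdg hdl) using 1
  rw [← hl.homotopy_sum_add_sum hX, map_sub, smul_sub]
  abel

theorem exists_d_eq_of_mem_degenerateFiltration (hX : X.IsNormal) (h : X.BoundaryDescends) {k : ℕ}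
    {z : X.UnGroup (n + 1)} (hz : z ∈ X.degenerateFiltration k (n + 1)) (hd : d h n z = 0) :
    ∃ w ∈ X.D (n + 1 + 1), d h (n + 1) w = z := by
  induction k generalizing z with
  | zero =>
    rw [degenerateFiltration_zero, Submodule.mem_bot] at hz
    exact ⟨0, zero_mem _, by rw [map_zero, hz]⟩
  | succ k ih =>
    have hmem := homotopy_sub_mem_degenerateFiltration hX h hz
    rw [hd, map_zero, zero_add] at hmem
    obtain ⟨w, hw, hdw⟩ := ih hmem (by
      rw [map_sub, hd, sub_zero]
      exact LinearMap.congr_fun (d_comp_d h n) _)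
    refine ⟨homotopy hX (n + 1) z - w, (X.D _).sub_mem
      (degenerateFiltration_le_D _ _ (homotopy_mem_degenerateFiltration hX hz)) hw, ?_⟩
    rw [map_sub, hdw, sub_sub_cancel]

theorem exists_d_eq_of_mem_D (hX : X.IsNormal) (h : X.BoundaryDescends) {z : X.UnGroup (n + 1)}
    (hz : z ∈ X.D (n + 1)) (hd : d h n z = 0) : ∃ w ∈ X.D (n + 1 + 1), d h (n + 1) w = z :=
  exists_d_eq_of_mem_degenerateFiltration hX h (D_le_degenerateFiltration _ hz) hd

theorem D_zero : X.D 0 = ⊥ := by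
  rw [D, Submodule.span_eq_bot]
  rintro _ ⟨g, hg, -⟩
  obtain ⟨v, i, S, σ, -⟩ := isDegenerate_iff.1 hg
  have hS := σ.size_eq
  have hg := g.size_eq
  omega

end DSet

/-! ### The quotient map -/

open ZeroObject in
theorem quasiIso_g_of_acyclic {C ι : Type*} [Category* C] [Abelian C] {c : ComplexShape ι}
    {S : ShortComplex (HomologicalComplex C c)} (hS : S.ShortExact) (h : S.X₁.Acyclic) :
    QuasiIso S.g := by
  let S₀ : ShortComplex (HomologicalComplex C c) := .mk (0 : 0 ⟶ S.X₂) (𝟙 S.X₂) Limits.zero_comp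
  have hmono : Mono S₀.g := inferInstanceAs (Mono (𝟙 S.X₂))
  have hS₀ : S₀.ShortExact :=
    { exact := (S₀.exact_iff_mono rfl).2 hmono
      mono_f := inferInstanceAs (Mono (0 : 0 ⟶ S.X₂))
      epi_g := inferInstanceAs (Epi (𝟙 S.X₂)) }
  let φ : S₀ ⟶ S :=
    { τ₁ := 0
      τ₂ := 𝟙 S.X₂
      τ₃ := S.g
      comm₁₂ := Limits.zero_comp.trans Limits.zero_comp.symm
      comm₂₃ := rfl }
  have h₁ : QuasiIso φ.τ₁ := ⟨fun i => (quasiIsoAt_iff_exactAt _ i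
    (HomologicalComplex.acyclic_of_isZero _ (Limits.isZero_zero _) i)).2 (h i)⟩
  have h₂ : QuasiIso φ.τ₂ := inferInstanceAs (QuasiIso (𝟙 S.X₂))
  exact HomologicalComplex.HomologySequence.quasiIso_τ₃ φ hS₀ hS h₁ h₂

namespace DSet

variable {X : DSet.{u}}

/-- The complex `D(X)` of degenerate dendrices, as a chain complex of its own. -/
noncomputable def degenerateComplex (h : X.BoundaryDescends)
    (hd : ∀ n, d h n ∘ₗ d h (n + 1) = 0) (hD : ∀ n, X.D (n + 1) ≤ (X.D n).comap (d h n)) :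
    ChainComplex (ModuleCat.{max 1 u} ℤ) ℕ :=
  ChainComplex.of (fun n => ModuleCat.of ℤ (X.D n))
    (fun n => ModuleCat.ofHom ((d h n).restrict (hD n)))
    fun n => ModuleCat.hom_ext (LinearMap.ext fun x => Subtype.ext (LinearMap.congr_fun (hd n) x))

variable (h : X.BoundaryDescends) (hd : ∀ n, d h n ∘ₗ d h (n + 1) = 0)
  (hD : ∀ n, X.D (n + 1) ≤ (X.D n).comap (d h n))

theorem degenerateComplex_d (n : ℕ) :
    (degenerateComplex h hd hD).d (n + 1) n = ModuleCat.ofHom ((d h n).restrict (hD n)) :=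
  ChainComplex.of_d (fun n => ModuleCat.of ℤ (X.D n))
    (fun n => ModuleCat.ofHom ((d h n).restrict (hD n))) n

/-- The inclusion of the complex `D(X)` into `Ch^{un}(X)`. -/
noncomputable def degenerateComplexι : degenerateComplex h hd hD ⟶ chUn h hd :=
  ChainComplex.ofHom (fun n => ModuleCat.ofHom (X.D n).subtype) fun n => by
    have hun : (chUn h hd).d (n + 1) n = ModuleCat.ofHom (d h n) :=
      ChainComplex.of_d (fun n => ModuleCat.of ℤ (X.UnGroup n)) (fun n => ModuleCat.ofHom (d h n)) n
    rw [degenerateComplex_d]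
    exact congrArg (ModuleCat.ofHom (X.D (n + 1)).subtype ≫ ·) hun

theorem degenerateComplexι_comp_chUnToCh :
    degenerateComplexι h hd hD ≫ chUnToCh h hd hD = 0 := by
  ext n x
  exact (Submodule.Quotient.mk_eq_zero _).2 x.2

theorem shortExact_degenerateComplex :
    (ShortComplex.mk _ _ (degenerateComplexι_comp_chUnToCh h hd hD)).ShortExact :=
  HomologicalComplex.shortExact_of_degreewise_shortExact _ fun n =>
    ModuleCat.shortComplex_shortExact _ (LinearMap.exact_subtype_mkQ (X.D n))
      (X.D n).injective_subtype (X.D n).mkQ_surjective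

theorem degenerateComplex_acyclic (hX : X.IsNormal) : (degenerateComplex h hd hD).Acyclic := by
  rintro (_ | n)
  · have : Subsingleton (X.D 0) := (Submodule.subsingleton_iff_eq_bot).2 D_zero
    exact ShortComplex.exact_of_isZero_X₂ _ (ModuleCat.isZero_of_subsingleton (.of ℤ (X.D 0)))
  · rw [HomologicalComplex.exactAt_iff' _ (n + 1 + 1) (n + 1) n (by simp) (by simp),
      ShortComplex.moduleCat_exact_iff]
    intro z hz
    change (degenerateComplex h hd hD).d (n + 1) n z = 0 at hz
    rw [degenerateComplex_d] at hz
    obtain ⟨w, hw, hwz⟩ := exists_d_eq_of_mem_D hX h z.2 (congrArg Subtype.val hz)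
    refine ⟨⟨w, hw⟩, ?_⟩
    change (degenerateComplex h hd hD).d (n + 1 + 1) (n + 1) _ = z
    rw [degenerateComplex_d]
    exact Subtype.ext hwz

theorem quasiIso_chUnToCh (hX : X.IsNormal) : QuasiIso (chUnToCh h hd hD) :=
  quasiIso_g_of_acyclic (shortExact_degenerateComplex h hd hD)
    (degenerateComplex_acyclic h hd hD hX)

end DSet

/-- For every normal dendroidal set `X`, the differential of `Ch^{un}(X)` is well defined and squares to
zero, the degenerate dendrices span a subcomplex `D(X)`, and the quotient map
`Ch^{un}(X) → Ch(X) = Ch^{un}(X) / D(X)` is a quasi-isomorphism. -/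
theorem corollary5p5 (X : DSet.{u}) (hX : X.IsNormal) :
    ∃ (h : X.BoundaryDescends) (hd : ∀ n, DSet.d h n ∘ₗ DSet.d h (n + 1) = 0)
      (hD : ∀ n, X.D (n + 1) ≤ (X.D n).comap (DSet.d h n)),
      QuasiIso (DSet.chUnToCh h hd hD) :=
  ⟨DSet.boundaryDescends X, DSet.d_comp_d _, DSet.D_le_comap _, DSet.quasiIso_chUnToCh _ _ _ hX⟩
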